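/- **Conventions.** Digraphs are finite, may have loops and parallel edges, and need not be connected; edges are objects of their own, with a tail and a head. A digraph is *Eulerian* if every vertex has equal in- and out-degree. For $X\subseteq V(G)$ let $\rho^+(X)$ (resp. $\rho^-(X)$) be the set of edges leaving (resp. entering) $X$, and $\rho(X)=\rho^+(X)\cup\rho^-(X)$; write $\rho(v)=\rho(\{v\})$ (so loops are not in $\rho(v)$). An *ordering* of a finite set is a repetition-free enumeration of it. A *path* is a nonempty sequence $(e_1,\dots,e_m)$ of distinct edges with $\mathrm{head}(e_i)=\mathrm{tail}(e_{i+1})$; vertices may repeat. It starts in $\mathrm{tail}(e_1)$, ends in $\mathrm{head}(e_m)$, and its internal vertices are $\mathrm{head}(e_1),\dots,\mathrm{head}(e_{m-1})$. **Links.** A *matching* of $(E_1,E_2)$ is a set $M\subseteq E_1\times E_2$ in which every element of $E_1$ and every element of $E_2$ occurs at most once; it is *perfect* if each of them occurs. A *link* $\mathfrak M$ on $(E_1,E_2)$ is a set of matchings of $(E_1,E_2)$. It is *reliable* if $M'\subseteq M\in\mathfrak M$ implies $M'\in\mathfrak M$. It is *well-linked* if for all disjoint (possibly empty) $X_1,Y_1\subseteq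 E_1$ and all disjoint $X_2,Y_2\subseteq E_2$ with $|X_1|=|X_2|$ and $|Y_1|=|Y_2|$ there are perfect matchings $M_X$ of $(X_1,X_2)$ and $M_Y$ of $(Y_1,Y_2)$ with $M_X\cup M_Y\in\mathfrak M$. **Knitworks.** Let $\Omega=(V(\Omega),\preceq)$ be a well-quasi-order (reflexive, transitive, and every infinite sequence $(a_i)$ has $i<j$ with $a_i\preceq a_j$). An *$\Omega$-knitwork* is a tuple $((G,\pi(X)),\mu,\mathfrak m,\Phi)$ where $G$ is an Eulerian digraph, $X\subseteq V(G)$, $\pi(X)$ is an ordering of $\rho(X)$ (the *roots*), and $\mu,\mathfrak m,\Phi$ are partial functions on $V(G)$ such that $\mu(v)$ is an ordering of $\rho(v)$; $\mathrm{dom}(\mathfrak m)\subseteq\mathrm{dom}(\mu)$ and $\mathfrak m(v)$ is a reliable link on $(\rho^-(v),\rho^+(v))$; and $\Phi(v)\in V(\Omega)$. It is *well-linked* if every $\mathfrak m(v)$, $v\in\mathrm{dom}(\mathfrak m)$, is well-linked. **Carving width.** A *carving* of $G$ is a pair $(T,\ell)$ of a finite tree $T$ all of whose vertices have degree $1$ or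 $3$ and an injective map $\ell$ from $V(G)$ to the leaves of $T$. A tree edge $t$ displays the cut $\epsilon(t)=\rho(\{v:\ell(v)\in T_1\})$, where $T_1$ is a component of $T-t$; the width of $(T,\ell)$ is $\max_t|\epsilon(t)|$. A *rooted carving* of $(G,\pi(X))$ is a carving with a distinguished tree edge $e$ such that $\epsilon(e)=\rho(X)$; its width is the maximum of the width of $(T,\ell)$ and $|X|$. The *carving width* of a knitwork is the minimum width of a rooted carving of $(G,\pi(X))$. **Immersion.** A *strong immersion* of $G$ into $G'$ is a map $\gamma$ that is injective from $V(G)$ to $V(G')$ and sends each edge $e=(u,v)$ of $G$ to a path $\gamma(e)$ of $G'$ from $\gamma(u)$ to $\gamma(v)$, such that the paths of distinct edges are edge-disjoint and no vertex in $\gamma(V(G))$ is an internal vertex of any $\gamma(e)$. A *strong $\Omega$-knitwork immersion* of $((G,\pi(X)),\mu,\mathfrak m,\Phi)$ into $((G',\pi'(X')),\mu',\mathfrak m',\Phi')$ is a strong immersion $\gamma$ of $G$ into $G'$ such that: 1. $\pi(X)=(e_1,\dots,e_r)$ and $\pi'(X')=(e_1',\dots,e_r')$ have the same length, and $\gamma(e_i)$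 contains $e_j'$ if and only if $i=j$; 2. for every $v\in V(G)$: $\gamma(v)\in\mathrm{dom}(\mu')\iff v\in\mathrm{dom}(\mu)$, and $\gamma(v)\in\mathrm{dom}(\mathfrak m')\iff v\in\mathrm{dom}(\mathfrak m)$; 3. for every $v\in\mathrm{dom}(\mu)$, the orderings $\mu(v)=(e_1,\dots,e_s)$ and $\mu'(\gamma(v))=(e_1',\dots,e_s')$ have the same length, and $\gamma(e_i)$ contains $e_i'$ for all $i$; 4. for every $v'\in\mathrm{dom}(\mathfrak m')\setminus\gamma(\mathrm{dom}(\mathfrak m))$, the set of pairs $(e,e')\in\rho^-(v')\times\rho^+(v')$ that are consecutive on some path $\gamma(f)$, $f\in E(G)$, belongs to $\mathfrak m'(v')$; 5. for every $v\in\mathrm{dom}(\mathfrak m)$, with $\mu(v)=(e_1,\dots,e_s)$ and $\mu'(\gamma(v))=(e_1',\dots,e_s')$, and for every $I\subseteq\{1,\dots,s\}^2$: $\{(e_i,e_j):(i,j)\in I\}\in\mathfrak m(v)\iff\{(e_i',e_j'):(i,j)\in I\}\in\mathfrak m'(\gamma(v))$; 6. for every $v\in\mathrm{dom}(\Phi)$: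 $\gamma(v)\in\mathrm{dom}(\Phi')$ and $\Phi(v)\preceq\Phi'(\gamma(v))$. **Theorem.** Let $k\in\mathbb N$, let $\Omega$ be a well-quasi-order, and let $(\mathcal G_i)_{i\in\mathbb N}$ be a sequence of well-linked $\Omega$-knitworks, each of carving width at most $k$. Then there exist $i<j$ such that there is a strong $\Omega$-knitwork immersion of $\mathcal G_i$ into $\mathcal G_j$. -/

import Mathlib

universe u v w u' v'

/-- A directed multigraph with vertex type `V` and edge type `E`; loops and parallel edges are
allowed, and edges are objects of their own. -/
structure MultiDigraph (V : Type u) (E : Type v) where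
  tail : E → V
  head : E → V

namespace MultiDigraph

variable {V : Type u} {E : Type v}

/-- In-degree equals out-degree at every vertex (used for finite `E` only). -/
def IsEulerian (G : MultiDigraph V E) : Prop :=
  ∀ x : V, {e : E | G.tail e = x}.ncard = {e : E | G.head e = x}.ncard

/-- The edges leaving `X`. -/
def rhoPlus (G : MultiDigraph V E) (X : Set V) : Set E := {e | G.tail e ∈ X ∧ G.head e ∉ X}

/-- The edges entering `X`. -/
def rhoMinus (G : MultiDigraph V E) (X : Set V) : Set E := {e | G.tail e ∉ X ∧ G.head e ∈ X}

/-- The cut induced by `X`. In particular `G.rho {x}` is the set of non-loop edges at `x`. -/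
def rho (G : MultiDigraph V E) (X : Set V) : Set E := G.rhoMinus X ∪ G.rhoPlus X

/-- `P` is a path from `x` to `y`: a nonempty sequence of distinct edges, consecutive ones meeting
head to tail, whose first edge has tail `x` and whose last edge has head `y`.
Vertices may be repeated. -/
def IsPath (G : MultiDigraph V E) (x y : V) (P : List E) : Prop :=
  P.Nodup ∧ P.IsChain (fun e f => G.head e = G.tail f) ∧
    P.head?.map G.tail = some x ∧ P.getLast?.map G.head = some y

/-- The internal vertices of a path, those between two consecutive edges. -/
def internal (G : MultiDigraph V E) (P : List E) : Set V :=
  {x | ∃ e f, [e, f] <:+: P ∧ G.head e = x}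

end MultiDigraph

/-- The list `l` is an ordering of the set `S`. -/
def IsOrdering {E : Type v} (l : List E) (S : Set E) : Prop :=
  l.Nodup ∧ ∀ e, e ∈ l ↔ e ∈ S

/-- `M` is a matching of `(A, B)`. -/
def IsMatching {E : Type v} (A B : Set E) (M : Set (E × E)) : Prop :=
  M ⊆ A ×ˢ B ∧ (∀ p ∈ M, ∀ q ∈ M, p.1 = q.1 → p = q) ∧ (∀ p ∈ M, ∀ q ∈ M, p.2 = q.2 → p = q)

/-- `M` is a perfect matching of `(A, B)`. -/
def IsPerfectMatching {E : Type v} (A B : Set E) (M : Set (E × E)) : Prop :=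
  IsMatching A B M ∧ (∀ a ∈ A, ∃ b, (a, b) ∈ M) ∧ (∀ b ∈ B, ∃ a, (a, b) ∈ M)

/-- A link on `(A, B)` is a set of matchings of `(A, B)`. -/
def IsLink {E : Type v} (A B : Set E) (L : Set (Set (E × E))) : Prop :=
  ∀ M ∈ L, IsMatching A B M

/-- A link is reliable if it is closed under taking subsets of its matchings. -/
def IsReliable {E : Type v} (L : Set (Set (E × E))) : Prop :=
  ∀ M ∈ L, ∀ N, N ⊆ M → N ∈ L

/-- A link on `(A, B)` is well-linked if, for all subsets `A' = X₁ ∪ Y₁` of `A` and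
`B' = X₂ ∪ Y₂` of `B`, partitioned so that `|X₁| = |X₂|` and `|Y₁| = |Y₂|` (parts may be empty),
it contains the union of a perfect matching of `(X₁, X₂)` and one of `(Y₁, Y₂)`. -/
def IsWellLinked {E : Type v} (A B : Set E) (L : Set (Set (E × E))) : Prop :=
  ∀ X₁ Y₁ X₂ Y₂ : Set E, X₁ ∪ Y₁ ⊆ A → X₂ ∪ Y₂ ⊆ B → Disjoint X₁ Y₁ → Disjoint X₂ Y₂ →
    X₁.encard = X₂.encard → Y₁.encard = Y₂.encard →
    ∃ MX MY : Set (E × E),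
      IsPerfectMatching X₁ X₂ MX ∧ IsPerfectMatching Y₁ Y₂ MY ∧ MX ∪ MY ∈ L

/-- A finite Eulerian digraph rooted in the induced cut of a vertex set `X`, with an ordering `root`
of the edges of that cut. -/
structure RootedEulerianDigraph where
  V : Type u
  E : Type v
  finite_V : Finite V
  finite_E : Finite E
  G : MultiDigraph V E
  eulerian : G.IsEulerian
  X : Set V
  root : List E
  root_ordering : IsOrdering root (G.rho X)

/-- A carving of a digraph: a finite cubic tree (every vertex has degree one or three) together with
an injective map from the vertices of the digraph to the leaves of the tree. -/
structure Carving {V : Type u} {E : Type v} (G : MultiDigraph V E) where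
  n : ℕ
  T : SimpleGraph (Fin n)
  tree : T.IsTree
  cubic : ∀ t, (T.neighborSet t).ncard = 1 ∨ (T.neighborSet t).ncard = 3
  leaf : V → Fin n
  leaf_injective : Function.Injective leaf
  isLeaf : ∀ x, (T.neighborSet (leaf x)).ncard = 1

namespace Carving

variable {V : Type u} {E : Type v} {G : MultiDigraph V E}

/-- The vertices of the digraph whose leaf lies in the component of `a` in `T - {a, b}`. -/
def side (c : Carving G) (a b : Fin c.n) : Set V :=
  {x | (c.T.deleteEdges {s(a, b)}).Reachable a (c.leaf x)}

/-- The cut displayed by the tree edge `{a, b}`. Exchanging `a` and `b` complements the side and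
leaves the cut unchanged. -/
def eps (c : Carving G) (a b : Fin c.n) : Set E := G.rho (c.side a b)

/-- The largest order of a cut displayed by a tree edge. -/
noncomputable def width (c : Carving G) : ℕ∞ :=
  ⨆ (a : Fin c.n) (b : Fin c.n) (_ : c.T.Adj a b), (c.eps a b).encard

end Carving

/-- A rooted carving: a carving with a distinguished tree edge that displays the root cut. -/
structure RootedCarving (R : RootedEulerianDigraph.{u, v}) extends Carving R.G where
  a : Fin n
  b : Fin n
  adj : T.Adj a b
  eps_eq : toCarving.eps a b = R.G.rho R.X

/-- The width of a rooted carving. -/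
noncomputable def RootedCarving.rootedWidth {R : RootedEulerianDigraph.{u, v}}
    (c : RootedCarving R) : ℕ∞ :=
  max c.toCarving.width R.X.encard

/-- The carving width of a rooted Eulerian digraph: the minimum width of a rooted carving. -/
noncomputable def RootedEulerianDigraph.carvingWidth (R : RootedEulerianDigraph.{u, v}) : ℕ∞ :=
  ⨅ c : RootedCarving R, c.rootedWidth

/-- An `Ω`-knitwork. The partial functions `μ`, `𝔪`, `Φ` on the vertices are encoded with
values in `Option`, the domain being the set of vertices where the value is not `none`. -/
structure Knitwork (Ω : Type w) extends RootedEulerianDigraph.{u, v} where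
  mu : V → Option (List E)
  mu_ordering : ∀ x l, mu x = some l → IsOrdering l (G.rho {x})
  m : V → Option (Set (Set (E × E)))
  m_dom : ∀ x, (m x).isSome → (mu x).isSome
  m_link : ∀ x L, m x = some L → IsLink (G.rhoMinus {x}) (G.rhoPlus {x}) L
  m_reliable : ∀ x L, m x = some L → IsReliable L
  Phi : V → Option Ω

/-- All links of the knitwork are well-linked. -/
def Knitwork.WellLinked {Ω : Type w} (K : Knitwork.{u, v} Ω) : Prop :=
  ∀ x L, K.m x = some L → IsWellLinked (K.G.rhoMinus {x}) (K.G.rhoPlus {x}) L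

/-- An immersion of digraphs, given by a map `f` on vertices and a map `g` from edges to
paths. -/
structure IsImmersion {V : Type u} {E : Type v} {V' : Type u'} {E' : Type v'}
    (G : MultiDigraph V E) (G' : MultiDigraph V' E') (f : V → V') (g : E → List E') : Prop where
  injective : Function.Injective f
  path : ∀ e, G'.IsPath (f (G.tail e)) (f (G.head e)) (g e)
  disjoint : ∀ e₁ e₂, e₁ ≠ e₂ → List.Disjoint (g e₁) (g e₂)

/-- A strong immersion: no image of a vertex is an internal vertex of the image of an edge. -/
structure IsStrongImmersion {V : Type u} {E : Type v} {V' : Type u'} {E' : Type v'}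
    (G : MultiDigraph V E) (G' : MultiDigraph V' E') (f : V → V') (g : E → List E') : Prop
    extends IsImmersion G G' f g where
  strong : ∀ e x, f x ∉ G'.internal (g e)

/-- A strong immersion of rooted digraphs: the two root orderings have the same length, and the
image of the `i`-th root edge contains the `j`-th root edge if and only if `i = j`. -/
structure IsStrongRootedImmersion (R : RootedEulerianDigraph.{u, v})
    (R' : RootedEulerianDigraph.{u', v'}) (f : R.V → R'.V) (g : R.E → List R'.E) : Prop
    extends IsStrongImmersion R.G R'.G f g where
  index_eq : R.root.length = R'.root.length
  root_iff : ∀ (i j : ℕ) (e : R.E) (e' : R'.E), R.root[i]? = some e → R'.root[j]? = some e' →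
    (e' ∈ g e ↔ i = j)

/-- The set of pairs of non-loop edges `(e₁, e₂)` at the vertex `x'`, the first entering and the
second leaving, that are consecutive on the image path of some edge. -/
def routing {E : Type v} {V' : Type u'} {E' : Type v'} (G' : MultiDigraph V' E')
    (g : E → List E') (x' : V') : Set (E' × E') :=
  {p | p.1 ∈ G'.rhoMinus {x'} ∧ p.2 ∈ G'.rhoPlus {x'} ∧ ∃ e, [p.1, p.2] <:+: g e}

/-- The set of pairs of entries of `l` at the index pairs in `I`. -/
def pairsAt {E : Type v} (l : List E) (I : Set (ℕ × ℕ)) : Set (E × E) :=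
  {p | ∃ i j, (i, j) ∈ I ∧ l[i]? = some p.1 ∧ l[j]? = some p.2}

/-- `(f, g)` is a strong immersion of the knitwork `K` into the knitwork `K'`. -/
structure IsStrongKnitworkImmersion {Ω : Type w} [Preorder Ω]
    (K : Knitwork.{u, v} Ω) (K' : Knitwork.{u', v'} Ω)
    (f : K.V → K'.V) (g : K.E → List K'.E) : Prop where
  rooted : IsStrongRootedImmersion K.toRootedEulerianDigraph K'.toRootedEulerianDigraph f g
  mu_dom : ∀ x, (K'.mu (f x)).isSome ↔ (K.mu x).isSome
  m_dom : ∀ x, (K'.m (f x)).isSome ↔ (K.m x).isSome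
  /-- `μ(x)` and `μ'(f(x))` have the same length, and corresponding entries are respected. -/
  mu_respected : ∀ x l l', K.mu x = some l → K'.mu (f x) = some l' →
    l.length = l'.length ∧
      ∀ (i : ℕ) (e : K.E) (e' : K'.E), l[i]? = some e → l'[i]? = some e' → e' ∈ g e
  /-- At a link vertex that is not the image of one, the routing is feasible. -/
  routing_feasible : ∀ x' L', K'.m x' = some L' → (∀ x, (K.m x).isSome → f x ≠ x') →
    routing K'.G g x' ∈ L'
  /-- The orderings `μ(x)` and `μ'(f(x))` identify the link at `x` with the link at `f(x)`. -/
  link_iff : ∀ x L l L' l', K.m x = some L → K.mu x = some l →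
    K'.m (f x) = some L' → K'.mu (f x) = some l' →
    ∀ I : Set (ℕ × ℕ), pairsAt l I ∈ L ↔ pairsAt l' I ∈ L'
  label_le : ∀ x a, K.Phi x = some a → ∃ b, K'.Phi (f x) = some b ∧ a ≤ b

/-- `K` strongly immerses into `K'`. -/
def Knitwork.StronglyImmersesIn {Ω : Type w} [Preorder Ω]
    (K : Knitwork.{u, v} Ω) (K' : Knitwork.{u', v'} Ω) : Prop :=
  ∃ (f : K.V → K'.V) (g : K.E → List K'.E), IsStrongKnitworkImmersion K K' f g

/-!
A knitwork is taken apart along a carving, and its parts are compared by immersions that respect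
orderings of their cuts. The argument has four ingredients.

*Linked carvings.* The two sides of the root edge of a carving are turned into binary trees of
nested vertex sets (`Carving.exists_cutTree`, `CutTree`), where leaves may be empty. Among the trees
of width at most `k` with a given carrier choose one that minimizes the sum, over the inner vertices
with nonempty children, of `3` to the power of the total size of the three cuts there. Such a tree
is linked (`CutTree.IsMinimal.linked`): a set between two nested subtrees `A ⊆ B` has a cut no
smaller than the smallest cut on the path from `A` to `B`. Otherwise take such a set `Z` with a
cut of minimum size, crossing as few subtrees as possible. By submodularity, restricting the tree to
`Z` and to its complement and joining the two along the cut of `Z` lowers the sum.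

*Linkages.* In an Eulerian digraph, if the cuts of `A ⊆ B` have equal size and no set in between has
a smaller cut, edge-disjoint paths join the two cuts edge by edge, inwards from the edges entering
`B` and outwards from those leaving `A`. They can be chosen so that the pairs of edges they use at
each link vertex form a member of its link (`MultiDigraph.exists_linkage`): it is enough to know
which edges belong to the inward paths (`MultiDigraph.exists_inward_flow`). At each vertex this
divides the entering and the leaving edges into two balanced parts, and well-linkedness says exactly
that the link has a matching that respects this division; following the matchings gives the paths.
Hence an immersion into the part at `A` extends to one into the part at `B`
(`IsPieceImmersion.extend`).

*Gluing.* Immersions of two disjoint parts glue to an immersion of their union, provided that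
the orderings of the cuts share edges in the same positions on both sides
(`IsPieceImmersion.glue`), and immersions of complementary parts glue to an immersion of the whole
knitwork (`IsPieceImmersion.isStrongKnitworkImmersion`). Since cuts are bounded, there are finitely
many possibilities for these positions.

*The induction.* Let `L` be a well-quasi-ordered class of parts, and consider the parts composed of
members of `L` by inner vertices all of which, except for the outermost one, have cuts of size at
least `m` (`composedPieces`). They are well-quasi-ordered as well
(`partiallyWellOrderedOn_composedPieces`), by descending induction over `m`. If `m` exceeds the
width, such a part is in `L` or splits into two members of `L`. For the step, take a minimal bad
sequence of such parts whose own cut has size `m`. The smaller parts of this kind that are contained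
in its terms immerse into these terms by linkedness, so they are well-quasi-ordered and can be added
to `L`; then the inner vertices that remain have cuts of size at least `m + 1`. Hence there is no
such bad sequence, and the parts whose own cut has size `m` can be added to `L` in turn. The case
`m = 0`, with `L` the parts with at most one vertex, is the theorem for parts
(`partiallyWellOrderedOn_isGood`). The parts in this `L` are well-quasi-ordered since up to
the labels there are finitely many types of vertices with few edges, apart from the number of loops.

Transitivity of the relation between parts is not needed: monotone subsequences come from Ramsey's
theorem (`Set.PartiallyWellOrderedOn.exists_strictMono`).
-/

/-! ### Concatenating paths that share an edge -/

section Splice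

variable {α : Type v}

/-- The concatenation of two sequences of which the first ends with the entry the second begins
with; that entry is kept once. If one of them is empty the result is the other. -/
def splice : List α → List α → List α
  | [], Q => Q
  | a :: P, Q => a :: P ++ Q.tail

/-- If both sequences are nonempty, the last entry of `P` is the first entry of `Q`. -/
def Spliceable (P Q : List α) : Prop :=
  ∀ a ∈ P.getLast?, ∀ b ∈ Q.head?, a = b

theorem Spliceable.cases {P Q : List α} (h : Spliceable P Q) :
    P = [] ∨ Q = [] ∨ ∃ P₀ a Q₀, P = P₀ ++ [a] ∧ Q = a :: Q₀ := by
  rcases List.eq_nil_or_concat P with hP | ⟨P₀, a, rfl⟩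
  · exact Or.inl hP
  · cases Q with
    | nil => exact Or.inr (Or.inl rfl)
    | cons b Q₀ =>
      have : a = b := h a (by simp) b (by simp)
      exact Or.inr (Or.inr ⟨P₀, a, Q₀, by simp, by rw [this]⟩)

@[simp] theorem splice_nil_left (Q : List α) : splice [] Q = Q := rfl

@[simp] theorem splice_nil_right (P : List α) : splice P [] = P := by
  cases P <;> simp [splice]

theorem splice_append_cons (P₀ : List α) (a : α) (Q₀ : List α) :
    splice (P₀ ++ [a]) (a :: Q₀) = P₀ ++ a :: Q₀ := by
  cases P₀ <;> simp [splice]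

theorem mem_splice {P Q : List α} (h : Spliceable P Q) {x : α} :
    x ∈ splice P Q ↔ x ∈ P ∨ x ∈ Q := by
  rcases h.cases with rfl | rfl | ⟨P₀, a, Q₀, rfl, rfl⟩
  · simp
  · simp
  · rw [splice_append_cons]; simp; tauto

theorem isChain_splice {R : α → α → Prop} {P Q : List α} (h : Spliceable P Q)
    (hP : P.IsChain R) (hQ : Q.IsChain R) : (splice P Q).IsChain R := by
  rcases h.cases with rfl | rfl | ⟨P₀, a, Q₀, rfl, rfl⟩
  · simpa
  · simpa
  · rw [splice_append_cons, List.isChain_split]; exact ⟨hP, hQ⟩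

theorem head?_splice {P Q : List α} : (splice P Q).head? = P.head?.or Q.head? := by
  cases P <;> simp [splice]

theorem getLast?_splice {P Q : List α} (h : Spliceable P Q) :
    (splice P Q).getLast? = Q.getLast?.or P.getLast? := by
  rcases h.cases with rfl | rfl | ⟨P₀, a, Q₀, rfl, rfl⟩
  · simp
  · simp
  · rw [splice_append_cons]; simp [List.getLast?_cons]

theorem nodup_splice {P Q : List α} (h : Spliceable P Q) (hP : P.Nodup) (hQ : Q.Nodup)
    (hPQ : ∀ x ∈ P, x ∈ Q → P.getLast? = some x) : (splice P Q).Nodup := by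
  rcases h.cases with rfl | rfl | ⟨P₀, a, Q₀, rfl, rfl⟩
  · simpa
  · simpa
  · rw [splice_append_cons, List.nodup_append]
    refine ⟨(List.nodup_append.1 hP).1, hQ, ?_⟩
    rintro x hx y hy rfl
    have := hPQ x (by simp [hx]) hy
    simp at this
    subst this
    exact (List.nodup_append.1 hP).2.2 a hx a (by simp) rfl

theorem List.IsChain.of_pair_infix {R : α → α → Prop} {l : List α} (h : l.IsChain R) {x y : α}
    (hxy : [x, y] <:+: l) : R x y := by
  simpa using h.infix hxy

theorem isChain_of_pair_infix {R : α → α → Prop} {l : List α}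
    (h : ∀ x y, [x, y] <:+: l → R x y) : l.IsChain R :=
  (List.isChain_isInfix l).imp (fun x y hxy => h x y hxy)

/-- Two entries are consecutive in a splice exactly if they are so in one of its parts. -/
theorem pair_infix_splice {P Q : List α} (h : Spliceable P Q) {x y : α}
    (hxy : [x, y] <:+: splice P Q) : [x, y] <:+: P ∨ [x, y] <:+: Q :=
  (isChain_splice (R := fun x y => [x, y] <:+: P ∨ [x, y] <:+: Q) h
    (isChain_of_pair_infix fun _ _ => Or.inl) (isChain_of_pair_infix fun _ _ => Or.inr)
    ).of_pair_infix hxy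

theorem head?_eq_or_pair_infix {l : List α} {x : α} (hx : x ∈ l) :
    l.head? = some x ∨ ∃ w, [w, x] <:+: l := by
  obtain ⟨s, t, rfl⟩ := List.append_of_mem hx
  rcases List.eq_nil_or_concat s with rfl | ⟨s', w, rfl⟩
  · simp
  · exact Or.inr ⟨w, s', t, by simp⟩

theorem getLast?_eq_or_pair_infix {l : List α} {x : α} (hx : x ∈ l) :
    l.getLast? = some x ∨ ∃ y, [x, y] <:+: l := by
  obtain ⟨s, t, rfl⟩ := List.append_of_mem hx
  cases t with
  | nil => simp
  | cons y t => exact Or.inr ⟨y, s, t, by simp⟩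

end Splice

/-! ### Cuts -/

namespace MultiDigraph

variable {V : Type u} {E : Type v} (G : MultiDigraph V E)

/-- The number of edges in the cut induced by `Z`. -/
noncomputable def cutSize (Z : Set V) : ℕ := (G.rho Z).ncard

theorem mem_rho {Z : Set V} {e : E} :
    e ∈ G.rho Z ↔ (G.tail e ∈ Z ∧ G.head e ∉ Z) ∨ (G.tail e ∉ Z ∧ G.head e ∈ Z) := by
  simp only [rho, rhoMinus, rhoPlus, Set.mem_union, Set.mem_ofPred_eq]; tauto

theorem rho_compl (Z : Set V) : G.rho Zᶜ = G.rho Z := by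
  ext e; simp only [mem_rho, Set.mem_compl_iff]; tauto

@[simp] theorem rho_empty : G.rho ∅ = ∅ := by
  ext e; simp [mem_rho]

@[simp] theorem cutSize_empty : G.cutSize ∅ = 0 := by simp [cutSize]

theorem cutSize_compl (Z : Set V) : G.cutSize Zᶜ = G.cutSize Z := by
  rw [cutSize, rho_compl, cutSize]

theorem cutSize_eq_sum [Fintype E] (Z : Set V) [DecidablePred (· ∈ G.rho Z)] :
    G.cutSize Z = ∑ e : E, if e ∈ G.rho Z then 1 else 0 := by
  rw [cutSize, Set.ncard_eq_toFinset_card', Finset.sum_boole]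
  simp only [Nat.cast_id]
  congr 1
  ext e; simp

theorem cutSize_inter_add_union [Finite E] (X Y : Set V) :
    G.cutSize (X ∩ Y) + G.cutSize (X ∪ Y) ≤ G.cutSize X + G.cutSize Y := by
  classical
  have := Fintype.ofFinite E
  simp only [cutSize_eq_sum, ← Finset.sum_add_distrib]
  refine Finset.sum_le_sum fun e _ => ?_
  simp only [mem_rho, Set.mem_inter_iff, Set.mem_union]
  by_cases h1 : G.tail e ∈ X <;> by_cases h2 : G.head e ∈ X <;>
    by_cases h3 : G.tail e ∈ Y <;> by_cases h4 : G.head e ∈ Y <;> simp [h1, h2, h3, h4]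

theorem cutSize_diff_add_diff [Finite E] (X Y : Set V) :
    G.cutSize (X \ Y) + G.cutSize (Y \ X) ≤ G.cutSize X + G.cutSize Y := by
  have h := G.cutSize_inter_add_union X Yᶜ
  rw [G.cutSize_compl Y, ← G.cutSize_compl (X ∪ Yᶜ)] at h
  have : (X ∪ Yᶜ)ᶜ = Y \ X := by ext; simp; tauto
  rwa [this, ← Set.sdiff_eq] at h

/-- In an Eulerian digraph every cut is balanced. -/
theorem IsEulerian.ncard_rhoMinus_eq [Finite V] [Finite E] {G : MultiDigraph V E}
    (hG : G.IsEulerian) (Z : Set V) : (G.rhoMinus Z).ncard = (G.rhoPlus Z).ncard := by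
  classical
  have := Fintype.ofFinite E
  have := Fintype.ofFinite V
  have key : ∀ φ : E → V, {e | φ e ∈ Z}.ncard = ∑ x with x ∈ Z, {e | φ e = x}.ncard := by
    intro φ
    simp only [Set.ncard_eq_toFinset_card']
    rw [Finset.card_eq_sum_card_fiberwise (f := φ) (t := Finset.univ.filter (· ∈ Z))]
    · refine Finset.sum_congr rfl fun x hx => ?_
      congr 1
      ext e
      simp only [Finset.mem_filter, Set.mem_toFinset, Set.mem_ofPred_eq]
      constructor
      · exact fun h => h.2
      · rintro rfl; exact ⟨by simpa using hx, rfl⟩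
    · intro e he; simpa using he
  have h1 : {e | G.tail e ∈ Z}.ncard = {e | G.head e ∈ Z}.ncard := by
    rw [key, key]; exact Finset.sum_congr rfl fun x _ => hG x
  have h2 : {e | G.tail e ∈ Z} = {e | G.tail e ∈ Z ∧ G.head e ∈ Z} ∪ G.rhoPlus Z := by
    ext e; simp only [rhoPlus, Set.mem_union, Set.mem_ofPred_eq]; tauto
  have h3 : {e | G.head e ∈ Z} = {e | G.tail e ∈ Z ∧ G.head e ∈ Z} ∪ G.rhoMinus Z := by
    ext e; simp only [rhoMinus, Set.mem_union, Set.mem_ofPred_eq]; tauto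
  rw [h2, h3, Set.ncard_union_eq, Set.ncard_union_eq] at h1
  · omega
  · rw [Set.disjoint_left]; rintro e ⟨h, _⟩ ⟨h', _⟩; exact h' h
  · rw [Set.disjoint_left]; rintro e ⟨_, h⟩ ⟨_, h'⟩; exact h' h

theorem IsEulerian.two_mul_ncard_rhoMinus [Finite V] [Finite E] {G : MultiDigraph V E}
    (hG : G.IsEulerian) (Z : Set V) : 2 * (G.rhoMinus Z).ncard = G.cutSize Z := by
  rw [cutSize, rho, Set.ncard_union_eq, ← hG.ncard_rhoMinus_eq Z, two_mul]
  rw [Set.disjoint_left]; rintro e ⟨h, _⟩ ⟨h', _⟩; exact h h'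

end MultiDigraph

/-! ### Binary trees of nested vertex sets -/

/-- A rooted binary tree whose leaves carry sets of vertices. -/
inductive CutTree (V : Type u) : Type u
  | leaf (S : Set V) : CutTree V
  | node (l r : CutTree V) : CutTree V

namespace CutTree

variable {V : Type u} {E : Type v}

/-- The union of the sets at the leaves. -/
def carrier : CutTree V → Set V
  | leaf S => S
  | node l r => l.carrier ∪ r.carrier

/-- The number of vertices of the tree. -/
def size : CutTree V → ℕ
  | leaf _ => 0
  | node l r => l.size + r.size + 1

/-- The carriers of all subtrees. -/
def nodes : CutTree V → Set (Set V)
  | leaf S => {S}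
  | node l r => {l.carrier ∪ r.carrier} ∪ (l.nodes ∪ r.nodes)

/-- Intersect the set at every leaf with `Z`. -/
def restrict (Z : Set V) : CutTree V → CutTree V
  | leaf S => leaf (S ∩ Z)
  | node l r => node (l.restrict Z) (r.restrict Z)

/-- The tree in which `a` hangs at the end of a path that starts at the root and has the trees
of the list as its side branches. -/
def plug : List (CutTree V) → CutTree V → CutTree V
  | [], a => a
  | c :: cs, a => node (plug cs a) c

/-- The leaves of the tree hold at most one vertex each, distinct leaves hold disjoint sets, and
the cut of every subtree has at most `k` edges. Leaves may be empty. -/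
def IsCarving (G : MultiDigraph V E) (k : ℕ) : CutTree V → Prop
  | leaf S => S.Subsingleton ∧ G.cutSize S ≤ k
  | node l r => l.IsCarving G k ∧ r.IsCarving G k ∧ Disjoint l.carrier r.carrier ∧
      G.cutSize (l.carrier ∪ r.carrier) ≤ k

open Classical in
/-- The contribution of a vertex with children `X` and `Y` to the potential of a tree. Vertices
with an empty child do not count, as they could be suppressed. -/
noncomputable def nodeWeight (G : MultiDigraph V E) (X Y : Set V) : ℕ :=
  if X.Nonempty ∧ Y.Nonempty then 3 ^ (G.cutSize X + G.cutSize Y + G.cutSize (X ∪ Y)) else 0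

/-- The sum of the weights of the inner vertices. The base `3` makes two vertices together lighter
than one whose cuts are larger in total. -/
noncomputable def potential (G : MultiDigraph V E) : CutTree V → ℕ
  | leaf _ => 0
  | node l r => nodeWeight G l.carrier r.carrier + (l.potential G + r.potential G)

/-- A carving tree of minimum potential among all those with the same carrier. -/
def IsMinimal (G : MultiDigraph V E) (k : ℕ) (t : CutTree V) : Prop :=
  t.IsCarving G k ∧ ∀ t' : CutTree V, t'.IsCarving G k → t'.carrier = t.carrier →
    t.potential G ≤ t'.potential G

/-- `D` has vertices inside and outside of `Z`. -/
def Crosses (D Z : Set V) : Prop := (D ∩ Z).Nonempty ∧ (D ∩ Zᶜ).Nonempty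

theorem not_crosses_iff {D Z : Set V} : ¬ Crosses D Z ↔ D ⊆ Zᶜ ∨ D ⊆ Z := by
  simp only [Crosses, not_and_or, Set.not_nonempty_iff_eq_empty]
  rw [← Set.disjoint_iff_inter_eq_empty, ← Set.disjoint_iff_inter_eq_empty,
    Set.subset_compl_iff_disjoint_right, Set.disjoint_compl_right_iff_subset]

@[simp] theorem carrier_restrict (Z : Set V) (t : CutTree V) :
    (t.restrict Z).carrier = t.carrier ∩ Z := by
  induction t with
  | leaf S => rfl
  | node l r ihl ihr => simp [restrict, carrier, ihl, ihr, Set.union_inter_distrib_right]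

theorem carrier_mem_nodes (t : CutTree V) : t.carrier ∈ t.nodes := by
  cases t <;> simp [carrier, nodes]

theorem subset_carrier_of_mem_nodes {t : CutTree V} {D : Set V} (h : D ∈ t.nodes) :
    D ⊆ t.carrier := by
  induction t with
  | leaf S => simp only [nodes, Set.mem_singleton_iff] at h; rw [h]; rfl
  | node l r ihl ihr =>
    simp only [nodes, Set.singleton_union, Set.mem_insert_iff, Set.mem_union] at h
    rcases h with rfl | h | h
    · exact subset_rfl
    · exact (ihl h).trans Set.subset_union_left
    · exact (ihr h).trans Set.subset_union_right

variable {G : MultiDigraph V E} {k : ℕ}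

theorem IsCarving.cutSize_le {t : CutTree V} (h : t.IsCarving G k) : G.cutSize t.carrier ≤ k := by
  cases t with
  | leaf S => exact h.2
  | node l r => exact h.2.2.2

/-- The subtrees of a carving tree form a laminar family. -/
theorem IsCarving.laminar {t : CutTree V} (h : t.IsCarving G k) {D D' : Set V} (hD : D ∈ t.nodes)
    (hD' : D' ∈ t.nodes) : D ⊆ D' ∨ D' ⊆ D ∨ Disjoint D D' := by
  induction t with
  | leaf S =>
    simp only [nodes, Set.mem_singleton_iff] at hD hD'
    rw [hD, hD']; exact Or.inl subset_rfl
  | node l r ihl ihr =>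
    obtain ⟨hl, hr, hlr, -⟩ := h
    have sub := fun X (hX : X ∈ (node l r).nodes) => subset_carrier_of_mem_nodes hX
    have hs := sub D hD
    have hs' := sub D' hD'
    simp only [nodes, Set.singleton_union, Set.mem_insert_iff, Set.mem_union] at hD hD'
    rcases hD with rfl | hD
    · exact Or.inr (Or.inl hs')
    rcases hD' with rfl | hD'
    · exact Or.inl hs
    rcases hD with hD | hD <;> rcases hD' with hD' | hD'
    · exact ihl hl hD hD'
    · exact Or.inr (Or.inr (hlr.mono (subset_carrier_of_mem_nodes hD)
        (subset_carrier_of_mem_nodes hD')))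
    · exact Or.inr (Or.inr (hlr.symm.mono (subset_carrier_of_mem_nodes hD)
        (subset_carrier_of_mem_nodes hD')))
    · exact ihr hr hD hD'

theorem three_pow_add_lt {a b c : ℕ} (ha : a < c) (hb : b < c) : 3 ^ a + 3 ^ b < 3 ^ c := by
  obtain ⟨c, rfl⟩ : ∃ c', c = c' + 1 := ⟨c - 1, by omega⟩
  have h1 : 3 ^ a ≤ 3 ^ c := Nat.pow_le_pow_right (by norm_num) (by omega)
  have h2 : 3 ^ b ≤ 3 ^ c := Nat.pow_le_pow_right (by norm_num) (by omega)
  have h3 : 0 < 3 ^ c := by positivity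
  rw [pow_succ]; omega

theorem nodeWeight_of_nonempty {X Y : Set V} (hX : X.Nonempty) (hY : Y.Nonempty) :
    nodeWeight G X Y = 3 ^ (G.cutSize X + G.cutSize Y + G.cutSize (X ∪ Y)) :=
  if_pos ⟨hX, hY⟩

theorem nodeWeight_le (X Y : Set V) :
    nodeWeight G X Y ≤ 3 ^ (G.cutSize X + G.cutSize Y + G.cutSize (X ∪ Y)) := by
  unfold nodeWeight; split_ifs <;> simp

@[simp] theorem nodeWeight_empty_left (Y : Set V) : nodeWeight G ∅ Y = 0 := by simp [nodeWeight]

@[simp] theorem nodeWeight_empty_right (X : Set V) : nodeWeight G X ∅ = 0 := by simp [nodeWeight]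

theorem nodeWeight_add_lt {X Y X₁ Y₁ X₂ Y₂ : Set V} (hX : X.Nonempty) (hY : Y.Nonempty)
    (h₁ : G.cutSize X₁ + G.cutSize Y₁ + G.cutSize (X₁ ∪ Y₁) <
      G.cutSize X + G.cutSize Y + G.cutSize (X ∪ Y))
    (h₂ : G.cutSize X₂ + G.cutSize Y₂ + G.cutSize (X₂ ∪ Y₂) <
      G.cutSize X + G.cutSize Y + G.cutSize (X ∪ Y)) :
    nodeWeight G X₁ Y₁ + nodeWeight G X₂ Y₂ < nodeWeight G X Y := by
  rw [nodeWeight_of_nonempty hX hY]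
  exact (add_le_add (nodeWeight_le _ _) (nodeWeight_le _ _)).trans_lt (three_pow_add_lt h₁ h₂)

/-- Every subtree that crosses `Z` is split by `Z` into two parts with smaller cuts. -/
def SplitsWell (G : MultiDigraph V E) (Z : Set V) (t : CutTree V) : Prop :=
  ∀ D ∈ t.nodes, Crosses D Z → G.cutSize (D ∩ Z) < G.cutSize D ∧ G.cutSize (D ∩ Zᶜ) < G.cutSize D

theorem SplitsWell.cutSize_le {Z : Set V} {t : CutTree V} (h : SplitsWell G Z t) {D : Set V}
    (hD : D ∈ t.nodes) : G.cutSize (D ∩ Z) ≤ G.cutSize D ∧ G.cutSize (D ∩ Zᶜ) ≤ G.cutSize D := by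
  by_cases hc : Crosses D Z
  · exact ⟨(h D hD hc).1.le, (h D hD hc).2.le⟩
  · rcases not_crosses_iff.1 hc with hc | hc
    · rw [Set.inter_eq_left.2 hc, Set.disjoint_iff_inter_eq_empty.1
        (Set.subset_compl_iff_disjoint_right.1 hc)]
      simp
    · rw [Set.inter_eq_left.2 hc, Set.disjoint_iff_inter_eq_empty.1
        (Set.disjoint_compl_right_iff_subset.2 hc)]
      simp

/-- Splitting a side branch along `Z` gives two carving trees, and does not increase the
potential: a vertex that is split is replaced by two which together are lighter. -/
theorem IsCarving.restrict_both {Z : Set V} {t : CutTree V} (ht : t.IsCarving G k)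
    (h : SplitsWell G Z t) : (t.restrict Z).IsCarving G k ∧ (t.restrict Zᶜ).IsCarving G k ∧
      (t.restrict Z).potential G + (t.restrict Zᶜ).potential G ≤ t.potential G := by
  induction t with
  | leaf S =>
    have := h.cutSize_le (carrier_mem_nodes _)
    exact ⟨⟨ht.1.anti Set.inter_subset_left, this.1.trans ht.2⟩,
      ⟨ht.1.anti Set.inter_subset_left, this.2.trans ht.2⟩, le_rfl⟩
  | node l r ihl ihr =>
    obtain ⟨hl, hr, hlr, hk⟩ := ht
    have hD := h.cutSize_le (carrier_mem_nodes _)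
    have hcl := h.cutSize_le (D := l.carrier) (by simp [nodes, carrier_mem_nodes])
    have hcr := h.cutSize_le (D := r.carrier) (by simp [nodes, carrier_mem_nodes])
    obtain ⟨l1, l2, l3⟩ := ihl hl fun D hD => h D (by simp [nodes, hD])
    obtain ⟨r1, r2, r3⟩ := ihr hr fun D hD => h D (by simp [nodes, hD])
    simp only [CutTree.carrier, Set.union_inter_distrib_right] at hD
    have hw : nodeWeight G (l.carrier ∩ Z) (r.carrier ∩ Z) +
        nodeWeight G (l.carrier ∩ Zᶜ) (r.carrier ∩ Zᶜ) ≤ nodeWeight G l.carrier r.carrier := by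
      rcases l.carrier.eq_empty_or_nonempty with hl0 | hl0
      · simp [hl0]
      rcases r.carrier.eq_empty_or_nonempty with hr0 | hr0
      · simp [hr0]
      by_cases hc : Crosses (l.carrier ∪ r.carrier) Z
      · have := h _ (carrier_mem_nodes _) hc
        simp only [CutTree.carrier, Set.union_inter_distrib_right] at this
        exact (nodeWeight_add_lt hl0 hr0 (by omega) (by omega)).le
      · rcases not_crosses_iff.1 hc with hc | hc
        · rw [Set.union_subset_iff] at hc
          rw [Set.inter_eq_left.2 hc.1, Set.inter_eq_left.2 hc.2, Set.disjoint_iff_inter_eq_empty.1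
            (Set.subset_compl_iff_disjoint_right.1 hc.1)]
          simp
        · rw [Set.union_subset_iff] at hc
          rw [Set.inter_eq_left.2 hc.1, Set.inter_eq_left.2 hc.2, Set.disjoint_iff_inter_eq_empty.1
            (Set.disjoint_compl_right_iff_subset.2 hc.1)]
          simp
    refine ⟨⟨l1, r1, ?_, ?_⟩, ⟨l2, r2, ?_, ?_⟩, ?_⟩
    · simpa using hlr.mono Set.inter_subset_left Set.inter_subset_left
    · simpa using hD.1.trans hk
    · simpa using hlr.mono Set.inter_subset_left Set.inter_subset_left
    · simpa using hD.2.trans hk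
    · simp only [restrict, potential, carrier_restrict]
      omega

@[simp] theorem carrier_plug_cons (c : CutTree V) (cs : List (CutTree V)) (a : CutTree V) :
    (plug (c :: cs) a).carrier = (plug cs a).carrier ∪ c.carrier := rfl

@[simp] theorem plug_nil (a : CutTree V) : plug [] a = a := rfl

theorem plug_append (cs : List (CutTree V)) (a r : CutTree V) :
    plug (cs ++ [r]) a = plug cs (node a r) := by
  induction cs with
  | nil => rfl
  | cons c cs ih => simp [plug, ih]

theorem carrier_subset_plug (cs : List (CutTree V)) (a : CutTree V) :
    a.carrier ⊆ (plug cs a).carrier := by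
  induction cs with
  | nil => exact subset_rfl
  | cons c cs ih => exact ih.trans Set.subset_union_left

/-- Side branches are carving trees on subsets disjoint from the end of the path. -/
theorem IsCarving.of_mem {cs : List (CutTree V)} {a c : CutTree V}
    (h : (plug cs a).IsCarving G k) (hc : c ∈ cs) : c.IsCarving G k ∧
      Disjoint a.carrier c.carrier ∧ c.carrier ⊆ (plug cs a).carrier ∧
      c.nodes ⊆ (plug cs a).nodes := by
  induction cs with
  | nil => simp at hc
  | cons c' cs ih =>
    obtain ⟨h1, h2, h3, h4⟩ := h
    rcases List.mem_cons.1 hc with rfl | hc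
    · refine ⟨h2, h3.mono_left (carrier_subset_plug _ _), Set.subset_union_right, ?_⟩
      exact Set.subset_union_right.trans Set.subset_union_right
    · obtain ⟨i1, i2, i3, i4⟩ := ih h1 hc
      exact ⟨i1, i2, i3.trans Set.subset_union_left,
        i4.trans (Set.subset_union_left.trans Set.subset_union_right)⟩

theorem carrier_plug_restrict {Z : Set V} (cs : List (CutTree V)) {a : CutTree V}
    (ha : a.carrier ⊆ Z) :
    (plug (cs.map (restrict Z)) a).carrier = (plug cs a).carrier ∩ Z := by
  induction cs with
  | nil => exact (Set.inter_eq_left.2 ha).symm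
  | cons c cs ih =>
    simp [ih, Set.union_inter_distrib_right]

theorem carrier_plug_restrict_compl {Z : Set V} (cs : List (CutTree V)) {a b : CutTree V}
    (ha : a.carrier ⊆ Z) (hb : b.carrier = Z) :
    (plug (cs.map (restrict Zᶜ)) b).carrier = (plug cs a).carrier ∪ Z := by
  induction cs with
  | nil => simp [hb, Set.union_eq_right.2 ha]
  | cons c cs ih =>
    simp only [List.map_cons, carrier_plug_cons, ih, carrier_restrict]
    ext x; simp only [Set.mem_union, Set.mem_inter_iff, Set.mem_compl_iff]; tauto

/-- Rerouting a path of the tree through the set `Z`: the side branches are split along `Z`, the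
parts inside `Z` stay with the end `a` of the path, and the parts outside are attached along
a second path which ends in a tree `b` with carrier `Z`. If the cuts of `Z` and of the pieces are
small, this does not increase the potential. It decreases unless the path lies inside `Z`. -/
theorem reroute {Z : Set V} {a b : CutTree V} (ha : a.carrier ⊆ Z) (ha0 : a.carrier.Nonempty)
    (hb : b.carrier = Z) (hbc : b.IsCarving G k) (cs : List (CutTree V))
    (hcs : (plug cs a).IsCarving G k) (hsplit : ∀ c ∈ cs, SplitsWell G Z c)
    (hpath : ∀ cs', cs' <:+ cs → G.cutSize ((plug cs' a).carrier ∩ Z) ≤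
      G.cutSize (plug cs' a).carrier ∧ G.cutSize ((plug cs' a).carrier ∪ Z) ≤
      G.cutSize (plug cs' a).carrier ∧ G.cutSize Z < G.cutSize (plug cs' a).carrier) :
    (plug (cs.map (restrict Z)) a).IsCarving G k ∧ (plug (cs.map (restrict Zᶜ)) b).IsCarving G k ∧
    (plug (cs.map (restrict Z)) a).potential G + (plug (cs.map (restrict Zᶜ)) b).potential G ≤
      (plug cs a).potential G + b.potential G ∧
    (¬ (plug cs a).carrier ⊆ Z →
      (plug (cs.map (restrict Z)) a).potential G + (plug (cs.map (restrict Zᶜ)) b).potential G <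
      (plug cs a).potential G + b.potential G) := by
  induction cs with
  | nil => exact ⟨hcs, hbc, le_rfl, fun h => absurd ha h⟩
  | cons c cs ih =>
    obtain ⟨h1, h2, h3, h4⟩ := hcs
    obtain ⟨i1, i2, i3, i4⟩ := ih h1 (fun c hc => hsplit c (List.mem_cons_of_mem _ hc))
      (fun cs' h => hpath cs' (h.trans (List.suffix_cons _ _)))
    have hc := hsplit c List.mem_cons_self
    obtain ⟨c1, c2, c3⟩ := h2.restrict_both hc
    obtain ⟨p1, p2, p3⟩ := hpath _ List.suffix_rfl
    obtain ⟨q1, q2, q3⟩ := hpath cs (List.suffix_cons _ _)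
    have e1 := carrier_plug_restrict cs ha
    have e2 := carrier_plug_restrict_compl cs ha hb
    have hne : (plug cs a).carrier.Nonempty := ha0.mono (carrier_subset_plug _ _)
    rw [carrier_plug_cons] at p1 p2 p3
    have e3 : (plug cs a).carrier ∪ Z ∪ c.carrier ∩ Zᶜ = (plug cs a).carrier ∪ c.carrier ∪ Z := by
      ext x; simp only [Set.mem_union, Set.mem_inter_iff, Set.mem_compl_iff]; tauto
    have d1 := hc.cutSize_le (carrier_mem_nodes c)
    have hw : nodeWeight G ((plug cs a).carrier ∩ Z) (c.carrier ∩ Z) +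
        nodeWeight G ((plug cs a).carrier ∪ Z) (c.carrier ∩ Zᶜ) ≤
          nodeWeight G (plug cs a).carrier c.carrier ∧
        (¬ c.carrier ⊆ Z → (plug cs a).carrier ⊆ Z →
          nodeWeight G ((plug cs a).carrier ∩ Z) (c.carrier ∩ Z) +
          nodeWeight G ((plug cs a).carrier ∪ Z) (c.carrier ∩ Zᶜ) <
          nodeWeight G (plug cs a).carrier c.carrier) := by
      rcases c.carrier.eq_empty_or_nonempty with hc0 | hc0
      · simp [hc0]
      by_cases hcr : Crosses c.carrier Z
      · have := hc _ (carrier_mem_nodes _) hcr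
        have := nodeWeight_add_lt (G := G) hne hc0
          (X₁ := (plug cs a).carrier ∩ Z) (Y₁ := c.carrier ∩ Z)
          (X₂ := (plug cs a).carrier ∪ Z) (Y₂ := c.carrier ∩ Zᶜ)
          (by rw [← Set.union_inter_distrib_right]; omega) (by rw [e3]; omega)
        exact ⟨this.le, fun _ _ => this⟩
      · rcases not_crosses_iff.1 hcr with hcr | hcr
        · have hz : c.carrier ∩ Z = ∅ := Set.disjoint_iff_inter_eq_empty.1
            (Set.subset_compl_iff_disjoint_right.1 hcr)
          have hz' := Set.inter_eq_left.2 hcr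
          rw [hz'] at e3
          rw [hz, hz', nodeWeight_empty_right, zero_add, nodeWeight_of_nonempty hne hc0]
          have hle := nodeWeight_le (G := G) ((plug cs a).carrier ∪ Z) c.carrier
          refine ⟨hle.trans (Nat.pow_le_pow_right (by norm_num) (by rw [e3]; omega)),
            fun _ hs => hle.trans_lt (Nat.pow_lt_pow_right (by norm_num) ?_)⟩
          rw [e3, Set.union_eq_right.2 hs]; omega
        · have hz : c.carrier ∩ Zᶜ = ∅ := Set.disjoint_iff_inter_eq_empty.1
            (Set.disjoint_compl_right_iff_subset.2 hcr)
          have hz' := Set.inter_eq_left.2 hcr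
          rw [hz, hz', nodeWeight_empty_right, add_zero, nodeWeight_of_nonempty hne hc0]
          refine ⟨(nodeWeight_le _ _).trans (Nat.pow_le_pow_right (by norm_num) ?_),
            fun h => absurd hcr h⟩
          have : (plug cs a).carrier ∩ Z ∪ c.carrier = ((plug cs a).carrier ∪ c.carrier) ∩ Z := by
            rw [Set.union_inter_distrib_right, hz']
          rw [this]; omega
    have hd : Disjoint ((plug cs a).carrier ∪ Z) (c.carrier ∩ Zᶜ) := by
      rw [Set.disjoint_union_left]
      exact ⟨h3.mono_right Set.inter_subset_left,
        Set.disjoint_left.2 fun x hx hx' => hx'.2 hx⟩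
    refine ⟨⟨i1, c1, ?_, ?_⟩, ⟨i2, c2, ?_, ?_⟩, ?_, ?_⟩
    · rw [e1, carrier_restrict]
      exact h3.mono Set.inter_subset_left Set.inter_subset_left
    · rw [e1, carrier_restrict, ← Set.union_inter_distrib_right]; exact p1.trans h4
    · rw [e2, carrier_restrict]; exact hd
    · rw [e2, carrier_restrict, e3]; exact p2.trans h4
    · simp only [List.map_cons, plug, potential, e1, e2, carrier_restrict]; omega
    · intro hs
      simp only [List.map_cons, plug, potential, e1, e2, carrier_restrict]
      by_cases hs' : (plug cs a).carrier ⊆ Z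
      · have := hw.2 (fun h => hs (Set.union_subset hs' h)) hs'
        omega
      · have := i4 hs'
        omega

theorem Crosses.of_union {D D' Z : Set V} (hD : D ⊆ D' ∨ D' ⊆ D ∨ Disjoint D D')
    (hZ : (D ∩ Z).Nonempty) (h : Crosses D' (D ∪ Z)) : Crosses D' Z := by
  obtain ⟨⟨x, hx, hx'⟩, ⟨y, hy, hy'⟩⟩ := h
  refine ⟨?_, y, hy, fun h => hy' (Or.inr h)⟩
  rcases hD with hD | hD | hD
  · exact hZ.mono (Set.inter_subset_inter_left _ hD)
  · exact absurd (Or.inl (hD hy)) hy'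
  · exact ⟨x, hx, hx'.resolve_left fun h => hD.le_bot ⟨h, hx⟩⟩

theorem Crosses.of_diff {D D' Z : Set V} (hD : D ⊆ D' ∨ D' ⊆ D ∨ Disjoint D D')
    (hZ : (D ∩ Zᶜ).Nonempty) (h : Crosses D' (Z \ D)) : Crosses D' Z := by
  obtain ⟨⟨x, hx, hx'⟩, ⟨y, hy, hy'⟩⟩ := h
  refine ⟨⟨x, hx, hx'.1⟩, ?_⟩
  rcases hD with hD | hD | hD
  · exact hZ.mono (Set.inter_subset_inter_left _ hD)
  · exact absurd (hD hx) hx'.2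
  · exact ⟨y, hy, fun h => hy' ⟨h, fun h' => hD.le_bot ⟨h', hy⟩⟩⟩

/-- Carving trees of minimum potential are linked: a set `Z` between two of its subtrees has
a cut at least as large as the smallest cut on the path between them. Otherwise take `Z` with
minimum cut and, subject to that, crossing the fewest subtrees. By submodularity the
tree can be rerouted through `Z`, which decreases the potential. -/
theorem IsMinimal.linked [Finite V] [Finite E] {cs : List (CutTree V)} {a : CutTree V} {m : ℕ}
    (hmin : (plug cs a).IsMinimal G k)
    (hm : ∀ cs', cs' <:+ cs → m ≤ G.cutSize (plug cs' a).carrier)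
    {Z : Set V} (haZ : a.carrier ⊆ Z) (hZ : Z ⊆ (plug cs a).carrier) : m ≤ G.cutSize Z := by
  by_contra! hlt
  let cr : Set V → ℕ := fun Z => {D | D ∈ (plug cs a).nodes ∧ Crosses D Z}.ncard
  -- `Y` has a cut of minimum size between `a` and the whole tree and crosses the fewest nodes.
  obtain ⟨Z₁, hZ₁, hZ₁min⟩ := WellFounded.has_min (measure G.cutSize).wf
    {Z | a.carrier ⊆ Z ∧ Z ⊆ (plug cs a).carrier} ⟨Z, haZ, hZ⟩
  have hZ₁min' : ∀ X, a.carrier ⊆ X → X ⊆ (plug cs a).carrier → G.cutSize Z₁ ≤ G.cutSize X :=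
    fun X h1 h2 => not_lt.1 (hZ₁min X ⟨h1, h2⟩)
  obtain ⟨Y, ⟨hYa, hYc, hYd⟩, hYmin⟩ := WellFounded.has_min (measure cr).wf
    {Z | a.carrier ⊆ Z ∧ Z ⊆ (plug cs a).carrier ∧ G.cutSize Z = G.cutSize Z₁}
    ⟨Z₁, hZ₁.1, hZ₁.2, rfl⟩
  have hY1 : ∀ X, a.carrier ⊆ X → X ⊆ (plug cs a).carrier → G.cutSize Y ≤ G.cutSize X :=
    fun X h1 h2 => hYd ▸ hZ₁min' X h1 h2
  have hYm : G.cutSize Y < m := (hY1 Z haZ hZ).trans_lt hlt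
  have hY2 : ∀ X, a.carrier ⊆ X → X ⊆ (plug cs a).carrier →
      G.cutSize X ≤ G.cutSize Y → cr Y ≤ cr X := fun X h1 h2 h3 =>
    not_lt.1 (hYmin X ⟨h1, h2, hYd ▸ le_antisymm h3 (hY1 X h1 h2)⟩)
  have hcrlt : ∀ X D, D ∈ (plug cs a).nodes → Crosses D Y → ¬ Crosses D X →
      (∀ D' ∈ (plug cs a).nodes, Crosses D' X → Crosses D' Y) → cr X < cr Y := by
    intro X D hD hDY hDX h
    refine Set.ncard_lt_ncard ⟨fun D' hD' => ⟨hD'.1, h D' hD'.1 hD'.2⟩, fun hs => ?_⟩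
      (Set.toFinite _)
    exact hDX (hs ⟨hD, hDY⟩).2
  -- If a part of a crossing node `D` had a cut as large as that of `D`, uncrossing would show that
  -- `D ∪ Y` or `Y \ D` has a minimum cut as well, and it crosses fewer nodes.
  have hsplit : ∀ c ∈ cs, SplitsWell G Y c := by
    intro c hc D hD hcr
    obtain ⟨-, hac, hcc, hcn⟩ := hmin.1.of_mem hc
    have hDc := subset_carrier_of_mem_nodes hD
    constructor
    · by_contra! hle
      have := G.cutSize_inter_add_union D Y
      have h1 : a.carrier ⊆ D ∪ Y := hYa.trans Set.subset_union_right
      have h2 : D ∪ Y ⊆ (plug cs a).carrier := Set.union_subset (hDc.trans hcc) hYc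
      refine absurd (hY2 (D ∪ Y) h1 h2 (by omega)) (not_le.2 (hcrlt _ D (hcn hD) hcr ?_ ?_))
      · rintro ⟨-, x, hx, hx'⟩; exact hx' (Or.inl hx)
      · exact fun D' hD' h => h.of_union (hmin.1.laminar (hcn hD) hD') hcr.1
    · by_contra! hle
      have := G.cutSize_diff_add_diff D Y
      rw [← Set.sdiff_eq] at hle
      have h1 : a.carrier ⊆ Y \ D := fun x hx => ⟨hYa hx, fun h => hac.le_bot ⟨hx, hDc h⟩⟩
      have h2 : Y \ D ⊆ (plug cs a).carrier := Set.sdiff_subset.trans hYc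
      refine absurd (hY2 (Y \ D) h1 h2 (by omega)) (not_le.2 (hcrlt _ D (hcn hD) hcr ?_ ?_))
      · rintro ⟨⟨x, hx, hx'⟩, -⟩; exact hx'.2 hx
      · exact fun D' hD' h => h.of_diff (hmin.1.laminar (hcn hD) hD') hcr.2
  have hpath : ∀ cs', cs' <:+ cs → G.cutSize ((plug cs' a).carrier ∩ Y) ≤
      G.cutSize (plug cs' a).carrier ∧ G.cutSize ((plug cs' a).carrier ∪ Y) ≤
      G.cutSize (plug cs' a).carrier ∧ G.cutSize Y < G.cutSize (plug cs' a).carrier := by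
    intro cs' h
    have hs : (plug cs' a).carrier ⊆ (plug cs a).carrier := by
      obtain ⟨ds, rfl⟩ := h
      clear * -
      induction ds with
      | nil => exact subset_rfl
      | cons c cs ih => exact ih.trans Set.subset_union_left
    have h1 := G.cutSize_inter_add_union (plug cs' a).carrier Y
    have h2 := hY1 ((plug cs' a).carrier ∩ Y) (Set.subset_inter (carrier_subset_plug _ _) hYa)
      (Set.inter_subset_right.trans hYc)
    have h3 := hY1 ((plug cs' a).carrier ∪ Y) (hYa.trans Set.subset_union_right)
      (Set.union_subset hs hYc)
    have h4 := hm cs' h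
    omega
  have ha0 : a.carrier.Nonempty := by
    rw [Set.nonempty_iff_ne_empty]
    intro h0
    have := hm [] List.nil_suffix
    rw [plug_nil, h0, MultiDigraph.cutSize_empty] at this
    omega
  -- The lower path is itself the tree with carrier `Y` at the end of the upper path, so it is
  -- first shown to be a carving tree, using any tree with carrier `Y`.
  have hb : (plug (cs.map (restrict Y)) a).carrier = Y := by
    rw [carrier_plug_restrict cs hYa, Set.inter_eq_right.2 hYc]
  have hlow : (plug (cs.map (restrict Y)) a).IsCarving G k := by
    have hsmall : G.cutSize Y ≤ k := by
      have := hm [] List.nil_suffix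
      have := hm cs List.suffix_rfl
      have := hmin.1.cutSize_le
      omega
    have key : ∀ cs', cs' <:+ cs → (plug cs' a).IsCarving G k →
        (plug (cs'.map (restrict Y)) a).IsCarving G k := by
      intro cs' h hcar
      induction cs' with
      | nil => exact hcar
      | cons c cs' ih =>
        obtain ⟨h1, h2, h3, h4⟩ := hcar
        refine ⟨ih ((List.suffix_cons _ _).trans h) h1,
          (h2.restrict_both (hsplit c (h.subset List.mem_cons_self))).1, ?_, ?_⟩
        · rw [carrier_plug_restrict _ hYa, carrier_restrict]
          exact h3.mono Set.inter_subset_left Set.inter_subset_left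
        · rw [carrier_plug_restrict _ hYa, carrier_restrict, ← Set.union_inter_distrib_right]
          exact (hpath _ h).1.trans h4
    exact key cs List.suffix_rfl hmin.1
  obtain ⟨-, h2, -, h4⟩ := reroute hYa ha0 hb hlow cs hmin.1 hsplit hpath
  have hnot : ¬ (plug cs a).carrier ⊆ Y := by
    intro h
    have h1 := (hpath cs List.suffix_rfl).2.2
    rw [Set.Subset.antisymm h hYc] at h1
    omega
  have := h4 hnot
  have := hmin.2 _ h2 (by rw [carrier_plug_restrict_compl cs hYa hb, Set.union_eq_left.2 hYc])
  omega

theorem IsMinimal.children {l r : CutTree V} (h : (node l r).IsMinimal G k) :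
    l.IsMinimal G k ∧ r.IsMinimal G k := by
  obtain ⟨⟨hl, hr, hd, hk⟩, hmin⟩ := h
  refine ⟨⟨hl, fun t ht he => ?_⟩, ⟨hr, fun t ht he => ?_⟩⟩
  · have := hmin (node t r) ⟨ht, hr, by rwa [he], by rwa [he]⟩ (by simp [carrier, he])
    simp only [potential, he] at this
    omega
  · have := hmin (node l t) ⟨hl, ht, by rwa [he], by rwa [he]⟩ (by simp [carrier, he])
    simp only [potential, he] at this
    omega

theorem nodeWeight_comm (X Y : Set V) : nodeWeight G X Y = nodeWeight G Y X := by
  rw [nodeWeight, nodeWeight, Set.union_comm, add_comm (G.cutSize X)]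
  classical exact if_congr and_comm rfl rfl

theorem carrier_plug_swap (cs : List (CutTree V)) (l r : CutTree V) :
    (plug cs (node r l)).carrier = (plug cs (node l r)).carrier := by
  induction cs with
  | nil => exact Set.union_comm _ _
  | cons c cs ih => simp [ih]

theorem potential_plug_swap (cs : List (CutTree V)) (l r : CutTree V) :
    (plug cs (node r l)).potential G = (plug cs (node l r)).potential G := by
  induction cs with
  | nil => simp only [plug, potential, nodeWeight_comm r.carrier]; omega
  | cons c cs ih => simp only [plug, potential, ih, carrier_plug_swap cs l r]

theorem IsCarving.plug_swap {cs : List (CutTree V)} {l r : CutTree V}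
    (h : (plug cs (node l r)).IsCarving G k) : (plug cs (node r l)).IsCarving G k := by
  induction cs with
  | nil => exact ⟨h.2.1, h.1, h.2.2.1.symm, by rw [Set.union_comm]; exact h.2.2.2⟩
  | cons c cs ih =>
    refine ⟨ih h.1, h.2.1, ?_, ?_⟩
    · rw [carrier_plug_swap]; exact h.2.2.1
    · rw [carrier_plug_swap]; exact h.2.2.2

theorem IsMinimal.plug_swap {cs : List (CutTree V)} {l r : CutTree V}
    (h : (plug cs (node l r)).IsMinimal G k) : (plug cs (node r l)).IsMinimal G k :=
  ⟨h.1.plug_swap, fun t ht he => by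
    rw [potential_plug_swap]; exact h.2 t ht (he.trans (carrier_plug_swap _ _ _))⟩

theorem IsCarving.exists_isMinimal {t : CutTree V} (h : t.IsCarving G k) :
    ∃ t' : CutTree V, t'.IsMinimal G k ∧ t'.carrier = t.carrier := by
  obtain ⟨t', ht', hmin⟩ := WellFounded.has_min (measure (potential G)).wf
    {t' : CutTree V | t'.IsCarving G k ∧ t'.carrier = t.carrier} ⟨t, h, rfl⟩
  exact ⟨t', ⟨ht'.1, fun s hs he => not_lt.1 (hmin s ⟨hs, he.trans ht'.2⟩)⟩, ht'.2⟩

end CutTree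

/-! ### Linkages between two cuts -/

section Orbits

variable {E : Type v} {p : E → Prop} {σ : E → E}

/-- Orbits of a partial injection that start outside of its range are disjoint and without
repetitions. -/
theorem iterate_injective_of_start (hσ : ∀ x y, p x → p y → σ x = σ y → x = y) {e e' : E}
    (he : ∀ x, p x → σ x ≠ e) (he' : ∀ x, p x → σ x ≠ e') {a b : ℕ}
    (ha : ∀ i < a, p (σ^[i] e)) (hb : ∀ i < b, p (σ^[i] e')) (h : σ^[a] e = σ^[b] e') :
    a = b ∧ e = e' := by
  induction a generalizing b with
  | zero =>
    cases b with
    | zero => exact ⟨rfl, h⟩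
    | succ b =>
      rw [Function.iterate_succ_apply'] at h
      exact absurd h.symm (he _ (hb b b.lt_succ_self))
  | succ a ih =>
    cases b with
    | zero =>
      rw [Function.iterate_succ_apply'] at h
      exact absurd h (he' _ (ha a a.lt_succ_self))
    | succ b =>
      rw [Function.iterate_succ_apply', Function.iterate_succ_apply'] at h
      have := ih (fun i hi => ha i (hi.trans a.lt_succ_self))
        (fun i hi => hb i (hi.trans b.lt_succ_self))
        (hσ _ _ (ha a a.lt_succ_self) (hb b b.lt_succ_self) h)
      exact ⟨by omega, this.2⟩

/-- The orbit of `e` under a partial injection `σ` with domain `p`, as a sequence. -/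
def orbitList (σ : E → E) (e : E) (N : ℕ) : List E := (List.range (N + 1)).map (σ^[·] e)

theorem mem_orbitList {e x : E} {N : ℕ} :
    x ∈ orbitList σ e N ↔ ∃ i ≤ N, σ^[i] e = x := by
  simp only [orbitList, List.mem_map, List.mem_range, Nat.lt_succ_iff]

theorem isChain_orbitList {e : E} {N : ℕ} (hN : ∀ i < N, p (σ^[i] e)) :
    (orbitList σ e N).IsChain (fun a b => p a ∧ b = σ a) := by
  induction N with
  | zero => simp [orbitList]
  | succ N ih =>
    rw [orbitList, List.range_succ, List.map_append]
    refine List.IsChain.append (ih fun i hi => hN i (hi.trans N.lt_succ_self)) (by simp) ?_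
    intro x hx y hy
    simp [List.range_succ] at hx hy
    subst hx hy
    exact ⟨hN N N.lt_succ_self, Function.iterate_succ_apply' _ _ _⟩

@[simp] theorem head?_orbitList {e : E} {N : ℕ} : (orbitList σ e N).head? = some e := by
  simp [orbitList, List.range_succ_eq_map]

@[simp] theorem getLast?_orbitList {e : E} {N : ℕ} :
    (orbitList σ e N).getLast? = some (σ^[N] e) := by
  simp [orbitList, List.range_succ]

/-- An orbit of a partial injection of a finite set that starts outside of its range leaves its
domain. -/
theorem exists_orbit_end [Finite E] (hσ : ∀ x y, p x → p y → σ x = σ y → x = y) {e : E}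
    (he : ∀ x, p x → σ x ≠ e) : ∃ N, ¬ p (σ^[N] e) ∧ ∀ i < N, p (σ^[i] e) := by
  classical
  have hex : ∃ N, ¬ p (σ^[N] e) := by
    by_contra! hall
    exact not_injective_infinite_finite (fun n => σ^[n] e) fun a b hab =>
      (iterate_injective_of_start hσ he he (fun i _ => hall i) (fun i _ => hall i) hab).1
  exact ⟨Nat.find hex, Nat.find_spec hex, fun i hi => not_not.1 (Nat.find_min hex hi)⟩

end Orbits

/-- The set of all relations is well-linked; it serves as the link of vertices without a link. -/
theorem isWellLinked_univ {E : Type v} [Finite E] (A B : Set E) :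
    IsWellLinked A B Set.univ := by
  have key : ∀ X Y : Set E, X.encard = Y.encard → ∃ M, IsPerfectMatching X Y M := by
    intro X Y h
    rcases isEmpty_or_nonempty E with hE | hE
    · exact ⟨∅, ⟨by simp, by simp, by simp⟩, fun a => isEmptyElim a, fun a => isEmptyElim a⟩
    obtain ⟨f, hf⟩ := (Set.toFinite X).exists_bijOn_of_encard_eq h
    refine ⟨(fun a => (a, f a)) '' X, ⟨?_, ?_, ?_⟩, ?_, ?_⟩
    · rintro _ ⟨a, ha, rfl⟩; exact ⟨ha, hf.mapsTo ha⟩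
    · rintro _ ⟨a, ha, rfl⟩ _ ⟨c, hc, rfl⟩ (rfl : a = c); rfl
    · rintro _ ⟨a, ha, rfl⟩ _ ⟨c, hc, rfl⟩ (hac : f a = f c)
      rw [hf.injOn ha hc hac]
    · exact fun a ha => ⟨f a, a, ha, rfl⟩
    · intro b hb
      obtain ⟨a, ha, rfl⟩ := hf.surjOn hb
      exact ⟨a, a, ha, rfl⟩
  intro X₁ Y₁ X₂ Y₂ _ _ _ _ hX hY
  obtain ⟨M, hM⟩ := key _ _ hX
  obtain ⟨N, hN⟩ := key _ _ hY
  exact ⟨M, N, hM, hN, trivial⟩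

namespace MultiDigraph

variable {V : Type u} {E : Type v} {G : MultiDigraph V E}

/-- Menger's theorem for the cuts of `A ⊆ B`, in a form that is local at the vertices of `B \ A`:
if no cut between `A` and `B` is smaller, there is a set of edges that contains
the edges entering `A` and those entering `B`, none of those leaving `A` or `B`, and equally many
in- and out-edges at each vertex of `B \ A`. It is found by Hall's theorem, which yields an
injection that maps every edge with head in `B \ A` to itself or to an edge continuing it. -/
theorem exists_inward_flow [Finite V] [Finite E] (hG : G.IsEulerian) {A B : Set V} (hAB : A ⊆ B)
    (heq : G.cutSize A = G.cutSize B)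
    (hmin : ∀ Z, A ⊆ Z → Z ⊆ B → G.cutSize B ≤ G.cutSize Z) :
    ∃ X : Set E, G.rhoMinus B ⊆ X ∧ G.rhoMinus A ⊆ X ∧ (∀ e ∈ X, e ∉ G.rhoPlus A) ∧
      (∀ e ∈ X, e ∉ G.rhoPlus B) ∧
      ∀ v ∈ B \ A, (X ∩ G.rhoMinus {v}).ncard = (X ∩ G.rhoPlus {v}).ncard := by
  classical
  have := Fintype.ofFinite E
  -- The inner edges of `B \ A`, the edges that enter it from outside of `B`, and those by which it
  -- is left towards `A`.
  let I : Set E := {e | G.tail e ∈ B \ A ∧ G.head e ∈ B \ A ∧ G.tail e ≠ G.head e}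
  let S : Set E := {e | G.tail e ∉ B ∧ G.head e ∈ B \ A}
  let T : Set E := {e | G.tail e ∈ B \ A ∧ G.head e ∈ A}
  have hST : S.ncard = T.ncard := by
    have h1 := hG.two_mul_ncard_rhoMinus A
    have h2 := hG.two_mul_ncard_rhoMinus B
    have h3 : G.rhoMinus A = T ∪ {e | G.tail e ∉ B ∧ G.head e ∈ A} := by
      ext e; have := @hAB (G.tail e)
      simp only [rhoMinus, T, Set.mem_union, Set.mem_ofPred_eq, Set.mem_sdiff]; tauto
    have h4 : G.rhoMinus B = S ∪ {e | G.tail e ∉ B ∧ G.head e ∈ A} := by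
      ext e; have := @hAB (G.head e)
      simp only [rhoMinus, S, Set.mem_union, Set.mem_ofPred_eq, Set.mem_sdiff]; tauto
    rw [h3, Set.ncard_union_eq] at h1
    · rw [h4, Set.ncard_union_eq] at h2
      · omega
      · rw [Set.disjoint_left]; rintro e ⟨_, h⟩ ⟨_, h'⟩; exact h.2 h'
    · rw [Set.disjoint_left]; rintro e ⟨h, _⟩ ⟨h', _⟩; exact h' h.1
  have hSI : Disjoint S I := Set.disjoint_left.2 fun e h h' => h.1 h'.1.1
  have hTI : Disjoint T I := Set.disjoint_left.2 fun e h h' => h'.2.1.2 h.2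
  let t : ↥(S ∪ I) → Finset E := fun e =>
    Finset.univ.filter fun f => f ∈ T ∪ I ∧ (f = e ∨ G.tail f = G.head e)
  -- Hall's condition for `W` follows from the minimality of the cut of `B` compared with `B \ U`,
  -- where `U` consists of the heads of the edges in `W`.
  have hall : ∀ W : Finset ↥(S ∪ I), W.card ≤ (W.biUnion t).card := by
    intro W
    let W' : Set E := Subtype.val '' (W : Set ↥(S ∪ I))
    have hW' : W'.ncard = W.card := by
      rw [Set.ncard_image_of_injective _ Subtype.val_injective, Set.ncard_coe_finset]
    have hW'sub : W' ⊆ S ∪ I := by rintro _ ⟨e, _, rfl⟩; exact e.2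
    let U : Set V := G.head '' W'
    have hU : U ⊆ B \ A := by
      rintro _ ⟨e, he, rfl⟩
      rcases hW'sub he with h | h
      · exact h.2
      · exact h.2.1
    have hZ := hmin (B \ U) (fun x hx => ⟨hAB hx, fun h => (hU h).2 hx⟩) Set.sdiff_subset
    rw [← hG.two_mul_ncard_rhoMinus, ← hG.two_mul_ncard_rhoMinus] at hZ
    let P : Set E := {e | G.tail e ∈ U ∧ G.head e ∈ B \ U}
    let Q : Set E := {e | G.tail e ∉ B ∧ G.head e ∈ U}
    have h3 : G.rhoMinus (B \ U) = P ∪ {e | G.tail e ∉ B ∧ G.head e ∈ B \ U} := by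
      ext e; have := @hU (G.tail e)
      simp only [Set.mem_sdiff] at this
      simp only [rhoMinus, P, Set.mem_union, Set.mem_ofPred_eq, Set.mem_sdiff]; tauto
    have h4 : G.rhoMinus B = Q ∪ {e | G.tail e ∉ B ∧ G.head e ∈ B \ U} := by
      ext e; have := @hU (G.head e)
      simp only [Set.mem_sdiff] at this
      simp only [rhoMinus, Q, Set.mem_union, Set.mem_ofPred_eq, Set.mem_sdiff]; tauto
    rw [h3, h4, Set.ncard_union_eq, Set.ncard_union_eq] at hZ
    rotate_left
    · rw [Set.disjoint_left]; rintro e ⟨h, _⟩ ⟨h', _⟩; exact h' (hU h).1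
    · rw [Set.disjoint_left]; rintro e ⟨_, h⟩ ⟨_, h'⟩; exact h'.2 h
    have h5 : W' ⊆ (W' ∩ I) ∪ Q := by
      intro e he
      rcases hW'sub he with h | h
      · exact Or.inr ⟨h.1, e, he, rfl⟩
      · exact Or.inl ⟨he, h⟩
    have h6 : (W' ∩ I) ∪ P ⊆ (W.biUnion t : Finset E) := by
      rintro e (⟨⟨w, hw, rfl⟩, hI⟩ | he)
      · simp only [Finset.coe_biUnion, Set.mem_iUnion]
        exact ⟨w, hw, by simp [t, hI]⟩
      · obtain ⟨⟨_, ⟨w, hw, rfl⟩, hwe⟩, h2⟩ := he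
        simp only [Finset.coe_biUnion, Set.mem_iUnion]
        refine ⟨w, hw, ?_⟩
        have h7 : G.head w ∈ B \ A := hU ⟨w, ⟨w, hw, rfl⟩, rfl⟩
        have h8 : G.tail e ≠ G.head e := by
          intro h; exact h2.2 (h ▸ ⟨w, ⟨w, hw, rfl⟩, hwe⟩)
        simp only [t, Finset.coe_filter, Finset.mem_univ, true_and, Set.mem_ofPred_eq]
        refine ⟨?_, Or.inr hwe.symm⟩
        by_cases hA : G.head e ∈ A
        · exact Or.inl ⟨hwe ▸ h7, hA⟩
        · exact Or.inr ⟨hwe ▸ h7, ⟨h2.1, hA⟩, h8⟩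
    have h7 := Set.ncard_le_ncard h6 (Finset.finite_toSet _)
    rw [Set.ncard_union_eq, Set.ncard_coe_finset] at h7
    · have h8 := (Set.ncard_le_ncard h5 (Set.toFinite _)).trans (Set.ncard_union_le _ _)
      omega
    · rw [Set.disjoint_left]; rintro e ⟨h, _⟩ ⟨_, h'⟩; exact h'.2 ⟨e, h, rfl⟩
  obtain ⟨φ, hφinj, hφ⟩ := (Finset.all_card_le_biUnion_card_iff_exists_injective t).1 hall
  -- An edge `e` with `nx e = e` is unused; the others are continued by `nx e`.
  let nx : E → E := fun e => if h : e ∈ S ∪ I then φ ⟨e, h⟩ else e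
  have hnx : ∀ e ∈ S ∪ I, nx e ∈ T ∪ I ∧ (nx e = e ∨ G.tail (nx e) = G.head e) := by
    intro e he
    have := hφ ⟨e, he⟩
    simp only [nx, dif_pos he]
    simpa [t] using this
  have hinj : Set.InjOn nx (S ∪ I) := by
    intro e he f hf hef
    simp only [nx, dif_pos he, dif_pos hf] at hef
    simpa using hφinj hef
  have himg : nx '' (S ∪ I) = T ∪ I := by
    refine Set.eq_of_subset_of_ncard_le ?_ ?_ (Set.toFinite _)
    · rintro _ ⟨e, he, rfl⟩; exact (hnx e he).1
    · rw [hinj.ncard_image, Set.ncard_union_eq hSI, Set.ncard_union_eq hTI, hST]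
  refine ⟨G.rhoMinus B ∪ G.rhoMinus A ∪ {e | e ∈ I ∧ nx e ≠ e},
    fun e he => Or.inl (Or.inl he), fun e he => Or.inl (Or.inr he), ?_, ?_, ?_⟩
  · rintro e ((h | h) | h) h'
    · exact h.1 (hAB h'.1)
    · exact h.1 h'.1
    · exact h.1.1.2 h'.1
  · rintro e ((h | h) | h) h'
    · exact h.1 h'.1
    · exact h'.2 (hAB h.2)
    · exact h'.2 h.1.2.1.1
  · intro v hv
    have e1 : (G.rhoMinus B ∪ G.rhoMinus A ∪ {e | e ∈ I ∧ nx e ≠ e}) ∩ G.rhoMinus {v} =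
        {e | e ∈ S ∪ I ∧ nx e ≠ e ∧ G.head e = v} := by
      ext e
      constructor
      · rintro ⟨(h | h) | h, h'⟩
        · obtain rfl : G.head e = v := h'.2
          have hS : e ∈ S := ⟨h.1, hv⟩
          refine ⟨Or.inl hS, fun heq => ?_, rfl⟩
          rcases heq ▸ (hnx e (Or.inl hS)).1 with h | h
          · exact hS.1 h.1.1
          · exact hS.1 h.1.1
        · obtain rfl : G.head e = v := h'.2
          exact absurd h.2 hv.2
        · exact ⟨Or.inr h.1, h.2, h'.2⟩
      · rintro ⟨h | h, hne, rfl⟩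
        · exact ⟨Or.inl (Or.inl ⟨h.1, h.2.1⟩), fun h' => h.1 (by
               rw [Set.mem_singleton_iff.1 h']; exact hv.1), rfl⟩
        · exact ⟨Or.inr ⟨h, hne⟩, fun h' => h.2.2 h', rfl⟩
    have e2 : (G.rhoMinus B ∪ G.rhoMinus A ∪ {e | e ∈ I ∧ nx e ≠ e}) ∩ G.rhoPlus {v} =
        nx '' {e | e ∈ S ∪ I ∧ nx e ≠ e ∧ G.head e = v} := by
      ext f
      constructor
      · rintro ⟨h, hf1, hf2⟩
        obtain rfl : G.tail f = v := hf1
        have hf : f ∈ T ∪ I ∧ (f ∈ I → nx f ≠ f) := by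
          rcases h with (h | h) | h
          · exact absurd hv.1 h.1
          · exact ⟨Or.inl ⟨hv, h.2⟩, fun h' => absurd h.2 h'.2.1.2⟩
          · exact ⟨Or.inr h.1, fun _ => h.2⟩
        obtain ⟨e, he, rfl⟩ := himg ▸ hf.1
        have hne : nx e ≠ e := by
          intro heq
          rcases he with he | he
          · rcases heq ▸ (hnx e (Or.inl he)).1 with h | h
            · exact he.1 h.1.1
            · exact he.1 h.1.1
          · have := hf.2 (heq.symm ▸ he)
            rw [heq] at this
            exact this heq
        exact ⟨e, ⟨he, hne, (((hnx e he).2.resolve_left hne)).symm⟩, rfl⟩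
      · rintro ⟨e, ⟨he, hne, rfl⟩, rfl⟩
        obtain ⟨h1, h2⟩ := hnx e he
        have h2 := h2.resolve_left hne
        rcases h1 with h1 | h1
        · exact ⟨Or.inl (Or.inr ⟨h1.1.2, h1.2⟩), h2, fun h => hv.2 (h ▸ h1.2)⟩
        · refine ⟨Or.inr ⟨h1, fun heq => hne (hinj (Or.inr h1) he heq)⟩, h2, fun h => ?_⟩
          exact h1.2.2 (h2.trans h.symm)
    rw [e1, e2, (hinj.mono fun e he => he.1).ncard_image]

/-- A flow as in `exists_inward_flow` can be followed at each vertex `v` of a set `R`: there is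
a bijection from the in-edges to the out-edges of `v` that respects the flow and lies in the link
of `v`, if there is one. -/
theorem exists_transition [Finite V] [Finite E] (hG : G.IsEulerian) {R : Set V} {X : Set E}
    (hX : ∀ v ∈ R, (X ∩ G.rhoMinus {v}).ncard = (X ∩ G.rhoPlus {v}).ncard)
    (m : V → Option (Set (Set (E × E))))
    (hm : ∀ v L, m v = some L → IsWellLinked (G.rhoMinus {v}) (G.rhoPlus {v}) L) :
    ∃ σ : E → E, (∀ e, G.head e ∈ R → G.tail e ≠ G.head e →
        G.tail (σ e) = G.head e ∧ G.head (σ e) ≠ G.head e ∧ (σ e ∈ X ↔ e ∈ X)) ∧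
      (∀ e f, G.head e ∈ R ∧ G.tail e ≠ G.head e → G.head f ∈ R ∧ G.tail f ≠ G.head f →
        σ e = σ f → e = f) ∧
      ∀ v ∈ R, ∀ L, m v = some L → ∃ M ∈ L, ∀ e ∈ G.rhoMinus {v}, (e, σ e) ∈ M := by
  classical
  have key : ∀ v ∈ R, ∃ M : Set (E × E), (∀ L, m v = some L → M ∈ L) ∧
      (∀ p ∈ M, p.2 ∈ G.rhoPlus {v} ∧ (p.2 ∈ X ↔ p.1 ∈ X)) ∧
      (∀ e ∈ G.rhoMinus {v}, ∃ f, (e, f) ∈ M) ∧ ∀ p ∈ M, ∀ q ∈ M, p.2 = q.2 → p = q := by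
    intro v hv
    obtain ⟨L, hL, hLm⟩ : ∃ L, IsWellLinked (G.rhoMinus {v}) (G.rhoPlus {v}) L ∧
        ∀ L', m v = some L' → L' = L := by
      cases h : m v with
      | none => exact ⟨Set.univ, isWellLinked_univ _ _, by simp⟩
      | some L => exact ⟨L, hm v L h, by simp⟩
    -- Since `X` is balanced at `v`, so is its complement; these are the two parts to be matched.
    have h1 := Set.ncard_inter_add_ncard_sdiff_eq_ncard (G.rhoMinus {v}) X (Set.toFinite _)
    have h2 := Set.ncard_inter_add_ncard_sdiff_eq_ncard (G.rhoPlus {v}) X (Set.toFinite _)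
    have h3 := hX v hv
    have h4 := hG.ncard_rhoMinus_eq {v}
    rw [Set.inter_comm] at h1 h2
    obtain ⟨MX, MY, ⟨⟨x1, x2, x3⟩, x4, x5⟩, ⟨⟨y1, y2, y3⟩, y4, y5⟩, hML⟩ := hL
      (X ∩ G.rhoMinus {v}) (G.rhoMinus {v} \ X) (X ∩ G.rhoPlus {v}) (G.rhoPlus {v} \ X)
      (Set.union_subset Set.inter_subset_right Set.sdiff_subset)
      (Set.union_subset Set.inter_subset_right Set.sdiff_subset)
      (Set.disjoint_left.2 fun e h h' => h'.2 h.1) (Set.disjoint_left.2 fun e h h' => h'.2 h.1)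
      (by rw [← (Set.toFinite _).cast_ncard_eq, ← (Set.toFinite _).cast_ncard_eq, h3])
      (by rw [← (Set.toFinite _).cast_ncard_eq, ← (Set.toFinite _).cast_ncard_eq]
          congr 1; omega)
    refine ⟨MX ∪ MY, fun L' hL' => hLm L' hL' ▸ hML, ?_, ?_, ?_⟩
    · rintro p (hp | hp)
      · have := x1 hp
        exact ⟨this.2.2, iff_of_true this.2.1 this.1.1⟩
      · have := y1 hp
        exact ⟨this.2.1, iff_of_false this.2.2 this.1.2⟩
    · intro e he
      by_cases h : e ∈ X
      · obtain ⟨f, hf⟩ := x4 e ⟨h, he⟩; exact ⟨f, Or.inl hf⟩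
      · obtain ⟨f, hf⟩ := y4 e ⟨he, h⟩; exact ⟨f, Or.inr hf⟩
    · rintro p (hp | hp) q (hq | hq) hpq
      · exact x3 p hp q hq hpq
      · exact absurd (hpq ▸ (x1 hp).2.1) (y1 hq).2.2
      · exact absurd (hpq ▸ (x1 hq).2.1) (y1 hp).2.2
      · exact y3 p hp q hq hpq
  choose! M hML hM1 hM2 hM3 using key
  choose! σ hσ using hM2
  have hmem : ∀ e, G.head e ∈ R → G.tail e ≠ G.head e → (e, σ (G.head e) e) ∈ M (G.head e) :=
    fun e he hne => hσ _ he e ⟨hne, rfl⟩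
  refine ⟨fun e => σ (G.head e) e, ?_, ?_, ?_⟩
  · intro e he hne
    obtain ⟨⟨h1, h2⟩, h3⟩ := hM1 _ he _ (hmem e he hne)
    exact ⟨h1, h2, h3⟩
  · rintro e f ⟨he, hne⟩ ⟨hf, hnf⟩ hef
    have h1 : G.tail (σ (G.head e) e) = G.head e := (hM1 _ he _ (hmem e he hne)).1.1
    have h2 : G.tail (σ (G.head f) f) = G.head f := (hM1 _ hf _ (hmem f hf hnf)).1.1
    have h3 : G.head e = G.head f := by rw [← h1, ← h2]; exact congrArg _ hef
    have h4 := hmem f hf hnf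
    rw [← h3] at h4
    have h5 : σ (G.head e) e = σ (G.head e) f := by
      have h6 : σ (G.head e) e = σ (G.head f) f := hef
      rw [← h3] at h6; exact h6
    exact congrArg Prod.fst (hM3 _ he _ (hmem e he hne) _ h4 h5)
  · intro v hv L hL
    refine ⟨M v, hML v hv L hL, ?_⟩
    rintro e ⟨h1, rfl⟩
    exact hmem e hv h1

/-- A linkage between the cuts of `A ⊆ B`: a bijection `τ` between the cuts and edge-disjoint
paths `Q b` that join `b` and `τ b`, directed as these edges are, all of whose internal vertices
lie in `B \ A`. The paths are feasible for the links at these vertices. -/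
structure IsLinkage (G : MultiDigraph V E) (m : V → Option (Set (Set (E × E)))) (A B : Set V)
    (τ : E → E) (Q : E → List E) : Prop where
  bijOn : Set.BijOn τ (G.rho B) (G.rho A)
  path : ∀ b ∈ G.rho B, (Q b).Nodup ∧
    (Q b).IsChain (fun e f => G.head e = G.tail f ∧ G.head e ∈ B \ A) ∧
    ((b ∈ G.rhoMinus B ∧ τ b ∈ G.rhoMinus A ∧ (Q b).head? = some b ∧
        (Q b).getLast? = some (τ b)) ∨
      (b ∈ G.rhoPlus B ∧ τ b ∈ G.rhoPlus A ∧ (Q b).head? = some (τ b) ∧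
        (Q b).getLast? = some b))
  disjoint : ∀ b ∈ G.rho B, ∀ b' ∈ G.rho B, b ≠ b' → List.Disjoint (Q b) (Q b')
  feasible : ∀ v ∈ B \ A, ∀ L, m v = some L → ∃ M ∈ L, ∀ b ∈ G.rho B, ∀ e f, [e, f] <:+: Q b →
    G.head e = v → (e, f) ∈ M

/-- Two nested cuts of minimum size are joined by a linkage. The orbits of a transition that
respects an inward flow cannot leave the flow or enter it, so they join the cuts in the right
direction. -/
theorem exists_linkage [Finite V] [Finite E] (hG : G.IsEulerian) {A B : Set V} (hAB : A ⊆ B)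
    (heq : G.cutSize A = G.cutSize B)
    (hmin : ∀ Z, A ⊆ Z → Z ⊆ B → G.cutSize B ≤ G.cutSize Z)
    (m : V → Option (Set (Set (E × E))))
    (hm : ∀ v L, m v = some L → IsWellLinked (G.rhoMinus {v}) (G.rhoPlus {v}) L) :
    ∃ (τ : E → E) (Q : E → List E), G.IsLinkage m A B τ Q := by
  classical
  obtain ⟨X, hXB, hXA, hXA', hXB', hX⟩ := exists_inward_flow hG hAB heq hmin
  obtain ⟨σ, hσ, hσinj, hσm⟩ := exists_transition hG hX m hm
  let p : E → Prop := fun e => G.head e ∈ B \ A ∧ G.tail e ≠ G.head e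
  -- The inward paths start in edges entering `B`, the outward ones in edges leaving `A`.
  let St : Set E := G.rhoMinus B ∪ G.rhoPlus A
  have hSt : ∀ c ∈ St, G.tail c ∉ B \ A ∧ G.tail c ≠ G.head c := by
    rintro c (h | h)
    · exact ⟨fun h' => h.1 h'.1, fun h' => h.1 (h' ▸ h.2)⟩
    · exact ⟨fun h' => h'.2 h.1, fun h' => h.2 (h' ▸ h.1)⟩
  have hstart : ∀ c ∈ St, ∀ x, p x → σ x ≠ c := by
    rintro c hc x hx rfl
    exact (hSt _ hc).1 ((hσ x hx.1 hx.2).1.symm ▸ hx.1)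
  have hN : ∀ c ∈ St, ∃ N, ¬ p (σ^[N] c) ∧ ∀ i < N, p (σ^[i] c) :=
    fun c hc => exists_orbit_end hσinj (hstart c hc)
  choose! N hN1 hN2 using hN
  let z : E → E := fun c => σ^[N c] c
  have hclass : ∀ c ∈ St, ∀ i ≤ N c, (σ^[i] c ∈ X ↔ c ∈ X) ∧
      G.tail (σ^[i] c) ≠ G.head (σ^[i] c) ∧ (σ^[i] c = c ∨ G.tail (σ^[i] c) ∈ B \ A) := by
    intro c hc i
    induction i with
    | zero => exact fun _ => ⟨Iff.rfl, (hSt c hc).2, Or.inl rfl⟩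
    | succ i ih =>
      intro hi
      have hp := hN2 c hc i (by omega)
      obtain ⟨h1, h2, h3⟩ := hσ _ hp.1 hp.2
      rw [Function.iterate_succ_apply']
      exact ⟨h3.trans (ih (by omega)).1, fun h => h2 (h ▸ h1), Or.inr (h1 ▸ hp.1)⟩
  have hzR : ∀ c ∈ St, G.head (z c) ∉ B \ A := fun c hc h =>
    hN1 c hc ⟨h, (hclass c hc _ le_rfl).2.1⟩
  have hzinj : ∀ c ∈ St, ∀ c' ∈ St, ∀ i ≤ N c, ∀ j ≤ N c', σ^[i] c = σ^[j] c' → i = j ∧ c = c' :=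
    fun c hc c' hc' i hi j hj h => iterate_injective_of_start hσinj (hstart c hc) (hstart c' hc')
      (fun l hl => hN2 c hc l (by omega)) (fun l hl => hN2 c' hc' l (by omega)) h
  -- Within `X` an orbit cannot end in an edge leaving `B`, so it ends in one entering `A`; outside
  -- of `X` it cannot end in an edge entering `A`, so it ends in one leaving `B`.
  have hzB : ∀ c ∈ G.rhoMinus B, z c ∈ G.rhoMinus A := by
    intro c hc
    obtain ⟨h1, -, h3⟩ := hclass c (Or.inl hc) _ le_rfl
    have hzX : z c ∈ X := h1.2 (hXB hc)
    have hzr := hzR c (Or.inl hc)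
    change z c = c ∨ G.tail (z c) ∈ B \ A at h3
    rcases h3 with h3 | h3
    · rw [h3] at hzr ⊢
      exact ⟨fun h => hc.1 (hAB h), by_contra fun h => hzr ⟨hc.2, h⟩⟩
    · by_cases hh : G.head (z c) ∈ B
      · exact ⟨h3.2, by_contra fun h => hzr ⟨hh, h⟩⟩
      · exact absurd ⟨h3.1, hh⟩ (hXB' _ hzX)
  have hzA : ∀ c ∈ G.rhoPlus A, z c ∈ G.rhoPlus B := by
    intro c hc
    obtain ⟨h1, -, h3⟩ := hclass c (Or.inr hc) _ le_rfl
    have hzX : z c ∉ X := fun h => hXA' _ (h1.1 h) hc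
    have hzr := hzR c (Or.inr hc)
    change z c = c ∨ G.tail (z c) ∈ B \ A at h3
    rcases h3 with h3 | h3
    · rw [h3] at hzr ⊢
      exact ⟨hAB hc.1, fun h => hzr ⟨h, hc.2⟩⟩
    · refine ⟨h3.1, fun hh => hzX (hXA ⟨h3.2, by_contra fun h => hzr ⟨hh, h⟩⟩)⟩
  have hsurj : z '' G.rhoPlus A = G.rhoPlus B := by
    refine Set.eq_of_subset_of_ncard_le ?_ ?_ (Set.toFinite _)
    · rintro _ ⟨c, hc, rfl⟩; exact hzA c hc
    · rw [Set.InjOn.ncard_image fun c hc c' hc' h =>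
        (hzinj c (Or.inr hc) c' (Or.inr hc') _ le_rfl _ le_rfl h).2]
      have h1 := hG.two_mul_ncard_rhoMinus A
      have h2 := hG.two_mul_ncard_rhoMinus B
      rw [hG.ncard_rhoMinus_eq] at h1 h2
      omega
  have hw : ∀ b ∈ G.rhoPlus B, ∃ c ∈ G.rhoPlus A, z c = b := by
    intro b hb; rw [← hsurj] at hb; exact hb
  choose! w hw1 hw2 using hw
  -- The path at `b` starts in `st b`, which is `b` itself or the start of the orbit ending in `b`.
  let st : E → E := fun b => if b ∈ G.rhoMinus B then b else w b
  let τ : E → E := fun b => if b ∈ G.rhoMinus B then z b else w b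
  have hcases : ∀ b ∈ G.rho B, (b ∈ G.rhoMinus B ∧ st b = b ∧ τ b = z b) ∨
      (b ∈ G.rhoPlus B ∧ b ∉ G.rhoMinus B ∧ st b = w b ∧ τ b = w b) := by
    rintro b hb
    by_cases h : b ∈ G.rhoMinus B
    · exact Or.inl ⟨h, if_pos h, if_pos h⟩
    · exact Or.inr ⟨hb.resolve_left h, h, if_neg h, if_neg h⟩
  have hst : ∀ b ∈ G.rho B, st b ∈ St := by
    intro b hb
    rcases hcases b hb with ⟨h, h', -⟩ | ⟨h, -, h', -⟩ <;> rw [h']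
    · exact Or.inl h
    · exact Or.inr (hw1 b h)
  have hstinj : ∀ b ∈ G.rho B, ∀ b' ∈ G.rho B, st b = st b' → b = b' := by
    intro b hb b' hb' h
    rcases hcases b hb with ⟨h1, h2, -⟩ | ⟨h1, h1', h2, -⟩ <;>
      rcases hcases b' hb' with ⟨h3, h4, -⟩ | ⟨h3, h3', h4, -⟩ <;> rw [h2, h4] at h
    · exact h
    · exact absurd (hAB (hw1 b' h3).1) (h ▸ h1.1)
    · exact absurd (hAB (hw1 b h1).1) (h ▸ h3.1)
    · rw [← hw2 b h1, h, hw2 b' h3]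
  have hτmem : ∀ b ∈ G.rho B, τ b ∈ G.rho A := by
    intro b hb
    rcases hcases b hb with ⟨h, -, h'⟩ | ⟨h, -, -, h'⟩ <;> rw [h']
    · exact Or.inl (hzB b h)
    · exact Or.inr (hw1 b h)
  have hτinj : Set.InjOn τ (G.rho B) := by
    intro b hb b' hb' h
    rcases hcases b hb with ⟨h1, -, h2⟩ | ⟨h1, h1', -, h2⟩ <;>
      rcases hcases b' hb' with ⟨h3, -, h4⟩ | ⟨h3, h3', -, h4⟩ <;> rw [h2, h4] at h
    · exact (hzinj b (Or.inl h1) b' (Or.inl h3) _ le_rfl _ le_rfl h).2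
    · exact absurd (hw1 b' h3).1 (h ▸ (hzB b h1).1)
    · exact absurd (hw1 b h1).1 (h ▸ (hzB b' h3).1)
    · rw [← hw2 b h1, h, hw2 b' h3]
  refine ⟨τ, fun b => orbitList σ (st b) (N (st b)), ⟨hτmem, hτinj, ?_⟩, ?_, ?_, ?_⟩
  · have : τ '' G.rho B = G.rho A := by
      refine Set.eq_of_subset_of_ncard_le ?_ ?_ (Set.toFinite _)
      · rintro _ ⟨b, hb, rfl⟩; exact hτmem b hb
      · rw [hτinj.ncard_image]; exact heq.le
    exact this.symm.subset
  · intro b hb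
    refine ⟨?_, ?_, ?_⟩
    · refine List.Nodup.map_on ?_ List.nodup_range
      intro i hi j hj h
      rw [List.mem_range, Nat.lt_succ_iff] at hi hj
      exact (hzinj _ (hst b hb) _ (hst b hb) i hi j hj h).1
    · refine (isChain_orbitList (p := p) (hN2 _ (hst b hb))).imp ?_
      rintro e f ⟨he, rfl⟩
      exact ⟨(hσ e he.1 he.2).1.symm, he.1⟩
    · rcases hcases b hb with ⟨h1, h2, h3⟩ | ⟨h1, h1', h2, h3⟩
      · refine Or.inl ⟨h1, ?_, ?_, ?_⟩
        · rw [h3]; exact hzB b h1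
        · simp [h2]
        · simp [h2, h3, z]
      · refine Or.inr ⟨h1, ?_, ?_, ?_⟩
        · rw [h3]; exact hw1 b h1
        · simp [h2, h3]
        · rw [getLast?_orbitList, h2]; exact congrArg some (hw2 b h1)
  · intro b hb b' hb' hne x hx hx'
    obtain ⟨i, hi, rfl⟩ := mem_orbitList.1 hx
    obtain ⟨j, hj, h⟩ := mem_orbitList.1 hx'
    exact hne (hstinj b hb b' hb' (hzinj _ (hst b hb) _ (hst b' hb') i hi j hj h.symm).2)
  · intro v hv L hL
    obtain ⟨M, hM, hMσ⟩ := hσm v hv L hL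
    refine ⟨M, hM, fun b hb e f hef hev => ?_⟩
    obtain ⟨he, rfl⟩ := (isChain_orbitList (p := p) (hN2 _ (hst b hb))).of_pair_infix hef
    subst hev
    exact hMσ e ⟨he.2, rfl⟩

/-- The only edge of a path of a linkage that has an end in `A` is the one in the cut of `A`. -/
theorem IsLinkage.eq_of_mem {m : V → Option (Set (Set (E × E)))} {A B : Set V} {τ : E → E}
    {Q : E → List E} (h : G.IsLinkage m A B τ Q) (hAB : A ⊆ B) {b x : E} (hb : b ∈ G.rho B)
    (hx : x ∈ Q b) (hxA : G.tail x ∈ A ∨ G.head x ∈ A) : x = τ b := by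
  obtain ⟨-, hc, he⟩ := h.path b hb
  have htail : G.tail x ∈ A → (Q b).head? = some x := fun hA =>
    (head?_eq_or_pair_infix hx).resolve_right fun ⟨w, hw⟩ =>
      ((hc.of_pair_infix hw).1 ▸ (hc.of_pair_infix hw).2).2 hA
  have hhead : G.head x ∈ A → (Q b).getLast? = some x := fun hA =>
    (getLast?_eq_or_pair_infix hx).resolve_right fun ⟨w, hw⟩ => (hc.of_pair_infix hw).2.2 hA
  rcases he with ⟨h1, h2, h3, h4⟩ | ⟨h1, h2, h3, h4⟩ <;> rcases hxA with hA | hA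
  · have := htail hA
    rw [h3, Option.some_inj] at this
    exact absurd (hAB hA) (this ▸ h1.1)
  · have := hhead hA
    rw [h4, Option.some_inj] at this
    exact this.symm
  · have := htail hA
    rw [h3, Option.some_inj] at this
    exact this.symm
  · have := hhead hA
    rw [h4, Option.some_inj] at this
    exact absurd (hAB hA) (this ▸ h1.2)

end MultiDigraph

/-! ### Immersions of parts of a knitwork -/

section Ordering

variable {E : Type v} {l : List E} {S : Set E}

theorem IsOrdering.exists_index (h : IsOrdering l S) {e : E} (he : e ∈ S) :
    ∃ i : ℕ, l[i]? = some e :=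
  List.mem_iff_getElem?.1 ((h.2 e).2 he)

theorem IsOrdering.mem (h : IsOrdering l S) {i : ℕ} {e : E} (he : l[i]? = some e) : e ∈ S :=
  (h.2 e).1 (List.mem_of_getElem? he)

theorem IsOrdering.index_inj (h : IsOrdering l S) {i j : ℕ} {e : E} (hi : l[i]? = some e)
    (hj : l[j]? = some e) : i = j := by
  obtain ⟨hi', -⟩ := List.getElem?_eq_some_iff.1 hi
  exact (List.getElem?_inj hi' h.1).1 (hi.trans hj.symm)

theorem exists_getElem?_of_length_eq {E' : Type v'} {l' : List E'} (h : l.length = l'.length)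
    {i : ℕ} {e : E} (hi : l[i]? = some e) : ∃ e', l'[i]? = some e' := by
  obtain ⟨hi', -⟩ := List.getElem?_eq_some_iff.1 hi
  exact ⟨l'[i]'(h ▸ hi'), List.getElem?_eq_getElem _⟩

end Ordering

section

variable {Ω : Type w} [Preorder Ω] {K K' : Knitwork.{u, v} Ω}

/-- An immersion of the part of `K` at the vertex set `A` into the part of `K'` at `A'`. Every edge
is sent to a path whose internal vertices lie in `A'`, possibly to the empty one; this path must
begin and end in the right vertex as far as the ends of the edge lie in `A`. -/
structure IsPartialImmersion (K K' : Knitwork.{u, v} Ω) (A : Set K.V) (A' : Set K'.V)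
    (f : K.V → K'.V) (g : K.E → List K'.E) : Prop where
  maps : ∀ x ∈ A, f x ∈ A'
  inj : ∀ x ∈ A, ∀ y ∈ A, f x = f y → x = y
  nodup : ∀ e, (g e).Nodup
  chain : ∀ e, (g e).IsChain fun a b => K'.G.head a = K'.G.tail b ∧ K'.G.head a ∈ A' ∧
    ∀ x ∈ A, f x ≠ K'.G.head a
  start_eq : ∀ e, K.G.tail e ∈ A → (g e).head?.map K'.G.tail = some (f (K.G.tail e))
  end_eq : ∀ e, K.G.head e ∈ A → (g e).getLast?.map K'.G.head = some (f (K.G.head e))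
  disjoint : ∀ e₁ e₂, e₁ ≠ e₂ → List.Disjoint (g e₁) (g e₂)
  mu_dom : ∀ x ∈ A, (K'.mu (f x)).isSome ↔ (K.mu x).isSome
  m_dom : ∀ x ∈ A, (K'.m (f x)).isSome ↔ (K.m x).isSome
  mu_respected : ∀ x ∈ A, ∀ l l', K.mu x = some l → K'.mu (f x) = some l' →
    l.length = l'.length ∧
      ∀ (i : ℕ) (e : K.E) (e' : K'.E), l[i]? = some e → l'[i]? = some e' → e' ∈ g e
  routing_feasible : ∀ x' ∈ A', ∀ L', K'.m x' = some L' → (∀ x ∈ A, f x ≠ x') →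
    routing K'.G g x' ∈ L'
  link_iff : ∀ x ∈ A, ∀ L l L' l', K.m x = some L → K.mu x = some l →
    K'.m (f x) = some L' → K'.mu (f x) = some l' →
    ∀ I : Set (ℕ × ℕ), pairsAt l I ∈ L ↔ pairsAt l' I ∈ L'
  label_le : ∀ x ∈ A, ∀ a, K.Phi x = some a → ∃ b, K'.Phi (f x) = some b ∧ a ≤ b

open Classical in
/-- The vertex map that agrees with `f₁` on `A` and with `f₂` elsewhere. -/
noncomputable def glueVertex (A : Set K.V) (f₁ f₂ : K.V → K'.V) (x : K.V) : K'.V :=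
  if x ∈ A then f₁ x else f₂ x

open Classical in
/-- The edge map that splices the images of an edge under `g₁` and `g₂`, the former coming first if
the tail of the edge lies in `A`. -/
noncomputable def glueEdge (A : Set K.V) (g₁ g₂ : K.E → List K'.E) (e : K.E) : List K'.E :=
  if K.G.tail e ∈ A then splice (g₁ e) (g₂ e) else splice (g₂ e) (g₁ e)

namespace IsPartialImmersion

variable {A A₁ A₂ : Set K.V} {A' A₁' A₂' : Set K'.V} {f f₁ f₂ : K.V → K'.V}
  {g g₁ g₂ : K.E → List K'.E}

theorem exists_head? (h : IsPartialImmersion K K' A A' f g) {e : K.E} (he : K.G.tail e ∈ A) :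
    ∃ a, (g e).head? = some a ∧ K'.G.tail a = f (K.G.tail e) := by
  simpa using h.start_eq e he

theorem exists_getLast? (h : IsPartialImmersion K K' A A' f g) {e : K.E} (he : K.G.head e ∈ A) :
    ∃ a, (g e).getLast? = some a ∧ K'.G.head a = f (K.G.head e) := by
  simpa using h.end_eq e he

/-- Two partial immersions into disjoint parts combine to one of the union, if the
two images of an edge share at most the edge at which they are to be spliced. -/
theorem glue (h₁ : IsPartialImmersion K K' A₁ A₁' f₁ g₁) (h₂ : IsPartialImmersion K K' A₂ A₂' f₂ g₂)
    (hA : Disjoint A₁ A₂) (hA' : Disjoint A₁' A₂')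
    (hj₁ : ∀ e, K.G.tail e ∈ A₁ → Spliceable (g₁ e) (g₂ e))
    (hj₂ : ∀ e, K.G.tail e ∉ A₁ → Spliceable (g₂ e) (g₁ e))
    (hx : ∀ e₁ e₂ x, x ∈ g₁ e₁ → x ∈ g₂ e₂ → e₁ = e₂ ∧
      (K.G.tail e₁ ∈ A₁ → (g₁ e₁).getLast? = some x) ∧
      (K.G.tail e₁ ∉ A₁ → (g₂ e₁).getLast? = some x))
    (ho₁ : ∀ e, K.G.tail e ∈ A₁ → K.G.head e ∈ A₁ → g₂ e = [])
    (ho₂ : ∀ e, K.G.tail e ∉ A₁ → K.G.head e ∈ A₂ → g₁ e = []) :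
    IsPartialImmersion K K' (A₁ ∪ A₂) (A₁' ∪ A₂') (glueVertex A₁ f₁ f₂) (glueEdge A₁ g₁ g₂) := by
  have hf₁ : ∀ x ∈ A₁, glueVertex A₁ f₁ f₂ x = f₁ x := fun x hx => if_pos hx
  have hf₂ : ∀ x ∈ A₂, glueVertex A₁ f₁ f₂ x = f₂ x := fun x hx =>
    if_neg fun h => hA.le_bot ⟨h, hx⟩
  have hg₁ : ∀ e, K.G.tail e ∈ A₁ → glueEdge A₁ g₁ g₂ e = splice (g₁ e) (g₂ e) :=
    fun x hx => if_pos hx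
  have hg₂ : ∀ e, K.G.tail e ∉ A₁ → glueEdge A₁ g₁ g₂ e = splice (g₂ e) (g₁ e) :=
    fun x hx => if_neg hx
  have hmem : ∀ e x, x ∈ glueEdge A₁ g₁ g₂ e ↔ x ∈ g₁ e ∨ x ∈ g₂ e := by
    intro e x
    by_cases he : K.G.tail e ∈ A₁
    · rw [hg₁ e he, mem_splice (hj₁ e he)]
    · rw [hg₂ e he, mem_splice (hj₂ e he), or_comm]
  have hpair : ∀ e x y, [x, y] <:+: glueEdge A₁ g₁ g₂ e → [x, y] <:+: g₁ e ∨ [x, y] <:+: g₂ e := by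
    intro e x y hxy
    by_cases he : K.G.tail e ∈ A₁
    · rw [hg₁ e he] at hxy; exact pair_infix_splice (hj₁ e he) hxy
    · rw [hg₂ e he] at hxy; exact (pair_infix_splice (hj₂ e he) hxy).symm
  have hne : ∀ x ∈ A₁', ∀ y ∈ A₂', x ≠ y := by
    rintro x hx _ hy rfl; exact hA'.le_bot ⟨hx, hy⟩
  constructor
  case maps =>
    rintro x (hx | hx)
    · rw [hf₁ x hx]; exact Or.inl (h₁.maps x hx)
    · rw [hf₂ x hx]; exact Or.inr (h₂.maps x hx)
  case inj =>
    rintro x (hx | hx) y (hy | hy) hxy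
    · rw [hf₁ x hx, hf₁ y hy] at hxy; exact h₁.inj x hx y hy hxy
    · rw [hf₁ x hx, hf₂ y hy] at hxy; exact absurd hxy (hne _ (h₁.maps x hx) _ (h₂.maps y hy))
    · rw [hf₂ x hx, hf₁ y hy] at hxy; exact absurd hxy.symm (hne _ (h₁.maps y hy) _ (h₂.maps x hx))
    · rw [hf₂ x hx, hf₂ y hy] at hxy; exact h₂.inj x hx y hy hxy
  case nodup =>
    intro e
    by_cases he : K.G.tail e ∈ A₁
    · rw [hg₁ e he]
      exact nodup_splice (hj₁ e he) (h₁.nodup e) (h₂.nodup e)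
        fun x h h' => (hx e e x h h').2.1 he
    · rw [hg₂ e he]
      exact nodup_splice (hj₂ e he) (h₂.nodup e) (h₁.nodup e)
        fun x h h' => (hx e e x h' h).2.2 he
  case chain =>
    intro e
    refine isChain_of_pair_infix fun a b hab => ?_
    rcases hpair e a b hab with hab | hab
    · obtain ⟨c1, c2, c3⟩ := (h₁.chain e).of_pair_infix hab
      refine ⟨c1, Or.inl c2, ?_⟩
      rintro x (hx | hx)
      · rw [hf₁ x hx]; exact c3 x hx
      · rw [hf₂ x hx]; exact (hne _ c2 _ (h₂.maps x hx)).symm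
    · obtain ⟨c1, c2, c3⟩ := (h₂.chain e).of_pair_infix hab
      refine ⟨c1, Or.inr c2, ?_⟩
      rintro x (hx | hx)
      · rw [hf₁ x hx]; exact hne _ (h₁.maps x hx) _ c2
      · rw [hf₂ x hx]; exact c3 x hx
  case start_eq =>
    rintro e (he | he)
    · obtain ⟨a, ha, ha'⟩ := h₁.exists_head? he
      rw [hg₁ e he, head?_splice, ha, hf₁ _ he, ← ha']; rfl
    · obtain ⟨a, ha, ha'⟩ := h₂.exists_head? he
      rw [hg₂ e fun h => hA.le_bot ⟨h, he⟩, head?_splice, ha, hf₂ _ he, ← ha']; rfl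
  case end_eq =>
    rintro e (he | he)
    · obtain ⟨a, ha, ha'⟩ := h₁.exists_getLast? he
      by_cases ht : K.G.tail e ∈ A₁
      · rw [hg₁ e ht, ho₁ e ht he, splice_nil_right, ha, hf₁ _ he, ← ha']; rfl
      · rw [hg₂ e ht, getLast?_splice (hj₂ e ht), ha, hf₁ _ he, ← ha']; rfl
    · obtain ⟨a, ha, ha'⟩ := h₂.exists_getLast? he
      by_cases ht : K.G.tail e ∈ A₁
      · rw [hg₁ e ht, getLast?_splice (hj₁ e ht), ha, hf₂ _ he, ← ha']; rfl
      · rw [hg₂ e ht, ho₂ e ht he, splice_nil_right, ha, hf₂ _ he, ← ha']; rfl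
  case disjoint =>
    intro e₁ e₂ hne x hx₁ hx₂
    rw [hmem] at hx₁ hx₂
    rcases hx₁ with hx₁ | hx₁ <;> rcases hx₂ with hx₂ | hx₂
    · exact h₁.disjoint e₁ e₂ hne hx₁ hx₂
    · exact hne (hx _ _ x hx₁ hx₂).1
    · exact hne (hx _ _ x hx₂ hx₁).1.symm
    · exact h₂.disjoint e₁ e₂ hne hx₁ hx₂
  case mu_dom =>
    rintro x (hx | hx)
    · rw [hf₁ x hx]; exact h₁.mu_dom x hx
    · rw [hf₂ x hx]; exact h₂.mu_dom x hx
  case m_dom =>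
    rintro x (hx | hx)
    · rw [hf₁ x hx]; exact h₁.m_dom x hx
    · rw [hf₂ x hx]; exact h₂.m_dom x hx
  case mu_respected =>
    rintro x (hx | hx) l l' hl hl'
    · rw [hf₁ x hx] at hl'
      obtain ⟨h, h'⟩ := h₁.mu_respected x hx l l' hl hl'
      exact ⟨h, fun i e e' he he' => (hmem e e').2 (Or.inl (h' i e e' he he'))⟩
    · rw [hf₂ x hx] at hl'
      obtain ⟨h, h'⟩ := h₂.mu_respected x hx l l' hl hl'
      exact ⟨h, fun i e e' he he' => (hmem e e').2 (Or.inr (h' i e e' he he'))⟩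
  case routing_feasible =>
    rintro x' (hx' | hx') L' hL' hno
    · refine K'.m_reliable x' L' hL' _ (h₁.routing_feasible x' hx' L' hL' fun x hx => ?_) _ ?_
      · rw [← hf₁ x hx]; exact hno x (Or.inl hx)
      · rintro ⟨a, b⟩ ⟨ha, hb, e, hab⟩
        refine ⟨ha, hb, e, (hpair e a b hab).resolve_right fun h => ?_⟩
        have h3 := ((h₂.chain e).of_pair_infix h).2.1
        have h4 : K'.G.head a = x' := ha.2
        exact hne x' hx' x' (h4 ▸ h3) rfl
    · refine K'.m_reliable x' L' hL' _ (h₂.routing_feasible x' hx' L' hL' fun x hx => ?_) _ ?_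
      · rw [← hf₂ x hx]; exact hno x (Or.inr hx)
      · rintro ⟨a, b⟩ ⟨ha, hb, e, hab⟩
        refine ⟨ha, hb, e, (hpair e a b hab).resolve_left fun h => ?_⟩
        have h3 := ((h₁.chain e).of_pair_infix h).2.1
        have h4 : K'.G.head a = x' := ha.2
        exact hne x' (h4 ▸ h3) x' hx' rfl
  case link_iff =>
    rintro x (hx | hx)
    · rw [hf₁ x hx]; exact h₁.link_iff x hx
    · rw [hf₂ x hx]; exact h₂.link_iff x hx
  case label_le =>
    rintro x (hx | hx)
    · rw [hf₁ x hx]; exact h₁.label_le x hx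
    · rw [hf₂ x hx]; exact h₂.label_le x hx

end IsPartialImmersion

/-- A partial immersion of the part of `K` at `A`, whose cut is ordered by `π`, into the part
of `K'` at `A'`, whose cut is ordered by `π'`. The image of the `i`-th edge of the former cut
runs through the `i`-th edge of the latter, at the end at which the edge leaves the part. -/
structure IsPieceImmersion (K K' : Knitwork.{u, v} Ω) (A : Set K.V) (A' : Set K'.V) (π : List K.E)
    (π' : List K'.E) (f : K.V → K'.V) (g : K.E → List K'.E) : Prop
    extends IsPartialImmersion K K' A A' f g where
  nil : ∀ e, K.G.tail e ∉ A → K.G.head e ∉ A → g e = []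
  length_eq : π.length = π'.length
  start_root : ∀ (i : ℕ) (e : K.E) (e' : K'.E), π[i]? = some e → π'[i]? = some e' →
    K.G.tail e ∉ A → (g e).head? = some e'
  end_root : ∀ (i : ℕ) (e : K.E) (e' : K'.E), π[i]? = some e → π'[i]? = some e' →
    K.G.head e ∉ A → (g e).getLast? = some e'

namespace IsPieceImmersion

variable {A A₁ A₂ : Set K.V} {A' A₁' A₂' : Set K'.V} {f f₁ f₂ : K.V → K'.V}
  {g g₁ g₂ : K.E → List K'.E} {π π₁ π₂ : List K.E} {π' π₁' π₂' : List K'.E}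

/-- The edges in the image of an edge lie inside `A'`, except for the cut edge prescribed by the
orderings. -/
theorem inside_or_root (h : IsPieceImmersion K K' A A' π π' f g) (hπ : IsOrdering π (K.G.rho A))
    {e : K.E} {x : K'.E} (hx : x ∈ g e) : (K'.G.tail x ∈ A' ∧ K'.G.head x ∈ A') ∨
      ∃ i : ℕ, π[i]? = some e ∧ π'[i]? = some x := by
  have hroot : ∀ hρ : e ∈ K.G.rho A, ∃ (i : ℕ) (e' : K'.E), π[i]? = some e ∧ π'[i]? = some e' := by
    intro hρ
    obtain ⟨i, hi⟩ := hπ.exists_index hρ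
    obtain ⟨e', he'⟩ := exists_getElem?_of_length_eq h.length_eq hi
    exact ⟨i, e', hi, he'⟩
  have htail : K'.G.tail x ∈ A' ∨ ∃ i : ℕ, π[i]? = some e ∧ π'[i]? = some x := by
    rcases head?_eq_or_pair_infix hx with hh | ⟨w, hw⟩
    · by_cases ht : K.G.tail e ∈ A
      · obtain ⟨a, ha, ha'⟩ := h.exists_head? ht
        rw [hh, Option.some_inj] at ha
        rw [ha, ha']
        exact Or.inl (h.maps _ ht)
      · by_cases hd : K.G.head e ∈ A
        · obtain ⟨i, e', hi, he'⟩ := hroot (K.G.mem_rho.2 (Or.inr ⟨ht, hd⟩))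
          have := h.start_root i e e' hi he' ht
          rw [hh, Option.some_inj] at this
          exact Or.inr ⟨i, hi, this ▸ he'⟩
        · rw [h.nil e ht hd] at hx; simp at hx
    · have := (h.chain e).of_pair_infix hw
      exact Or.inl (this.1 ▸ this.2.1)
  have hhead : K'.G.head x ∈ A' ∨ ∃ i : ℕ, π[i]? = some e ∧ π'[i]? = some x := by
    rcases getLast?_eq_or_pair_infix hx with hh | ⟨w, hw⟩
    · by_cases ht : K.G.head e ∈ A
      · obtain ⟨a, ha, ha'⟩ := h.exists_getLast? ht
        rw [hh, Option.some_inj] at ha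
        rw [ha, ha']
        exact Or.inl (h.maps _ ht)
      · by_cases hd : K.G.tail e ∈ A
        · obtain ⟨i, e', hi, he'⟩ := hroot (K.G.mem_rho.2 (Or.inl ⟨hd, ht⟩))
          have := h.end_root i e e' hi he' ht
          rw [hh, Option.some_inj] at this
          exact Or.inr ⟨i, hi, this ▸ he'⟩
        · rw [h.nil e hd ht] at hx; simp at hx
    · exact Or.inl ((h.chain e).of_pair_infix hw).2.1
  rcases htail with ht | ht
  · exact hhead.imp (fun hh => ⟨ht, hh⟩) id
  · exact Or.inr ht

/-- Immersions of two disjoint pieces can be glued if the orderings of their cuts agree on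
which edges the cuts share. -/
theorem glue_partial (h₁ : IsPieceImmersion K K' A₁ A₁' π₁ π₁' f₁ g₁)
    (h₂ : IsPieceImmersion K K' A₂ A₂' π₂ π₂' f₂ g₂)
    (hA : Disjoint A₁ A₂) (hA' : Disjoint A₁' A₂')
    (hπ₁ : IsOrdering π₁ (K.G.rho A₁)) (hπ₂ : IsOrdering π₂ (K.G.rho A₂))
    (hπ₁' : IsOrdering π₁' (K'.G.rho A₁')) (hπ₂' : IsOrdering π₂' (K'.G.rho A₂'))
    (h₁₂ : ∀ i j : ℕ, (∃ e, π₁[i]? = some e ∧ π₂[j]? = some e) ↔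
      ∃ e, π₁'[i]? = some e ∧ π₂'[j]? = some e) :
    IsPartialImmersion K K' (A₁ ∪ A₂) (A₁' ∪ A₂') (glueVertex A₁ f₁ f₂) (glueEdge A₁ g₁ g₂) := by
  have hA1 : ∀ {x}, x ∈ A₁ → x ∉ A₂ := fun h h' => hA.le_bot ⟨h, h'⟩
  have hA2 : ∀ {x}, x ∈ A₂ → x ∉ A₁ := fun h h' => hA.le_bot ⟨h', h⟩
  have hshared : ∀ e, e ∈ K.G.rho A₁ → e ∈ K.G.rho A₂ → ∃ (i j : ℕ) (x : K'.E), π₁[i]? = some e ∧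
      π₂[j]? = some e ∧ π₁'[i]? = some x ∧ π₂'[j]? = some x := by
    intro e he₁ he₂
    obtain ⟨i, hi⟩ := hπ₁.exists_index he₁
    obtain ⟨j, hj⟩ := hπ₂.exists_index he₂
    obtain ⟨x, hx⟩ := (h₁₂ i j).1 ⟨e, hi, hj⟩
    exact ⟨i, j, x, hi, hj, hx⟩
  refine h₁.toIsPartialImmersion.glue h₂.toIsPartialImmersion hA hA' ?_ ?_ ?_
    (fun e ht hh => h₂.nil e (hA1 ht) (hA1 hh)) (fun e ht hh => h₁.nil e ht (hA2 hh))
  · intro e ht a ha b hb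
    have hh : K.G.head e ∈ A₂ := by
      by_contra hh; rw [h₂.nil e (hA1 ht) hh] at hb; simp at hb
    obtain ⟨i, j, x, hi, hj, hi', hj'⟩ := hshared e (K.G.mem_rho.2 (Or.inl ⟨ht, hA2 hh⟩))
      (K.G.mem_rho.2 (Or.inr ⟨hA1 ht, hh⟩))
    rw [h₁.end_root i e x hi hi' (hA2 hh)] at ha
    rw [h₂.start_root j e x hj hj' (hA1 ht)] at hb
    rw [← Option.some_inj, ← Option.mem_def.1 ha, ← Option.mem_def.1 hb]
  · intro e ht a ha b hb
    have hh : K.G.head e ∈ A₁ := by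
      by_contra hh; rw [h₁.nil e ht hh] at hb; simp at hb
    have ht' : K.G.tail e ∈ A₂ := by
      by_contra ht'; rw [h₂.nil e ht' (hA1 hh)] at ha; simp at ha
    obtain ⟨i, j, x, hi, hj, hi', hj'⟩ := hshared e (K.G.mem_rho.2 (Or.inr ⟨ht, hh⟩))
      (K.G.mem_rho.2 (Or.inl ⟨ht', hA1 hh⟩))
    rw [h₁.start_root i e x hi hi' ht] at hb
    rw [h₂.end_root j e x hj hj' (hA1 hh)] at ha
    rw [← Option.some_inj, ← Option.mem_def.1 ha, ← Option.mem_def.1 hb]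
  · intro e₁ e₂ x hx₁ hx₂
    have hdis : ∀ {y}, y ∈ A₁' → y ∉ A₂' := fun h h' => hA'.le_bot ⟨h, h'⟩
    have i₁ := h₁.inside_or_root hπ₁ hx₁
    have i₂ := h₂.inside_or_root hπ₂ hx₂
    rcases i₁ with i₁ | ⟨i, hi, hi'⟩
    · rcases i₂ with i₂ | ⟨j, hj, hj'⟩
      · exact absurd i₂.1 (hdis i₁.1)
      · rcases K'.G.mem_rho.1 (hπ₂'.mem hj') with h | h
        · exact absurd h.1 (hdis i₁.1)
        · exact absurd h.2 (hdis i₁.2)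
    · rcases i₂ with i₂ | ⟨j, hj, hj'⟩
      · rcases K'.G.mem_rho.1 (hπ₁'.mem hi') with h | h
        · exact absurd i₂.1 (hdis h.1)
        · exact absurd i₂.2 (hdis h.2)
      · obtain ⟨e, he, he'⟩ := (h₁₂ i j).2 ⟨x, hi', hj'⟩
        rw [hi, Option.some_inj] at he
        rw [hj, Option.some_inj] at he'
        subst he he'
        refine ⟨rfl, fun ht => ?_, fun ht => ?_⟩
        · refine h₁.end_root i _ x hi hi' ?_
          rcases K.G.mem_rho.1 (hπ₁.mem hi) with h | h
          · exact h.2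
          · exact absurd ht h.1
        · refine h₂.end_root j _ x hj hj' ?_
          rcases K.G.mem_rho.1 (hπ₁.mem hi) with h | h
          · exact absurd h.1 ht
          · exact hA1 h.2

/-- Immersions of two disjoint pieces glue to an immersion of their union if any two of the three
orderings share edges at the same pairs of positions on both sides. -/
theorem glue (h₁ : IsPieceImmersion K K' A₁ A₁' π₁ π₁' f₁ g₁)
    (h₂ : IsPieceImmersion K K' A₂ A₂' π₂ π₂' f₂ g₂)
    (hA : Disjoint A₁ A₂) (hA' : Disjoint A₁' A₂')
    (hπ₁ : IsOrdering π₁ (K.G.rho A₁)) (hπ₂ : IsOrdering π₂ (K.G.rho A₂))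
    (hπ₁' : IsOrdering π₁' (K'.G.rho A₁')) (hπ₂' : IsOrdering π₂' (K'.G.rho A₂'))
    (hπ : IsOrdering π (K.G.rho (A₁ ∪ A₂))) (hlen : π.length = π'.length)
    (h₁₂ : ∀ i j : ℕ, (∃ e, π₁[i]? = some e ∧ π₂[j]? = some e) ↔
      ∃ e, π₁'[i]? = some e ∧ π₂'[j]? = some e)
    (h₀₁ : ∀ i j : ℕ, (∃ e, π[i]? = some e ∧ π₁[j]? = some e) ↔
      ∃ e, π'[i]? = some e ∧ π₁'[j]? = some e)
    (h₀₂ : ∀ i j : ℕ, (∃ e, π[i]? = some e ∧ π₂[j]? = some e) ↔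
      ∃ e, π'[i]? = some e ∧ π₂'[j]? = some e) :
    IsPieceImmersion K K' (A₁ ∪ A₂) (A₁' ∪ A₂') π π' (glueVertex A₁ f₁ f₂)
      (glueEdge A₁ g₁ g₂) := by
  have hA1 : ∀ {x}, x ∈ A₁ → x ∉ A₂ := fun h h' => hA.le_bot ⟨h, h'⟩
  have hA2 : ∀ {x}, x ∈ A₂ → x ∉ A₁ := fun h h' => hA.le_bot ⟨h', h⟩
  have hi₁ : ∀ (i : ℕ) e e', π[i]? = some e → π'[i]? = some e' → e ∈ K.G.rho A₁ →
      ∃ j : ℕ, π₁[j]? = some e ∧ π₁'[j]? = some e' := by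
    intro i e e' hi hi' he
    obtain ⟨j, hj⟩ := hπ₁.exists_index he
    obtain ⟨x, hx, hx'⟩ := (h₀₁ i j).1 ⟨e, hi, hj⟩
    rw [hi', Option.some_inj] at hx
    exact ⟨j, hj, hx ▸ hx'⟩
  have hi₂ : ∀ (i : ℕ) e e', π[i]? = some e → π'[i]? = some e' → e ∈ K.G.rho A₂ →
      ∃ j : ℕ, π₂[j]? = some e ∧ π₂'[j]? = some e' := by
    intro i e e' hi hi' he
    obtain ⟨j, hj⟩ := hπ₂.exists_index he
    obtain ⟨x, hx, hx'⟩ := (h₀₂ i j).1 ⟨e, hi, hj⟩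
    rw [hi', Option.some_inj] at hx
    exact ⟨j, hj, hx ▸ hx'⟩
  refine ⟨h₁.glue_partial h₂ hA hA' hπ₁ hπ₂ hπ₁' hπ₂' h₁₂, ?_, hlen, ?_, ?_⟩
  · intro e ht hh
    rw [Set.mem_union, not_or] at ht hh
    rw [glueEdge, if_neg ht.1, h₁.nil e ht.1 hh.1, h₂.nil e ht.2 hh.2]; rfl
  · intro i e e' hi hi' ht
    rw [Set.mem_union, not_or] at ht
    rcases (K.G.mem_rho.1 (hπ.mem hi)).resolve_left fun h => not_or.2 ht h.1 with ⟨-, hh | hh⟩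
    · obtain ⟨j, hj, hj'⟩ := hi₁ i e e' hi hi' (K.G.mem_rho.2 (Or.inr ⟨ht.1, hh⟩))
      rw [glueEdge, if_neg ht.1, h₂.nil e ht.2 (hA1 hh), splice_nil_left]
      exact h₁.start_root j e e' hj hj' ht.1
    · obtain ⟨j, hj, hj'⟩ := hi₂ i e e' hi hi' (K.G.mem_rho.2 (Or.inr ⟨ht.2, hh⟩))
      rw [glueEdge, if_neg ht.1, h₁.nil e ht.1 (hA2 hh), splice_nil_right]
      exact h₂.start_root j e e' hj hj' ht.2
  · intro i e e' hi hi' hh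
    rw [Set.mem_union, not_or] at hh
    rcases (K.G.mem_rho.1 (hπ.mem hi)).resolve_right fun h => not_or.2 hh h.2 with ⟨ht | ht, -⟩
    · obtain ⟨j, hj, hj'⟩ := hi₁ i e e' hi hi' (K.G.mem_rho.2 (Or.inl ⟨ht, hh.1⟩))
      rw [glueEdge, if_pos ht, h₂.nil e (hA1 ht) hh.2, splice_nil_right]
      exact h₁.end_root j e e' hj hj' hh.1
    · obtain ⟨j, hj, hj'⟩ := hi₂ i e e' hi hi' (K.G.mem_rho.2 (Or.inl ⟨ht, hh.2⟩))
      rw [glueEdge, if_neg (hA2 ht), h₁.nil e (hA2 ht) hh.1, splice_nil_right]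
      exact h₂.end_root j e e' hj hj' hh.2

/-- Complementary pieces glue to a strong immersion of the whole knitwork. -/
theorem isStrongKnitworkImmersion (h₁ : IsPieceImmersion K K' A₁ A₁' K.root K'.root f₁ g₁)
    (h₂ : IsPieceImmersion K K' A₁ᶜ A₁'ᶜ K.root K'.root f₂ g₂)
    (hK : K.G.rho A₁ = K.G.rho K.X) (hK' : K'.G.rho A₁' = K'.G.rho K'.X) :
    IsStrongKnitworkImmersion K K' (glueVertex A₁ f₁ f₂) (glueEdge A₁ g₁ g₂) := by
  have o₁ : IsOrdering K.root (K.G.rho A₁) := hK ▸ K.root_ordering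
  have o₁' : IsOrdering K'.root (K'.G.rho A₁') := hK' ▸ K'.root_ordering
  have o₂ : IsOrdering K.root (K.G.rho A₁ᶜ) := by rwa [K.G.rho_compl]
  have o₂' : IsOrdering K'.root (K'.G.rho A₁'ᶜ) := by rwa [K'.G.rho_compl]
  have hiff : ∀ i j : ℕ, (∃ e, K.root[i]? = some e ∧ K.root[j]? = some e) ↔
      ∃ e, K'.root[i]? = some e ∧ K'.root[j]? = some e := by
    intro i j
    constructor
    · rintro ⟨e, hi, hj⟩
      obtain rfl := o₁.index_inj hi hj
      obtain ⟨e', he'⟩ := exists_getElem?_of_length_eq h₁.length_eq hi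
      exact ⟨e', he', he'⟩
    · rintro ⟨e, hi, hj⟩
      obtain rfl := o₁'.index_inj hi hj
      obtain ⟨e', he'⟩ := exists_getElem?_of_length_eq h₁.length_eq.symm hi
      exact ⟨e', he', he'⟩
  have h := h₁.glue_partial h₂ disjoint_compl_right disjoint_compl_right o₁ o₂ o₁' o₂' hiff
  have hroot : ∀ (i : ℕ) e e', K.root[i]? = some e → K'.root[i]? = some e' →
      e' ∈ glueEdge A₁ g₁ g₂ e := by
    intro i e e' hi hi'
    by_cases ht : K.G.tail e ∈ A₁
    · have hh : K.G.head e ∉ A₁ :=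
        ((K.G.mem_rho.1 (o₁.mem hi)).resolve_right fun h => h.1 ht).2
      have m₁ := h₁.end_root i e e' hi hi' hh
      have m₂ := h₂.start_root i e e' hi hi' (fun h => h ht)
      rw [glueEdge, if_pos ht, mem_splice]
      · exact Or.inl (List.mem_of_getLast? m₁)
      · intro a ha b hb
        rw [m₁] at ha; rw [m₂] at hb
        rw [← Option.some_inj, ← Option.mem_def.1 ha, ← Option.mem_def.1 hb]
    · have hh : K.G.head e ∈ A₁ :=
        ((K.G.mem_rho.1 (o₁.mem hi)).resolve_left fun h => ht h.1).2
      have m₁ := h₁.start_root i e e' hi hi' ht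
      have m₂ := h₂.end_root i e e' hi hi' (fun h => h hh)
      rw [glueEdge, if_neg ht, mem_splice]
      · exact Or.inl (List.mem_of_getLast? m₂)
      · intro a ha b hb
        rw [m₂] at ha; rw [m₁] at hb
        rw [← Option.some_inj, ← Option.mem_def.1 ha, ← Option.mem_def.1 hb]
  have hu : ∀ x, x ∈ A₁ ∪ A₁ᶜ := fun x => em _
  refine ⟨⟨⟨⟨fun x y hxy => h.inj x (hu x) y (hu y) hxy, fun e => ⟨h.nodup e,
    (h.chain e).imp fun _ _ hab => hab.1, h.start_eq e (hu _), h.end_eq e (hu _)⟩, h.disjoint⟩, ?_⟩,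
    h₁.length_eq, ?_⟩, fun x => h.mu_dom x (hu x), fun x => h.m_dom x (hu x),
    fun x => h.mu_respected x (hu x), ?_, fun x => h.link_iff x (hu x),
    fun x => h.label_le x (hu x)⟩
  · rintro e x ⟨a, b, hab, hx⟩
    exact ((h.chain e).of_pair_infix hab).2.2 x (hu x) hx.symm
  · intro i j e e' hi hj
    constructor
    · intro hmem
      obtain ⟨d, hd⟩ := exists_getElem?_of_length_eq h₁.length_eq.symm hj
      have hmem' := hroot j d e' hd hj
      by_contra hij
      refine h.disjoint e d ?_ hmem hmem'
      rintro rfl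
      exact hij (o₁.index_inj hi hd)
    · rintro rfl
      exact hroot i e e' hi hj
  · intro x' L' hL' hno
    refine h.routing_feasible x' (em _) L' hL' fun x _ hx => ?_
    refine hno x ?_ hx
    rw [← h.m_dom x (hu x), hx, hL']; rfl

/-- An immersion into a piece extends along a linkage to an immersion into a larger one, if the
ordering of the smaller cut is the one transported along the linkage. -/
theorem extend {B' : Set K'.V} {τ : K'.E → K'.E} {Q : K'.E → List K'.E}
    (h : IsPieceImmersion K K' A A' π (π'.map τ) f g) (hAB : A' ⊆ B')
    (hπ : IsOrdering π (K.G.rho A)) (hπ' : IsOrdering π' (K'.G.rho B'))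
    (hQ : K'.G.IsLinkage K'.m A' B' τ Q) :
    ∃ f' g', IsPieceImmersion K K' A B' π π' f' g' := by
  classical
  have hlen : π.length = π'.length := by simpa using h.length_eq
  have hb : ∀ e, e ∈ K.G.rho A → ∃ (b : K'.E) (i : ℕ), π[i]? = some e ∧ π'[i]? = some b := by
    intro e he
    obtain ⟨i, hi⟩ := hπ.exists_index he
    obtain ⟨b, hb⟩ := exists_getElem?_of_length_eq hlen hi
    exact ⟨b, i, hi, hb⟩
  rcases isEmpty_or_nonempty K'.E with hE | hE
  · have hnil : ∀ e, e ∉ K.G.rho A := fun e he => hE.elim (hb e he).choose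
    have hπ0 : π = [] := List.eq_nil_iff_forall_not_mem.2 fun e he => hnil e ((hπ.2 e).1 he)
    refine ⟨f, g, ?_, h.nil, hlen, by simp [hπ0], by simp [hπ0]⟩
    have hg : ∀ e, g e = [] := fun e => List.eq_nil_iff_forall_not_mem.2 fun e => hE.elim e
    refine { h.toIsPartialImmersion with
      maps := fun x hx => hAB (h.maps x hx)
      chain := fun e => by rw [hg]; simp
      routing_feasible := fun x' hx' L' hL' hno => ?_ }
    by_cases hxA : x' ∈ A'
    · exact h.routing_feasible x' hxA L' hL' hno
    · obtain ⟨M, hM, -⟩ := hQ.feasible x' ⟨hx', hxA⟩ L' hL'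
      exact K'.m_reliable x' L' hL' M hM _ fun p => hE.elim p.1
  choose! b i hi hi' using hb
  have hτ : ∀ e ∈ K.G.rho A, (π'.map τ)[i e]? = some (τ (b e)) := by
    intro e he; rw [List.getElem?_map, hi' e he]; rfl
  have hbB : ∀ e ∈ K.G.rho A, b e ∈ K'.G.rho B' := fun e he => hπ'.mem (hi' e he)
  have hbinj : ∀ e ∈ K.G.rho A, ∀ e' ∈ K.G.rho A, b e = b e' → e = e' := by
    intro e he e' he' hbb
    have := hπ'.index_inj (hi' e he) (hbb ▸ hi' e' he')
    rw [← Option.some_inj, ← hi e he, ← hi e' he', this]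
  have hτinj : ∀ e ∈ K.G.rho A, ∀ e' ∈ K.G.rho A, τ (b e) = τ (b e') → e = e' :=
    fun e he e' he' hbb => hbinj e he e' he' (hQ.bijOn.injOn (hbB e he) (hbB e' he') hbb)
  -- The path of the linkage that continues the image of `e`.
  let q : K.E → List K'.E := fun e => if e ∈ K.G.rho A then Q (b e) else []
  have hq : ∀ e ∈ K.G.rho A, q e = Q (b e) := fun e he => if_pos he
  have hqn : ∀ e, e ∉ K.G.rho A → q e = [] := fun e he => if_neg he
  have hin : ∀ e ∈ K.G.rho A, K.G.tail e ∉ A → (g e).head? = some (τ (b e)) ∧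
      (q e).head? = some (b e) ∧ (q e).getLast? = some (τ (b e)) := by
    intro e he ht
    have hh := ((K.G.mem_rho.1 he).resolve_left fun h => ht h.1).2
    have hs := h.start_root _ e _ (hi e he) (hτ e he) ht
    have hτA : K'.G.head (τ (b e)) ∈ A' := by
      rcases getLast?_eq_or_pair_infix (List.mem_of_head? hs) with hl | ⟨y, hy⟩
      · obtain ⟨a, ha, ha'⟩ := h.exists_getLast? hh
        rw [hl, Option.some_inj] at ha
        rw [ha, ha']; exact h.maps _ hh
      · exact ((h.chain e).of_pair_infix hy).2.1
    rw [hq e he]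
    rcases (hQ.path _ (hbB e he)).2.2 with ⟨-, -, h3, h4⟩ | ⟨-, h2, -, -⟩
    · exact ⟨hs, h3, h4⟩
    · exact absurd hτA h2.2
  have hout : ∀ e ∈ K.G.rho A, K.G.tail e ∈ A → (g e).getLast? = some (τ (b e)) ∧
      (q e).head? = some (τ (b e)) ∧ (q e).getLast? = some (b e) := by
    intro e he ht
    have hh := ((K.G.mem_rho.1 he).resolve_right fun h => h.1 ht).2
    have hs := h.end_root _ e _ (hi e he) (hτ e he) hh
    have hτA : K'.G.tail (τ (b e)) ∈ A' := by
      rcases head?_eq_or_pair_infix (List.mem_of_getLast? hs) with hl | ⟨y, hy⟩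
      · obtain ⟨a, ha, ha'⟩ := h.exists_head? ht
        rw [hl, Option.some_inj] at ha
        rw [ha, ha']; exact h.maps _ ht
      · have := (h.chain e).of_pair_infix hy
        exact this.1 ▸ this.2.1
    rw [hq e he]
    rcases (hQ.path _ (hbB e he)).2.2 with ⟨-, h2, -, -⟩ | ⟨-, -, h3, h4⟩
    · exact absurd hτA h2.1
    · exact ⟨hs, h3, h4⟩
  -- The paths of the linkage immerse the empty vertex set into `B' \ A'`, so the extension is an
  -- instance of gluing.
  have hcor : IsPartialImmersion K K' ∅ (B' \ A') f q := by
    constructor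
    case maps => simp
    case inj => simp
    case nodup =>
      intro e
      by_cases he : e ∈ K.G.rho A
      · rw [hq e he]; exact (hQ.path _ (hbB e he)).1
      · rw [hqn e he]; exact List.nodup_nil
    case chain =>
      intro e
      by_cases he : e ∈ K.G.rho A
      · rw [hq e he]
        exact (hQ.path _ (hbB e he)).2.1.imp fun a b h => ⟨h.1, h.2, by simp⟩
      · rw [hqn e he]; simp
    case start_eq => simp
    case end_eq => simp
    case disjoint =>
      intro e₁ e₂ hne
      by_cases he₁ : e₁ ∈ K.G.rho A
      · by_cases he₂ : e₂ ∈ K.G.rho A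
        · rw [hq _ he₁, hq _ he₂]
          exact hQ.disjoint _ (hbB _ he₁) _ (hbB _ he₂) fun hbb => hne (hbinj _ he₁ _ he₂ hbb)
        · rw [hqn _ he₂]; simp
      · rw [hqn _ he₁]; simp
    case routing_feasible =>
      intro x' hx' L' hL' _
      obtain ⟨M, hM, hMr⟩ := hQ.feasible x' hx' L' hL'
      refine K'.m_reliable x' L' hL' M hM _ ?_
      rintro ⟨c, d⟩ ⟨hc, -, e, hcd⟩
      by_cases he : e ∈ K.G.rho A
      · rw [hq e he] at hcd
        exact hMr _ (hbB e he) c d hcd hc.2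
      · rw [hqn e he] at hcd
        simp at hcd
    all_goals simp
  have hglue := h.toIsPartialImmersion.glue hcor (by simp) Set.disjoint_sdiff_right
    (fun e ht a ha c hc => ?_) (fun e ht a ha c hc => ?_) (fun e₁ e₂ x hx₁ hx₂ => ?_)
    (fun e ht hh => hqn e fun he => (K.G.mem_rho.1 he).elim (fun h => h.2 hh) fun h => h.1 ht)
    (by simp)
  · rw [Set.union_empty, Set.union_sdiff_cancel hAB] at hglue
    refine ⟨_, _, hglue, ?_, hlen, ?_, ?_⟩
    · intro e ht hh
      rw [glueEdge, if_neg ht, h.nil e ht hh, splice_nil_right]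
      exact hqn e fun he => (K.G.mem_rho.1 he).elim (fun h => ht h.1) fun h => hh h.2
    · intro j e e' hj hj' ht
      have he := hπ.mem hj
      obtain rfl := hπ.index_inj hj (hi e he)
      rw [glueEdge, if_neg ht, head?_splice, (hin e he ht).2.1, ← hj', hi' e he]; rfl
    · intro j e e' hj hj' hh
      have he := hπ.mem hj
      obtain rfl := hπ.index_inj hj (hi e he)
      have ht := ((K.G.mem_rho.1 he).resolve_right fun h => hh h.2).1
      have ho := hout e he ht
      rw [glueEdge, if_pos ht, getLast?_splice, ho.2.2, ← hj', hi' e he]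
      · rfl
      · intro a ha c hc
        rw [ho.1] at ha; rw [ho.2.1] at hc
        rw [← Option.some_inj, ← Option.mem_def.1 ha, ← Option.mem_def.1 hc]
  · have he : e ∈ K.G.rho A := by
      by_contra he; rw [hqn e he] at hc; simp at hc
    have ho := hout e he ht
    rw [ho.1] at ha; rw [ho.2.1] at hc
    rw [← Option.some_inj, ← Option.mem_def.1 ha, ← Option.mem_def.1 hc]
  · have he : e ∈ K.G.rho A := by
      by_contra he; rw [hqn e he] at ha; simp at ha
    have ho := hin e he ht
    rw [ho.2.2] at ha; rw [ho.1] at hc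
    rw [← Option.some_inj, ← Option.mem_def.1 ha, ← Option.mem_def.1 hc]
  · have he₂ : e₂ ∈ K.G.rho A := by
      by_contra he; rw [hqn _ he] at hx₂; simp at hx₂
    rw [hq _ he₂] at hx₂
    have hmapτ : ∀ j : ℕ, ∀ y, (π'.map τ)[j]? = some y → y ∈ K'.G.rho A' := by
      intro j y hy
      rw [List.getElem?_map, Option.map_eq_some_iff] at hy
      obtain ⟨c, hc, rfl⟩ := hy
      exact hQ.bijOn.mapsTo (hπ'.mem hc)
    have hio := h.inside_or_root hπ hx₁
    have hxτ : x = τ (b e₂) := by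
      refine hQ.eq_of_mem hAB (hbB _ he₂) hx₂ ?_
      rcases hio with hio | ⟨j, -, hj'⟩
      · exact Or.inl hio.1
      · rcases K'.G.mem_rho.1 (hmapτ j x hj') with hr | hr
        · exact Or.inl hr.1
        · exact Or.inr hr.2
    have hxρ : x ∈ K'.G.rho A' := hxτ ▸ hQ.bijOn.mapsTo (hbB _ he₂)
    rcases hio with hio | ⟨j, hj, hj'⟩
    · rcases K'.G.mem_rho.1 hxρ with hr | hr
      · exact absurd hio.2 hr.2
      · exact absurd hio.1 hr.1
    · have he₁ := hπ.mem hj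
      obtain rfl := hπ.index_inj hj (hi _ he₁)
      have hx1 : x = τ (b e₁) := by rw [← Option.some_inj, ← hj', hτ _ he₁]
      have h12 := hτinj _ he₁ _ he₂ (hx1.symm.trans hxτ)
      refine ⟨h12, fun ht => ?_, fun ht => ?_⟩
      · rw [hx1]; exact (hout _ he₁ ht).1
      · rw [hx1]; exact (hin _ he₁ ht).2.2

end IsPieceImmersion

end

/-! ### Infinite sequences -/

section Sequences

open Filter

/-- A relation that holds for most pairs, in the sense of an ultrafilter, holds for all pairs of
some subsequence. -/
theorem exists_strictMono_of_eventually {Q : ℕ → ℕ → Prop}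
    (h : ∀ᶠ i in (hyperfilter ℕ : Filter ℕ), ∀ᶠ j in (hyperfilter ℕ : Filter ℕ), Q i j) :
    ∃ φ : ℕ → ℕ, StrictMono φ ∧ ∀ i j, i < j → Q (φ i) (φ j) := by
  obtain ⟨φ, -, hφ⟩ := exists_seq_of_forall_finset_exists
    (fun i => ∀ᶠ j in (hyperfilter ℕ : Filter ℕ), Q i j) (fun i j => i < j ∧ Q i j) (by
      intro s hs
      have h1 : ∀ᶠ j in (hyperfilter ℕ : Filter ℕ), ∀ i ∈ s, i < j ∧ Q i j := by
        rw [Finset.eventually_all]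
        intro i hi
        refine Eventually.and ?_ (hs i hi)
        exact Nat.hyperfilter_le_atTop (eventually_gt_atTop i)
      exact (h.and h1).exists)
  exact ⟨φ, strictMono_nat_of_lt_succ fun n => (hφ n (n + 1) n.lt_succ_self).1,
    fun i j hij => (hφ i j hij).2⟩

/-- Ramsey's theorem for pairs provides monotone subsequences for well-quasi-ordered sets even if
the relation is not transitive. -/
theorem Set.PartiallyWellOrderedOn.exists_strictMono {α : Type*} {r : α → α → Prop} {s : Set α}
    (h : s.PartiallyWellOrderedOn r) {f : ℕ → α} (hf : ∀ n, f n ∈ s) :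
    ∃ φ : ℕ → ℕ, StrictMono φ ∧ ∀ i j, i < j → r (f (φ i)) (f (φ j)) := by
  by_cases hr : ∀ᶠ i in (hyperfilter ℕ : Filter ℕ), ∀ᶠ j in (hyperfilter ℕ : Filter ℕ),
      r (f i) (f j)
  · exact exists_strictMono_of_eventually hr
  · simp only [← Ultrafilter.eventually_not] at hr
    obtain ⟨φ, -, hφ⟩ := exists_strictMono_of_eventually hr
    obtain ⟨m, n, hmn, hr⟩ := h.exists_lt (f := f ∘ φ) fun n => hf _
    exact absurd hr (hφ m n hmn)

theorem exists_strictMono_const {α : Type*} [Finite α] (c : ℕ → α) :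
    ∃ φ : ℕ → ℕ, StrictMono φ ∧ ∀ i j, c (φ i) = c (φ j) := by
  obtain ⟨y, hy⟩ := Finite.exists_infinite_fiber c
  have hy' : (c ⁻¹' {y}).Infinite := Set.infinite_coe_iff.1 hy
  refine ⟨Nat.nth (· ∈ c ⁻¹' {y}), Nat.nth_strictMono hy', fun i j => ?_⟩
  have h1 : c _ = y := Nat.nth_mem_of_infinite hy' i
  have h2 : c _ = y := Nat.nth_mem_of_infinite hy' j
  exact h1.trans h2.symm

end Sequences

/-! ### Pieces of knitworks and their immersion relation -/

section

variable {E : Type v} {E' : Type v'}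

theorem Set.Finite.exists_isOrdering {S : Set E} (h : S.Finite) : ∃ l, IsOrdering l S :=
  ⟨h.toFinset.toList, Finset.nodup_toList _, by simp⟩

theorem IsOrdering.length_eq {l : List E} {S : Set E} (h : IsOrdering l S) :
    l.length = S.ncard := by
  classical
  rw [← List.toFinset_card_of_nodup h.1, ← Set.ncard_coe_finset]
  congr 1
  ext e; simp [h.2]

theorem IsOrdering.map {τ : E → E} {S S' : Set E} {l : List E} (h : IsOrdering l S)
    (hτ : Set.BijOn τ S S') : IsOrdering (l.map τ) S' := by
  refine ⟨List.Nodup.map_on (fun x hx y hy hxy => hτ.injOn ((h.2 x).1 hx) ((h.2 y).1 hy) hxy) h.1,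
    fun e => ?_⟩
  rw [List.mem_map, ← hτ.image_eq]
  simp only [h.2, Set.mem_image]

/-- The index pairs, bounded by `k`, at which two sequences have the same entry. -/
def coincidences (k : ℕ) (l₁ l₂ : List E) : Set (Fin k × Fin k) :=
  {p | ∃ e, l₁[p.1.1]? = some e ∧ l₂[p.2.1]? = some e}

/-- For sequences of length at most `k` the bound in `coincidences` is no restriction. -/
theorem coincidences_iff {k : ℕ} {l₁ l₂ : List E} {l₁' l₂' : List E'} (h₁ : l₁.length ≤ k)
    (h₂ : l₂.length ≤ k) (h₁' : l₁'.length ≤ k) (h₂' : l₂'.length ≤ k)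
    (h : coincidences k l₁ l₂ = coincidences k l₁' l₂') (i j : ℕ) :
    (∃ e, l₁[i]? = some e ∧ l₂[j]? = some e) ↔ ∃ e, l₁'[i]? = some e ∧ l₂'[j]? = some e := by
  by_cases hij : i < k ∧ j < k
  · exact Set.ext_iff.1 h (⟨i, hij.1⟩, ⟨j, hij.2⟩)
  · constructor
    · rintro ⟨e, he₁, he₂⟩
      have := (List.getElem?_eq_some_iff.1 he₁).1
      have := (List.getElem?_eq_some_iff.1 he₂).1
      omega
    · rintro ⟨e, he₁, he₂⟩
      have := (List.getElem?_eq_some_iff.1 he₁).1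
      have := (List.getElem?_eq_some_iff.1 he₂).1
      omega

end

/-- A part of a knitwork, given as the carrier of a tree on its vertices, together with a sequence
meant to order its cut. -/
structure Piece (Ω : Type w) where
  K : Knitwork.{u, v} Ω
  t : CutTree K.V
  π : List K.E

section

variable {Ω : Type w}

/-- Immersion of pieces. -/
def Piece.LE [Preorder Ω] (p q : Piece.{u, v, w} Ω) : Prop :=
  ∃ f g, IsPieceImmersion p.K q.K p.t.carrier q.t.carrier p.π q.π f g

/-- The pieces in question: the tree is a carving of minimum potential, and the sequence orders
the cut. -/
structure Piece.IsGood (k : ℕ) (p : Piece.{u, v, w} Ω) : Prop where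
  wellLinked : p.K.WellLinked
  nonempty : Nonempty p.K.V
  minimal : p.t.IsMinimal p.K.G k
  ordering : IsOrdering p.π (p.K.G.rho p.t.carrier)

theorem Piece.IsGood.length_le {k : ℕ} {p : Piece.{u, v, w} Ω} (h : p.IsGood k) :
    p.π.length ≤ k := by
  rw [h.ordering.length_eq]; exact h.minimal.1.cutSize_le

/-! ### Pieces with at most one vertex -/

theorem Piece.LE.of_empty [Preorder Ω] {k : ℕ} {p q : Piece.{u, v, w} Ω}
    (hp : p.IsGood k) (hq : q.IsGood k)
    (hp0 : p.t.carrier = ∅) (hq0 : q.t.carrier = ∅) : p.LE q := by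
  have h1 := hp.ordering
  have h2 := hq.ordering
  rw [hp0, MultiDigraph.rho_empty] at h1
  rw [hq0, MultiDigraph.rho_empty] at h2
  have h1' : p.π = [] := List.eq_nil_iff_forall_not_mem.2 fun e he => (h1.2 e).1 he
  have h2' : q.π = [] := List.eq_nil_iff_forall_not_mem.2 fun e he => (h2.2 e).1 he
  have := hq.nonempty
  refine ⟨fun _ => Classical.arbitrary _, fun _ => [], ?_⟩
  rw [hp0, hq0, h1', h2']
  refine ⟨?_, ?_, ?_, ?_, ?_⟩
  · constructor <;> simp
  all_goals simp

/-- A matching of the edges at `x` into the edges at `x'` that respects all the data of the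
knitworks gives an immersion of the pieces formed by these vertices. -/
theorem Piece.LE.of_edge_matching [Preorder Ω] {p q : Piece.{u, v, w} Ω} {x : p.K.V} {x' : q.K.V}
    (hp : p.t.carrier = {x}) (hq : q.t.carrier = {x'}) (R : p.K.E → q.K.E → Prop)
    (htotal : ∀ e, p.K.G.tail e = x ∨ p.K.G.head e = x → ∃ e', R e e')
    (htail : ∀ e e', R e e' → p.K.G.tail e = x → q.K.G.tail e' = x')
    (hhead : ∀ e e', R e e' → p.K.G.head e = x → q.K.G.head e' = x')
    (htouch : ∀ e e', R e e' → p.K.G.tail e = x ∨ p.K.G.head e = x)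
    (hfun : ∀ e e₁ e₂, R e e₁ → R e e₂ → e₁ = e₂)
    (hinj : ∀ e₁ e₂ e', R e₁ e' → R e₂ e' → e₁ = e₂)
    (hlen : p.π.length = q.π.length)
    (hroot : ∀ (i : ℕ) e e', p.π[i]? = some e → q.π[i]? = some e' → R e e')
    (mu_dom : (q.K.mu x').isSome ↔ (p.K.mu x).isSome)
    (m_dom : (q.K.m x').isSome ↔ (p.K.m x).isSome)
    (mu_respected : ∀ l l', p.K.mu x = some l → q.K.mu x' = some l' →
      l.length = l'.length ∧
        ∀ (i : ℕ) (e : p.K.E) (e' : q.K.E), l[i]? = some e → l'[i]? = some e' → R e e')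
    (link_iff : ∀ L l L' l', p.K.m x = some L → p.K.mu x = some l →
      q.K.m x' = some L' → q.K.mu x' = some l' →
      ∀ I : Set (ℕ × ℕ), pairsAt l I ∈ L ↔ pairsAt l' I ∈ L')
    (label_le : ∀ a, p.K.Phi x = some a → ∃ b, q.K.Phi x' = some b ∧ a ≤ b) : p.LE q := by
  classical
  let g : p.K.E → List q.K.E := fun e => if h : ∃ e', R e e' then [h.choose] else []
  have hg : ∀ e e', R e e' → g e = [e'] := by
    intro e e' he
    have hex : ∃ e', R e e' := ⟨e', he⟩
    simp only [g, dif_pos hex]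
    rw [hfun e _ _ hex.choose_spec he]
  have hgn : ∀ e, (¬ ∃ e', R e e') → g e = [] := fun e he => dif_neg he
  refine ⟨fun _ => x', g, ?_⟩
  rw [hp, hq]
  refine ⟨?_, ?_, hlen, ?_, ?_⟩
  · constructor
    case maps => simp
    case inj => rintro y rfl z rfl -; rfl
    case nodup =>
      intro e
      by_cases he : ∃ e', R e e'
      · obtain ⟨e', he⟩ := he; rw [hg e e' he]; simp
      · rw [hgn e he]; simp
    case chain =>
      intro e
      by_cases he : ∃ e', R e e'
      · obtain ⟨e', he⟩ := he; rw [hg e e' he]; simp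
      · rw [hgn e he]; simp
    case start_eq =>
      intro e he
      obtain ⟨e', hR⟩ := htotal e (Or.inl he)
      rw [hg e e' hR]
      simpa using htail e e' hR he
    case end_eq =>
      intro e he
      obtain ⟨e', hR⟩ := htotal e (Or.inr he)
      rw [hg e e' hR]
      simpa using hhead e e' hR he
    case disjoint =>
      intro e₁ e₂ hne
      by_cases he₁ : ∃ e', R e₁ e'
      · by_cases he₂ : ∃ e', R e₂ e'
        · obtain ⟨d₁, hd₁⟩ := he₁
          obtain ⟨d₂, hd₂⟩ := he₂
          rw [hg e₁ d₁ hd₁, hg e₂ d₂ hd₂]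
          have : d₁ ≠ d₂ := fun hd => hne (hinj _ _ _ hd₁ (hd ▸ hd₂))
          simpa using this.symm
        · rw [hgn e₂ he₂]; simp
      · rw [hgn e₁ he₁]; simp
    case mu_dom => rintro y rfl; exact mu_dom
    case m_dom => rintro y rfl; exact m_dom
    case mu_respected =>
      rintro y rfl l l' hl hl'
      obtain ⟨h1, h2⟩ := mu_respected l l' hl hl'
      refine ⟨h1, fun i e e' he he' => ?_⟩
      rw [hg e e' (h2 i e e' he he')]
      simp
    case routing_feasible =>
      rintro y rfl L' - hno
      exact absurd rfl (hno x rfl)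
    case link_iff => rintro y rfl; exact link_iff
    case label_le => rintro y rfl; exact label_le
  · exact fun e ht hh => hgn e fun ⟨e', he⟩ => (htouch e e' he).elim ht hh
  · intro i e e' hi hi' _
    rw [hg e e' (hroot i e e' hi hi')]; rfl
  · intro i e e' hi hi' _
    rw [hg e e' (hroot i e e' hi hi')]; rfl

open Classical in
/-- The finite part of the isomorphism type of a piece with the single vertex `x`: the number
and directions of the cut edges, how `μ(x)` and the link are expressed in terms of them, and
whether `x` has a label. -/
noncomputable def Piece.vertexType (k : ℕ) (p : Piece.{u, v, w} Ω) (x : p.K.V) :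
    ℕ × Set (Fin k) × Option (Set (Fin k × Fin k)) × Option (Set (Set (Fin k × Fin k))) × Bool :=
  (p.π.length, {i | ∃ e, p.π[i.1]? = some e ∧ p.K.G.tail e = x},
    (p.K.mu x).map fun l => coincidences k l p.π,
    (p.K.m x).map fun L => {I | pairsAt ((p.K.mu x).getD [])
      ((fun q : Fin k × Fin k => (q.1.1, q.2.1)) '' I) ∈ L},
    (p.K.Phi x).isSome)

/-- Only index pairs below the length of the sequence matter. -/
theorem pairsAt_eq_image {E : Type v} {k : ℕ} {l : List E} (h : l.length ≤ k)
    (I : Set (ℕ × ℕ)) : pairsAt l I = pairsAt l ((fun q : Fin k × Fin k => (q.1.1, q.2.1)) ''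
      {q | (q.1.1, q.2.1) ∈ I}) := by
  ext ⟨a, b⟩
  constructor
  · rintro ⟨i, j, hij, hi, hj⟩
    have h1 := (List.getElem?_eq_some_iff.1 hi).1
    have h2 := (List.getElem?_eq_some_iff.1 hj).1
    exact ⟨i, j, ⟨(⟨i, by omega⟩, ⟨j, by omega⟩), hij, rfl⟩, hi, hj⟩
  · rintro ⟨i, j, ⟨q, hq, hqij⟩, hi, hj⟩
    simp only [Prod.mk.injEq] at hqij
    obtain ⟨rfl, rfl⟩ := hqij
    exact ⟨_, _, hq, hi, hj⟩

/-- A piece with a single vertex immerses into another one of the same type with at least as many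
loops and a label at least as large. -/
theorem Piece.LE.of_vertexType_eq [Preorder Ω] {k : ℕ} {p q : Piece.{u, v, w} Ω}
    (hp : p.IsGood k) (hq : q.IsGood k)
    {x : p.K.V} {x' : q.K.V} (hpx : p.t.carrier = {x}) (hqx : q.t.carrier = {x'})
    (htype : p.vertexType k x = q.vertexType k x')
    (hloops : {e | p.K.G.tail e = x ∧ p.K.G.head e = x}.ncard ≤
      {e | q.K.G.tail e = x' ∧ q.K.G.head e = x'}.ncard)
    (hlabel : ∀ a b, p.K.Phi x = some a → q.K.Phi x' = some b → a ≤ b) : p.LE q := by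
  classical
  have := p.K.finite_E
  have := q.K.finite_E
  simp only [Piece.vertexType, Prod.mk.injEq] at htype
  obtain ⟨hlen, hdir, hmu, hm, hPhi⟩ := htype
  have hpk := hp.length_le
  have hqk := hq.length_le
  have hop := hp.ordering
  have hoq := hq.ordering
  rw [hpx] at hop
  rw [hqx] at hoq
  have hdir' : ∀ (i : ℕ) e e', p.π[i]? = some e → q.π[i]? = some e' →
      (p.K.G.tail e = x ↔ q.K.G.tail e' = x') := by
    intro i e e' hi hi'
    have hik := (List.getElem?_eq_some_iff.1 hi).1
    have := Set.ext_iff.1 hdir ⟨i, by omega⟩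
    simpa [hi, hi'] using this
  have hmap : ∀ {i : ℕ} {e}, p.π[i]? = some e → ∃ e', q.π[i]? = some e' := fun hi =>
    exists_getElem?_of_length_eq hlen hi
  -- Cut edges are matched according to the orderings, loops by an arbitrary injection.
  obtain ⟨φ⟩ : Nonempty ({e | p.K.G.tail e = x ∧ p.K.G.head e = x} ↪
      {e | q.K.G.tail e = x' ∧ q.K.G.head e = x'}) := by
    have := Fintype.ofFinite {e | p.K.G.tail e = x ∧ p.K.G.head e = x}
    have := Fintype.ofFinite {e | q.K.G.tail e = x' ∧ q.K.G.head e = x'}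
    refine Function.Embedding.nonempty_of_card_le ?_
    rwa [← Nat.card_eq_fintype_card, ← Nat.card_eq_fintype_card]
  have hρ : ∀ {i : ℕ} {e}, p.π[i]? = some e → ¬ (p.K.G.tail e = x ∧ p.K.G.head e = x) := by
    rintro i e hi ⟨h1, h2⟩
    exact (p.K.G.mem_rho.1 (hop.mem hi)).elim (fun h => h.2 h2) fun h => h.1 h1
  have hρ' : ∀ {i : ℕ} {e}, q.π[i]? = some e → ¬ (q.K.G.tail e = x' ∧ q.K.G.head e = x') := by
    rintro i e hi ⟨h1, h2⟩
    exact (q.K.G.mem_rho.1 (hoq.mem hi)).elim (fun h => h.2 h2) fun h => h.1 h1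
  refine Piece.LE.of_edge_matching hpx hqx (fun e e' =>
    (∃ i : ℕ, p.π[i]? = some e ∧ q.π[i]? = some e') ∨
    ∃ h : p.K.G.tail e = x ∧ p.K.G.head e = x, (φ ⟨e, h⟩).1 = e') ?_ ?_ ?_ ?_ ?_ ?_ hlen ?_ ?_ ?_ ?_
    ?_ ?_
  · intro e he
    by_cases hl : p.K.G.tail e = x ∧ p.K.G.head e = x
    · exact ⟨_, Or.inr ⟨hl, rfl⟩⟩
    · have : e ∈ p.K.G.rho {x} := by
        rw [MultiDigraph.mem_rho, Set.mem_singleton_iff, Set.mem_singleton_iff]; tauto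
      obtain ⟨i, hi⟩ := hop.exists_index this
      obtain ⟨e', he'⟩ := hmap hi
      exact ⟨e', Or.inl ⟨i, hi, he'⟩⟩
  · rintro e e' (⟨i, hi, hi'⟩ | ⟨h, rfl⟩) ht
    · exact (hdir' i e e' hi hi').1 ht
    · exact (φ ⟨e, h⟩).2.1
  · rintro e e' (⟨i, hi, hi'⟩ | ⟨h, rfl⟩) hh
    · have h1 : q.K.G.tail e' ≠ x' := fun ht => hρ hi ⟨(hdir' i e e' hi hi').2 ht, hh⟩
      exact ((q.K.G.mem_rho.1 (hoq.mem hi')).resolve_left fun h => h1 h.1).2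
    · exact (φ ⟨e, h⟩).2.2
  · rintro e e' (⟨i, hi, hi'⟩ | ⟨h, rfl⟩)
    · exact (p.K.G.mem_rho.1 (hop.mem hi)).imp (fun h => h.1) fun h => h.2
    · exact Or.inl h.1
  · rintro e e₁ e₂ (⟨i, hi, hi'⟩ | ⟨h, rfl⟩) (⟨j, hj, hj'⟩ | ⟨h', rfl⟩)
    · obtain rfl := hop.index_inj hi hj
      rw [← Option.some_inj, ← hi', hj']
    · exact absurd h' (hρ hi)
    · exact absurd h (hρ hj)
    · rfl
  · rintro e₁ e₂ e' (⟨i, hi, hi'⟩ | ⟨h, rfl⟩) (⟨j, hj, hj'⟩ | ⟨h', hφ⟩)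
    · obtain rfl := hoq.index_inj hi' hj'
      rw [← Option.some_inj, ← hi, hj]
    · exact absurd (hφ ▸ (φ ⟨e₂, h'⟩).2) (hρ' hi')
    · exact absurd (φ ⟨e₁, h⟩).2 (hρ' hj')
    · exact (congrArg Subtype.val (φ.injective (Subtype.ext hφ))).symm
  · exact fun i e e' hi hi' => Or.inl ⟨i, hi, hi'⟩
  · have := congrArg Option.isSome hmu; simpa using this.symm
  · have := congrArg Option.isSome hm; simpa using this.symm
  · intro l l' hl hl'
    rw [hl, hl'] at hmu
    simp only [Option.map_some, Option.some_inj] at hmu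
    have o := p.K.mu_ordering x l hl
    have o' := q.K.mu_ordering x' l' hl'
    have hle : l.length = p.π.length := by rw [o.length_eq, hop.length_eq]
    have hle' : l'.length = q.π.length := by rw [o'.length_eq, hoq.length_eq]
    have hc := coincidences_iff (hle ▸ hpk) hpk (hle' ▸ hqk) hqk hmu
    refine ⟨by omega, fun i e e' he he' => ?_⟩
    obtain ⟨j, hj⟩ := hop.exists_index (o.mem he)
    obtain ⟨d, hd, hd'⟩ := (hc i j).1 ⟨e, he, hj⟩
    rw [he', Option.some_inj] at hd
    exact Or.inl ⟨j, hj, hd ▸ hd'⟩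
  · intro L l L' l' hL hl hL' hl' I
    rw [hL, hL', hl, hl'] at hm
    simp only [Option.map_some, Option.getD_some, Option.some_inj] at hm
    have hle : l.length ≤ k := by
        rw [(p.K.mu_ordering x l hl).length_eq, ← hop.length_eq]; exact hpk
    have hle' : l'.length ≤ k := by
      rw [(q.K.mu_ordering x' l' hl').length_eq, ← hoq.length_eq]; exact hqk
    rw [pairsAt_eq_image hle, pairsAt_eq_image hle']
    exact Set.ext_iff.1 hm {q | (q.1.1, q.2.1) ∈ I}
  · intro a ha
    rw [ha] at hPhi
    obtain ⟨b, hb⟩ := Option.isSome_iff_exists.1 hPhi.symm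
    exact ⟨b, hb, hlabel a b ha hb⟩

/-- Pieces with at most one vertex are well-quasi-ordered: up to the number of loops and the label
there are finitely many of them. -/
theorem partiallyWellOrderedOn_leaf [Preorder Ω] [WellQuasiOrderedLE Ω] (k : ℕ) :
    {p : Piece.{u, v, w} Ω | p.IsGood k ∧ ∃ S, p.t = .leaf S}.PartiallyWellOrderedOn Piece.LE := by
  classical
  rw [Set.partiallyWellOrderedOn_iff_exists_lt]
  intro f hf
  have hsub : ∀ n, (f n).t.carrier.Subsingleton := by
    intro n
    obtain ⟨hg, S, hS⟩ := hf n
    have := hg.minimal.1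
    rw [hS] at this ⊢
    exact this.1
  obtain ⟨φ, hφ, hconst⟩ := exists_strictMono_const fun n => decide ((f n).t.carrier = ∅)
  by_cases h0 : (f (φ 0)).t.carrier = ∅
  · have h1 : (f (φ 1)).t.carrier = ∅ := by simpa [h0] using hconst 0 1
    exact ⟨φ 0, φ 1, hφ Nat.zero_lt_one, Piece.LE.of_empty (hf _).1 (hf _).1 h0 h1⟩
  · have hne : ∀ n, ∃ x, (f (φ n)).t.carrier = {x} := by
      intro n
      have h1 : (f (φ n)).t.carrier ≠ ∅ := by simpa [h0] using hconst n 0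
      exact (hsub _).eq_empty_or_singleton.resolve_left h1
    choose x hx using hne
    obtain ⟨ψ, hψ, htype⟩ := exists_strictMono_const fun n =>
      ((⟨(f (φ n)).π.length, Nat.lt_succ_of_le (hf _).1.length_le⟩ : Fin (k + 1)),
        ((f (φ n)).vertexType k (x n)).2)
    have htype' : ∀ i j, (f (φ (ψ i))).vertexType k (x (ψ i)) =
        (f (φ (ψ j))).vertexType k (x (ψ j)) := by
      intro i j
      have := htype i j
      simp only [Prod.mk.injEq, Fin.mk.injEq] at this
      exact Prod.ext this.1 this.2
    let loops : ℕ → ℕ := fun n => {e | (f (φ (ψ n))).K.G.tail e = x (ψ n) ∧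
      (f (φ (ψ n))).K.G.head e = x (ψ n)}.ncard
    by_cases hsome : ((f (φ (ψ 0))).K.Phi (x (ψ 0))).isSome
    · have hsome' : ∀ n, ∃ a, (f (φ (ψ n))).K.Phi (x (ψ n)) = some a := by
        intro n
        have := congrArg (fun t => t.2.2.2.2) (htype' n 0)
        simp only [Piece.vertexType, hsome] at this
        exact Option.isSome_iff_exists.1 this
      choose a ha using hsome'
      obtain ⟨i, j, hij, hle⟩ := wellQuasiOrdered_le fun n => (loops n, a n)
      refine ⟨_, _, hφ (hψ hij), Piece.LE.of_vertexType_eq (hf _).1 (hf _).1 (hx _) (hx _)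
        (htype' i j) hle.1 fun c d hc hd => ?_⟩
      rw [ha, Option.some_inj] at hc hd
      subst hc hd
      exact hle.2
    · obtain ⟨i, j, hij, hle⟩ := wellQuasiOrdered_le loops
      refine ⟨_, _, hφ (hψ hij), Piece.LE.of_vertexType_eq (hf _).1 (hf _).1 (hx _) (hx _)
        (htype' i j) hle fun c d hc hd => ?_⟩
      have := congrArg (fun t => t.2.2.2.2) (htype' i 0)
      simp only [Piece.vertexType, hc, Option.isSome_some] at this
      exact absurd this.symm hsome

/-! ### The induction over the sizes of cuts -/

/-- The pieces that split into two members of `L`. -/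
def splitPieces (k : ℕ) (L : Set (Piece.{u, v, w} Ω)) : Set (Piece.{u, v, w} Ω) :=
  {p | p.IsGood k ∧ ∃ l r π₁ π₂, p.t = .node l r ∧ ⟨p.K, l, π₁⟩ ∈ L ∧ ⟨p.K, r, π₂⟩ ∈ L}

/-- By passing to a subsequence on which the coincidences of the orderings are constant and
the left parts are increasing, a pair that is increasing in the right parts can be glued. -/
theorem partiallyWellOrderedOn_splitPieces [Preorder Ω] {k : ℕ} {L : Set (Piece.{u, v, w} Ω)}
    (hL : ∀ p ∈ L, p.IsGood k) (hwqo : L.PartiallyWellOrderedOn Piece.LE) :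
    (splitPieces k L).PartiallyWellOrderedOn Piece.LE := by
  rw [Set.partiallyWellOrderedOn_iff_exists_lt]
  intro f hf
  have hgood : ∀ n, (f n).IsGood k := fun n => (hf n).1
  choose l r π₁ π₂ ht hl hr using fun n => (hf n).2
  obtain ⟨φ, hφ, hc⟩ := exists_strictMono_const fun n =>
    ((⟨(f n).π.length, Nat.lt_succ_of_le (hgood n).length_le⟩ : Fin (k + 1)),
      coincidences k (π₁ n) (π₂ n), coincidences k (f n).π (π₁ n), coincidences k (f n).π (π₂ n))
  obtain ⟨ψ, hψ, hmono⟩ := hwqo.exists_strictMono (f := fun n => ⟨(f (φ n)).K, l (φ n), π₁ (φ n)⟩)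
    fun n => hl _
  obtain ⟨i, j, hij, f₂, g₂, h₂⟩ := hwqo.exists_lt
    (f := fun n => ⟨(f (φ (ψ n))).K, r (φ (ψ n)), π₂ (φ (ψ n))⟩) fun n => hr _
  obtain ⟨f₁, g₁, h₁⟩ := hmono i j hij
  refine ⟨_, _, hφ (hψ hij), ?_⟩
  have hc' := hc (ψ i) (ψ j)
  simp only [Prod.mk.injEq, Fin.mk.injEq] at hc'
  obtain ⟨c0, c1, c2, c3⟩ := hc'
  generalize φ (ψ i) = i at *
  generalize φ (ψ j) = j at *
  have gl := fun n => hL _ (hl n)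
  have gr := fun n => hL _ (hr n)
  have hdis : ∀ n, Disjoint (l n).carrier (r n).carrier := by
    intro n
    have := (hgood n).minimal.1
    rw [ht] at this
    exact this.2.2.1
  have hcar : ∀ n, (f n).t.carrier = (l n).carrier ∪ (r n).carrier := fun n => by rw [ht]; rfl
  have ho := (hgood i).ordering
  rw [hcar] at ho
  unfold Piece.LE
  rw [hcar, hcar]
  exact ⟨_, _, h₁.glue h₂ (hdis i) (hdis j) (gl i).ordering (gr i).ordering (gl j).ordering
    (gr j).ordering ho c0
    (coincidences_iff (gl i).length_le (gr i).length_le (gl j).length_le (gr j).length_le c1)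
    (coincidences_iff (hgood i).length_le (gl i).length_le (hgood j).length_le (gl j).length_le c2)
    (coincidences_iff (hgood i).length_le (gr i).length_le (hgood j).length_le (gr j).length_le c3)⟩

/-- The tree is cut into members of `L`, with suitable orderings of the cuts, by inner vertices
whose cuts have at least `m` edges. -/
def IsComposed (m : ℕ) (L : Set (Piece.{u, v, w} Ω)) (K : Knitwork.{u, v} Ω) :
    CutTree K.V → Prop
  | .leaf S => ∃ π, ⟨K, .leaf S, π⟩ ∈ L
  | .node l r => (∃ π, ⟨K, .node l r, π⟩ ∈ L) ∨
      (m ≤ K.G.cutSize (CutTree.node l r).carrier ∧ IsComposed m L K l ∧ IsComposed m L K r)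

/-- The pieces in `L` and those composed of members of `L` at a vertex whose cut may have any size
and at further vertices whose cuts have at least `m` edges. -/
def composedPieces (k m : ℕ) (L : Set (Piece.{u, v, w} Ω)) : Set (Piece.{u, v, w} Ω) :=
  {p | p.IsGood k ∧ (p ∈ L ∨ ∃ l r, p.t = .node l r ∧ IsComposed m L p.K l ∧ IsComposed m L p.K r)}

/-- If the relevant subtrees whose cut has exactly `m` edges can be turned into members of `S`,
then a tree composed of members of `L` with cuts of size at least `m` is composed of members of
`L ∪ S` with cuts of size at least `m + 1`. -/
theorem IsComposed.refine {m : ℕ} {L S : Set (Piece.{u, v, w} Ω)} {K : Knitwork.{u, v} Ω}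
    {P : CutTree K.V → Prop}
    (hP : ∀ l r, P (.node l r) → m ≤ K.G.cutSize (CutTree.node l r).carrier → P l ∧ P r)
    (hS : ∀ l r, P (.node l r) → K.G.cutSize (CutTree.node l r).carrier = m → IsComposed m L K l →
      IsComposed m L K r → ∃ π, ⟨K, .node l r, π⟩ ∈ S)
    {t : CutTree K.V} (ht : P t) (h : IsComposed m L K t) : IsComposed (m + 1) (L ∪ S) K t := by
  induction t with
  | leaf T => exact h.imp fun π hπ => Or.inl hπ
  | node l r ihl ihr =>
    rcases h with ⟨π, hπ⟩ | ⟨hm, hl, hr⟩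
    · exact Or.inl ⟨π, Or.inl hπ⟩
    · rcases hm.eq_or_lt with hm' | hm'
      · obtain ⟨π, hπ⟩ := hS l r ht hm'.symm hl hr
        exact Or.inl ⟨π, Or.inr hπ⟩
      · exact Or.inr ⟨hm', ihl (hP l r ht hm).1 hl, ihr (hP l r ht hm).2 hr⟩

theorem CutTree.IsMinimal.of_plug {V : Type u} {E : Type v} {G : MultiDigraph V E} {k : ℕ}
    {cs : List (CutTree V)} {a : CutTree V} (h : (plug cs a).IsMinimal G k) : a.IsMinimal G k := by
  induction cs with
  | nil => exact h
  | cons c cs ih => exact ih h.children.1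

/-- A piece contains a subtree `l`, reached along a path with side branches `cs`, whose cut has
the same size, and no cut on the path is smaller. Then the cut of `l` can be ordered in such a
way that every piece that immerses into the smaller piece immerses into the larger one. -/
theorem Piece.IsGood.exists_ordering [Preorder Ω] {k : ℕ} {p : Piece.{u, v, w} Ω} (hp : p.IsGood k)
    {l : CutTree p.K.V} {cs : List (CutTree p.K.V)} (hmin : (CutTree.plug cs l).IsMinimal p.K.G k)
    (hcar : (CutTree.plug cs l).carrier = p.t.carrier)
    (hcut : p.K.G.cutSize l.carrier = p.K.G.cutSize p.t.carrier)
    (hpath : ∀ cs', cs' <:+ cs →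
      p.K.G.cutSize p.t.carrier ≤ p.K.G.cutSize (CutTree.plug cs' l).carrier) :
    ∃ π, (⟨p.K, l, π⟩ : Piece Ω).IsGood k ∧
      ∀ q : Piece.{u, v, w} Ω, q.IsGood k → q.LE ⟨p.K, l, π⟩ → q.LE p := by
  have := p.K.finite_V
  have := p.K.finite_E
  have hsub : l.carrier ⊆ p.t.carrier := hcar ▸ CutTree.carrier_subset_plug cs l
  obtain ⟨τ, Q, hQ⟩ := MultiDigraph.exists_linkage p.K.eulerian hsub hcut
    (fun Z h1 h2 => hmin.linked hpath h1 (hcar.symm ▸ h2)) p.K.m hp.wellLinked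
  refine ⟨p.π.map τ, ⟨hp.wellLinked, hp.nonempty, hmin.of_plug, hp.ordering.map hQ.bijOn⟩, ?_⟩
  rintro q hq ⟨f, g, hfg⟩
  exact hfg.extend hsub hq.ordering hp.ordering hQ

/-- A well-quasi-order on `L` extends to the pieces composed of members of `L`. Descending induction
over the minimum size `m` of the cuts inside: the pieces whose own cut has size `m` are
well-quasi-ordered, since in a minimal bad sequence of such pieces the smaller ones contained in its
terms, which by linkedness immerse into these terms, are well-quasi-ordered and can be added to `L`;
then the cuts that remain inside have size at least `m + 1`. -/
theorem partiallyWellOrderedOn_composedPieces [Preorder Ω] {k : ℕ} (j : ℕ) {m : ℕ}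
    (hm : m + j = k + 1)
    {L : Set (Piece.{u, v, w} Ω)} (hL : ∀ p ∈ L, p.IsGood k)
    (hwqo : L.PartiallyWellOrderedOn Piece.LE) :
    (composedPieces k m L).PartiallyWellOrderedOn Piece.LE := by
  induction j generalizing m L with
  | zero =>
    refine (hwqo.union (partiallyWellOrderedOn_splitPieces hL hwqo)).mono ?_
    rintro p ⟨hp, h | ⟨l, r, ht, hl, hr⟩⟩
    · exact Or.inl h
    · have key : ∀ t : CutTree p.K.V, t.IsMinimal p.K.G k → IsComposed m L p.K t →
          ∃ π, ⟨p.K, t, π⟩ ∈ L := by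
        rintro (S | ⟨l, r⟩) hmin h
        · exact h
        · refine h.resolve_right fun h => ?_
          have := hmin.1.cutSize_le
          have := h.1
          omega
      have hmin := hp.minimal
      rw [ht] at hmin
      obtain ⟨π₁, h₁⟩ := key l hmin.children.1 hl
      obtain ⟨π₂, h₂⟩ := key r hmin.children.2 hr
      exact Or.inr ⟨hp, l, r, π₁, π₂, ht, h₁, h₂⟩
  | succ j ih =>
    have ih' := @ih (m + 1) (by omega)
    let D : Set (Piece.{u, v, w} Ω) :=
      {p | p ∈ composedPieces k m L ∧ p.K.G.cutSize p.t.carrier = m}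
    have hD : D.PartiallyWellOrderedOn Piece.LE := by
      rw [Set.PartiallyWellOrderedOn.iff_not_exists_isMinBadSeq (fun p => p.t.size)]
      rintro ⟨t, ⟨htD, hbad⟩, hmin⟩
      -- The smaller pieces whose immersion relation is passed on to some term of the bad sequence.
      let S : Set (Piece.{u, v, w} Ω) := {s | s ∈ D ∧ ∃ i, s.t.size < (t i).t.size ∧
        ∀ q : Piece.{u, v, w} Ω, q.IsGood k → q.LE s → q.LE (t i)}
      have hS : S.PartiallyWellOrderedOn Piece.LE := by
        rw [Set.partiallyWellOrderedOn_iff_exists_lt]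
        intro s hs
        by_contra! hsbad
        choose i hi1 hi2 using fun n => (hs n).2
        -- Replace the terms from the first index `i n₀` on by the bad sequence of smaller pieces.
        obtain ⟨n₀, -, hn₀⟩ := WellFounded.has_min (measure i).wf Set.univ ⟨0, trivial⟩
        have hn₀' : ∀ n, i n₀ ≤ i n := fun n => not_lt.1 (hn₀ n trivial)
        refine hmin (i n₀) (fun n => if n < i n₀ then t n else s (n₀ + (n - i n₀)))
          (fun n hn => (if_pos hn).symm) (by
            dsimp only
            rw [if_neg (lt_irrefl _), Nat.sub_self]
            exact hi1 n₀) ⟨fun n => ?_, fun a b hab => ?_⟩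
        · dsimp only
          split_ifs
          · exact htD n
          · exact (hs _).1
        · dsimp only
          split_ifs with ha hb hb
          · exact hbad a b hab
          · intro hle
            exact hbad a _ (ha.trans_le (hn₀' _)) (hi2 _ _ (htD a).1.1 hle)
          · omega
          · exact hsbad _ _ (by omega)
      have hLS : ∀ p ∈ L ∪ S, p.IsGood k := by
        rintro p (hp | hp)
        · exact hL p hp
        · exact hp.1.1.1
      obtain ⟨a, b, hab, hle⟩ := (ih' hLS (hwqo.union hS)).exists_lt (f := t) (by
        intro i
        obtain ⟨⟨hgood, hcomp⟩, hcut⟩ := htD i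
        refine ⟨hgood, ?_⟩
        rcases hcomp with hcomp | ⟨l, r, ht, hl, hr⟩
        · exact Or.inl (Or.inl hcomp)
        refine Or.inr ⟨l, r, ht, ?_⟩
        -- The subtrees of `t i` to which linkedness applies, up to swaps of children on the path.
        let P : CutTree (t i).K.V → Prop := fun l => ∃ cs,
          (CutTree.plug cs l).IsMinimal (t i).K.G k ∧
          (CutTree.plug cs l).carrier = (t i).t.carrier ∧ l.size < (t i).t.size ∧
          (m ≤ (t i).K.G.cutSize l.carrier → ∀ cs', cs' <:+ cs →
            m ≤ (t i).K.G.cutSize (CutTree.plug cs' l).carrier)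
        have hP : ∀ l r, P (.node l r) → m ≤ (t i).K.G.cutSize (CutTree.node l r).carrier →
            P l ∧ P r := by
          rintro l r ⟨cs, h1, h2, h3, h4⟩ hm
          simp only [CutTree.size] at h3
          refine ⟨⟨cs ++ [r], ?_, ?_, by omega, ?_⟩, ⟨cs ++ [l], ?_, ?_, by omega, ?_⟩⟩
          · rwa [CutTree.plug_append]
          · rwa [CutTree.plug_append]
          · intro hl cs' hcs'
            rcases List.suffix_concat_iff.1 hcs' with rfl | ⟨ds, rfl, hds⟩
            · exact hl
            · rw [CutTree.plug_append]; exact h4 hm ds hds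
          · rw [CutTree.plug_append]; exact h1.plug_swap
          · rwa [CutTree.plug_append, CutTree.carrier_plug_swap]
          · intro hr cs' hcs'
            rcases List.suffix_concat_iff.1 hcs' with rfl | ⟨ds, rfl, hds⟩
            · exact hr
            · rw [CutTree.plug_append, CutTree.carrier_plug_swap]; exact h4 hm ds hds
        have hPS : ∀ l r, P (.node l r) → (t i).K.G.cutSize (CutTree.node l r).carrier = m →
            IsComposed m L (t i).K l → IsComposed m L (t i).K r →
            ∃ π, ⟨(t i).K, .node l r, π⟩ ∈ S := by
          rintro l r ⟨cs, h1, h2, h3, h4⟩ hm hl hr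
          obtain ⟨π, hπ, hq⟩ := hgood.exists_ordering h1 h2 (hm.trans hcut.symm)
            (by rw [hcut]; exact h4 hm.ge)
          exact ⟨π, ⟨⟨hπ, Or.inr ⟨l, r, rfl, hl, hr⟩⟩, hm⟩, i, h3, hq⟩
        have hroot : P l ∧ P r := by
          have h1 := hgood.minimal
          have h2 : (CutTree.node l r).carrier = (t i).t.carrier := by rw [ht]
          have h3 : (t i).t.size = l.size + r.size + 1 := by rw [ht]; rfl
          rw [ht] at h1
          refine ⟨⟨[r], h1, h2, by omega, ?_⟩, ⟨[l], ?_, ?_, by omega, ?_⟩⟩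
          · intro hl cs' hcs'
            rcases List.suffix_cons_iff.1 hcs' with rfl | hcs'
            · exact (h2 ▸ hcut).ge
            · rw [List.suffix_nil.1 hcs']; exact hl
          · exact CutTree.IsMinimal.plug_swap (cs := []) h1
          · rw [← h2]; exact CutTree.carrier_plug_swap [] l r
          · intro hr cs' hcs'
            rcases List.suffix_cons_iff.1 hcs' with rfl | hcs'
            · rw [show (CutTree.plug [l] r).carrier = (t i).t.carrier from
                (CutTree.carrier_plug_swap [] l r).trans h2]
              exact hcut.ge
            · rw [List.suffix_nil.1 hcs']; exact hr
        exact ⟨hl.refine hP hPS hroot.1, hr.refine hP hPS hroot.2⟩)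
      exact hbad a b hab hle
    have hLD : ∀ p ∈ L ∪ D, p.IsGood k := by
      rintro p (hp | hp)
      · exact hL p hp
      · exact hp.1.1
    -- Now all cuts of size `m` inside are members of `D`.
    refine (ih' hLD (hwqo.union hD)).mono ?_
    rintro p ⟨hgood, hcomp | ⟨l, r, ht, hl, hr⟩⟩
    · exact ⟨hgood, Or.inl (Or.inl hcomp)⟩
    · have hmin := hgood.minimal
      rw [ht] at hmin
      have hP : ∀ l r : CutTree p.K.V, (CutTree.node l r).IsMinimal p.K.G k →
          m ≤ p.K.G.cutSize (CutTree.node l r).carrier →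
          l.IsMinimal p.K.G k ∧ r.IsMinimal p.K.G k := fun l r h _ => h.children
      have hPS : ∀ l r : CutTree p.K.V, (CutTree.node l r).IsMinimal p.K.G k →
          p.K.G.cutSize (CutTree.node l r).carrier = m → IsComposed m L p.K l →
          IsComposed m L p.K r → ∃ π, ⟨p.K, .node l r, π⟩ ∈ D := by
        intro l r h hm hl hr
        have := p.K.finite_E
        obtain ⟨π, hπ⟩ := (Set.toFinite (p.K.G.rho (CutTree.node l r).carrier)).exists_isOrdering
        exact ⟨π, ⟨⟨hgood.wellLinked, hgood.nonempty, h, hπ⟩, Or.inr ⟨l, r, rfl, hl, hr⟩⟩, hm⟩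
      exact ⟨hgood, Or.inr ⟨l, r, ht,
        hl.refine (P := fun t => t.IsMinimal p.K.G k) hP hPS hmin.children.1,
        hr.refine (P := fun t => t.IsMinimal p.K.G k) hP hPS hmin.children.2⟩⟩

/-- Pieces with carvings of bounded width are well-quasi-ordered. -/
theorem partiallyWellOrderedOn_isGood [Preorder Ω] [WellQuasiOrderedLE Ω] (k : ℕ) :
    {p : Piece.{u, v, w} Ω | p.IsGood k}.PartiallyWellOrderedOn Piece.LE := by
  refine (partiallyWellOrderedOn_composedPieces (k + 1) (Nat.zero_add _) (fun p hp => hp.1)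
    (partiallyWellOrderedOn_leaf k)).mono ?_
  intro p hp
  have key : ∀ t : CutTree p.K.V, t.IsMinimal p.K.G k →
      IsComposed 0 {p : Piece.{u, v, w} Ω | p.IsGood k ∧ ∃ S, p.t = .leaf S} p.K t := by
    intro t ht
    induction t with
    | leaf S =>
      have := p.K.finite_E
      obtain ⟨π, hπ⟩ := (Set.toFinite (p.K.G.rho S)).exists_isOrdering
      exact ⟨π, ⟨hp.wellLinked, hp.nonempty, ht, hπ⟩, S, rfl⟩
    | node l r ihl ihr =>
      exact Or.inr ⟨Nat.zero_le _, ihl ht.children.1, ihr ht.children.2⟩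
  refine ⟨hp, ?_⟩
  have hmin := hp.minimal
  cases h : p.t with
  | leaf S => exact Or.inl ⟨hp, S, h⟩
  | node l r =>
    rw [h] at hmin
    exact Or.inr ⟨l, r, rfl, key l hmin.children.1, key r hmin.children.2⟩

end

/-! ### Carvings as binary trees -/

section

open SimpleGraph

variable {N : Type*} {T : SimpleGraph N} {a b c z : N}

theorem SimpleGraph.IsAcyclic.not_reachable_deleteEdges (hT : T.IsAcyclic) (hab : T.Adj a b) :
    ¬ (T.deleteEdges {s(a, b)}).Reachable a b :=
  isBridge_iff.1 (isAcyclic_iff_forall_adj_isBridge.1 hT hab)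

theorem SimpleGraph.IsAcyclic.reachable_deleteEdges_iff (hT : T.IsAcyclic) (hab : T.Adj a b) :
    (T.deleteEdges {s(a, b)}).Reachable a z ↔ ∃ p : T.Walk a z, b ∉ p.support := by
  classical
  rw [reachable_deleteEdges_iff_exists_walk]
  constructor
  · rintro ⟨p, hp⟩
    refine ⟨p, fun hb => hT.not_reachable_deleteEdges hab ?_⟩
    exact reachable_deleteEdges_iff_exists_walk.2
      ⟨p.takeUntil b hb, fun h => hp (p.edges_takeUntil_subset_edges hb h)⟩
  · rintro ⟨p, hp⟩
    exact ⟨p, fun h => hp (p.snd_mem_support_of_mem_edges h)⟩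

theorem SimpleGraph.IsAcyclic.not_reachable_deleteEdges_of_ne (hT : T.IsAcyclic) (hca : T.Adj c a)
    (hba : T.Adj b a) (hbc : b ≠ c) : ¬ (T.deleteEdges {s(c, a)}).Reachable c b := by
  intro h
  refine hT.not_reachable_deleteEdges hca (h.trans (Adj.reachable ?_))
  rw [deleteEdges_adj]
  refine ⟨hba, ?_⟩
  simp only [Set.mem_singleton_iff, Sym2.eq_iff]
  rintro (⟨h, -⟩ | ⟨h, h'⟩)
  · exact hbc h
  · exact hba.ne h

/-- A branch of a tree consists of its first vertex and the branches that start at the further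
neighbours of that vertex. -/
theorem SimpleGraph.IsAcyclic.reachable_deleteEdges_succ (hT : T.IsAcyclic) (hab : T.Adj a b) :
    (T.deleteEdges {s(a, b)}).Reachable a z ↔
      z = a ∨ ∃ c, T.Adj c a ∧ c ≠ b ∧ (T.deleteEdges {s(c, a)}).Reachable c z := by
  classical
  rw [hT.reachable_deleteEdges_iff hab]
  constructor
  · rintro ⟨p, hp⟩
    have hp' : b ∉ p.bypass.support := fun h => hp (p.support_bypass_subset_support h)
    have hpath := p.bypass_isPath
    generalize p.bypass = q at hp' hpath
    cases q with
    | nil => exact Or.inl rfl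
    | @cons _ c _ h q =>
      rw [Walk.cons_isPath_iff] at hpath
      rw [Walk.support_cons, List.mem_cons, not_or] at hp'
      refine Or.inr ⟨c, h.symm, ?_, (hT.reachable_deleteEdges_iff h.symm).2 ⟨q, hpath.2⟩⟩
      rintro rfl
      exact hp'.2 q.start_mem_support
  · rintro (rfl | ⟨c, hca, hcb, hz⟩)
    · exact ⟨.nil, by simpa using hab.ne'⟩
    · obtain ⟨q, hq⟩ := (hT.reachable_deleteEdges_iff hca).1 hz
      refine ⟨.cons hca.symm q, ?_⟩
      rw [Walk.support_cons, List.mem_cons, not_or]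
      refine ⟨hab.ne', fun hb => ?_⟩
      refine hT.not_reachable_deleteEdges_of_ne hca hab.symm hcb.symm
        ((hT.reachable_deleteEdges_iff hca).2 ⟨q.takeUntil b hb, fun h => ?_⟩)
      exact hq (q.support_takeUntil_subset_support hb h)

theorem SimpleGraph.IsAcyclic.branches_disjoint (hT : T.IsAcyclic) (hba : T.Adj b a)
    (hca : T.Adj c a) (hbc : b ≠ c) (hb : (T.deleteEdges {s(b, a)}).Reachable b z) :
    ¬ (T.deleteEdges {s(c, a)}).Reachable c z := by
  intro hc
  obtain ⟨p, hp⟩ := (hT.reachable_deleteEdges_iff hba).1 hb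
  obtain ⟨q, hq⟩ := (hT.reachable_deleteEdges_iff hca).1 hc
  refine hT.not_reachable_deleteEdges_of_ne hca hba hbc
    ((hT.reachable_deleteEdges_iff hca).2 ⟨q.append p.reverse, ?_⟩)
  rw [Walk.mem_support_append_iff, Walk.support_reverse, List.mem_reverse]
  tauto

theorem SimpleGraph.Connected.reachable_deleteEdges_or (hT : T.Connected) (a b z : N) :
    (T.deleteEdges {s(a, b)}).Reachable a z ∨ (T.deleteEdges {s(b, a)}).Reachable b z := by
  rw [Sym2.eq_swap (a := b)]
  obtain ⟨p⟩ := hT.preconnected z a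
  suffices ∀ x y, T.Walk x y → y = a → (T.deleteEdges {s(a, b)}).Reachable a x ∨
    (T.deleteEdges {s(a, b)}).Reachable b x from this z a p rfl
  intro x y p
  induction p with
  | nil => rintro rfl; exact Or.inl (Reachable.refl _)
  | @cons x x' y h p ih =>
    intro hy
    by_cases he : s(x, x') = s(a, b)
    · rcases Sym2.eq_iff.1 he with ⟨rfl, -⟩ | ⟨rfl, -⟩
      · exact Or.inl (Reachable.refl _)
      · exact Or.inr (Reachable.refl _)
    · have hadj : (T.deleteEdges {s(a, b)}).Adj x' x :=
        (deleteEdges_adj.2 ⟨h, he⟩).symm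
      exact (ih hy).imp (fun h => h.trans hadj.reachable) (fun h => h.trans hadj.reachable)

end

namespace Carving

variable {V : Type u} {E : Type v} {G : MultiDigraph V E}

theorem side_swap (c : Carving G) {a b : Fin c.n} (hab : c.T.Adj a b) :
    c.side b a = (c.side a b)ᶜ := by
  ext x
  simp only [side, Set.mem_ofPred_eq, Set.mem_compl_iff]
  refine ⟨fun hb ha => ?_, fun h => ?_⟩
  · rw [Sym2.eq_swap] at hb
    exact c.tree.isAcyclic.not_reachable_deleteEdges hab (ha.trans hb.symm)
  · exact (c.tree.connected.reachable_deleteEdges_or a b _).resolve_left h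

/-- The part of a cubic tree on one side of an edge is a binary tree. -/
theorem exists_cutTree (c : Carving G) {k : ℕ}
    (hk : ∀ a b, c.T.Adj a b → G.cutSize (c.side a b) ≤ k) {a b : Fin c.n} (hab : c.T.Adj a b) :
    ∃ t : CutTree V, t.IsCarving G k ∧ t.carrier = c.side a b := by
  have hT := c.tree.isAcyclic
  induction hn : {z | (c.T.deleteEdges {s(a, b)}).Reachable a z}.ncard using
    Nat.strong_induction_on generalizing a b with
  | _ n ih =>
  subst hn
  rcases c.cubic a with h1 | h3
  · refine ⟨.leaf (c.side a b), ⟨?_, hk a b hab⟩, rfl⟩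
    have key : ∀ x ∈ c.side a b, c.leaf x = a := by
      intro x hx
      refine ((hT.reachable_deleteEdges_succ hab).1 hx).resolve_right ?_
      rintro ⟨d, hda, hdb, -⟩
      obtain ⟨y, hy⟩ := Set.ncard_eq_one.1 h1
      have hd : d ∈ c.T.neighborSet a := hda.symm
      have hb : b ∈ c.T.neighborSet a := hab
      rw [hy] at hd hb
      exact hdb (hd.trans hb.symm)
    exact fun x hx y hy => c.leaf_injective ((key x hx).trans (key y hy).symm)
  · have hb : b ∈ c.T.neighborSet a := hab
    have h2 : (c.T.neighborSet a \ {b}).ncard = 2 := by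
      rw [Set.ncard_sdiff_singleton_of_mem hb, h3]
    obtain ⟨d₁, d₂, hd, hset⟩ := Set.ncard_eq_two.1 h2
    have hmem : ∀ d, c.T.Adj d a ∧ d ≠ b ↔ d = d₁ ∨ d = d₂ := by
      intro d
      have := Set.ext_iff.1 hset d
      simp only [Set.mem_sdiff, SimpleGraph.mem_neighborSet, Set.mem_singleton_iff,
        Set.mem_insert_iff] at this
      rw [← this, c.T.adj_comm]
    have hsucc : ∀ z, (c.T.deleteEdges {s(a, b)}).Reachable a z ↔ z = a ∨
        (c.T.deleteEdges {s(d₁, a)}).Reachable d₁ z ∨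
        (c.T.deleteEdges {s(d₂, a)}).Reachable d₂ z := by
      intro z
      rw [hT.reachable_deleteEdges_succ hab]
      simp only [← and_assoc, hmem, or_and_right, exists_or, exists_eq_left]
    have hlt : ∀ d, c.T.Adj d a ∧ d ≠ b →
        ({z | (c.T.deleteEdges {s(d, a)}).Reachable d z} : Set (Fin c.n)).ncard <
          {z | (c.T.deleteEdges {s(a, b)}).Reachable a z}.ncard := by
      rintro d ⟨hda, hdb⟩
      refine Set.ncard_lt_ncard ⟨fun z hz => ?_, fun h => ?_⟩ (Set.toFinite _)
      · exact (hT.reachable_deleteEdges_succ hab).2 (Or.inr ⟨d, hda, hdb, hz⟩)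
      · exact hT.not_reachable_deleteEdges hda (h (SimpleGraph.Reachable.refl _))
    have hd₁ := (hmem d₁).2 (Or.inl rfl)
    have hd₂ := (hmem d₂).2 (Or.inr rfl)
    obtain ⟨t₁, ht₁, hc₁⟩ := ih _ (hlt d₁ hd₁) hd₁.1 rfl
    obtain ⟨t₂, ht₂, hc₂⟩ := ih _ (hlt d₂ hd₂) hd₂.1 rfl
    have hcar : c.side d₁ a ∪ c.side d₂ a = c.side a b := by
      ext x
      have : c.leaf x ≠ a := by
        rintro h
        have := c.isLeaf x
        rw [h, h3] at this
        omega
      simp only [side, Set.mem_union, Set.mem_ofPred_eq, hsucc, this, false_or]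
    refine ⟨.node t₁ t₂, ⟨ht₁, ht₂, ?_, ?_⟩, ?_⟩
    · rw [hc₁, hc₂, Set.disjoint_left]
      exact fun x h₁ h₂ => hT.branches_disjoint hd₁.1 hd₂.1 hd h₁ h₂
    · rw [hc₁, hc₂, hcar]; exact hk a b hab
    · rw [← hcar, ← hc₁, ← hc₂]; rfl

end Carving

/-! ### Knitworks of bounded carving width -/

theorem RootedEulerianDigraph.exists_rootedCarving {R : RootedEulerianDigraph.{u, v}} {k : ℕ}
    (h : R.carvingWidth ≤ k) : ∃ c : RootedCarving R,
      ∀ a b, c.T.Adj a b → R.G.cutSize (c.toCarving.side a b) ≤ k := by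
  have hlt : R.carvingWidth < (k + 1 : ℕ) := h.trans_lt (by exact_mod_cast Nat.lt_succ_self k)
  obtain ⟨c, hc⟩ := iInf_lt_iff.1 hlt
  refine ⟨c, fun a b hab => ?_⟩
  have h1 : (c.toCarving.eps a b).encard ≤ c.rootedWidth := by
    refine le_trans ?_ (le_max_left _ _)
    refine le_iSup_of_le a (le_iSup_of_le b ?_)
    exact le_iSup (fun _ : c.T.Adj a b => (c.toCarving.eps a b).encard) hab
  have := R.finite_E
  have h2 := h1.trans_lt hc
  rw [← (Set.toFinite (c.toCarving.eps a b)).cast_ncard_eq, Nat.cast_lt] at h2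
  exact Nat.lt_succ_iff.1 h2

/-- A knitwork of carving width at most `k` is made of two complementary pieces with carvings of
width at most `k`, both rooted like the knitwork. -/
theorem Knitwork.exists_isGood {Ω : Type w} {K : Knitwork.{u, v} Ω} {k : ℕ} (hK : K.WellLinked)
    (hV : Nonempty K.V) (hwidth : K.carvingWidth ≤ k) : ∃ s t : CutTree K.V,
      Piece.IsGood k ⟨K, s, K.root⟩ ∧ Piece.IsGood k ⟨K, t, K.root⟩ ∧
      t.carrier = s.carrierᶜ ∧ K.G.rho s.carrier = K.G.rho K.X := by
  obtain ⟨c, hc⟩ := RootedEulerianDigraph.exists_rootedCarving hwidth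
  obtain ⟨s, hs, hs'⟩ := c.toCarving.exists_cutTree hc c.adj
  obtain ⟨t, ht, ht'⟩ := c.toCarving.exists_cutTree hc c.adj.symm
  rw [c.toCarving.side_swap c.adj] at ht'
  obtain ⟨s₀, hs₀, hs₀'⟩ := hs.exists_isMinimal
  obtain ⟨t₀, ht₀, ht₀'⟩ := ht.exists_isMinimal
  have hrho : K.G.rho (c.toCarving.side c.a c.b) = K.G.rho K.X := c.eps_eq
  rw [hs'] at hs₀'
  rw [ht'] at ht₀'
  refine ⟨s₀, t₀, ⟨hK, hV, hs₀, ?_⟩, ⟨hK, hV, ht₀, ?_⟩, ?_, ?_⟩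
  · dsimp only
    rw [hs₀', hrho]; exact K.root_ordering
  · dsimp only
    rw [ht₀', K.G.rho_compl, hrho]; exact K.root_ordering
  · rw [ht₀', hs₀']
  · rw [hs₀', hrho]

theorem Knitwork.StronglyImmersesIn.of_isEmpty {Ω : Type w} [Preorder Ω] {K K' : Knitwork.{u, v} Ω}
    (h : IsEmpty K.V) (h' : IsEmpty K'.V) : K.StronglyImmersesIn K' := by
  have hE : IsEmpty K.E := ⟨fun e => h.elim (K.G.tail e)⟩
  have hE' : IsEmpty K'.E := ⟨fun e => h'.elim (K'.G.tail e)⟩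
  refine ⟨fun x => h.elim x, fun e => hE.elim e, ⟨⟨⟨⟨fun x => h.elim x, fun e => hE.elim e,
    fun e => hE.elim e⟩, fun e => hE.elim e⟩, ?_, fun _ _ e => hE.elim e⟩, fun x => h.elim x,
    fun x => h.elim x, fun x => h.elim x, fun x => h'.elim x, fun x => h.elim x,
    fun x => h.elim x⟩⟩
  have h1 : K.root = [] := List.eq_nil_iff_forall_not_mem.2 fun e => hE.elim e
  have h2 : K'.root = [] := List.eq_nil_iff_forall_not_mem.2 fun e => hE'.elim e
  rw [h1, h2, List.length_nil, List.length_nil]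

theorem mainTheorem3 {Ω : Type w} [Preorder Ω] [WellQuasiOrderedLE Ω] (k : ℕ)
    (K : ℕ → Knitwork.{u, v} Ω) (hlinked : ∀ i, (K i).WellLinked)
    (hwidth : ∀ i, (K i).carvingWidth ≤ (k : ℕ∞)) :
    ∃ i j : ℕ, i < j ∧ (K i).StronglyImmersesIn (K j) := by
  by_cases hempty : ∃ i j, i < j ∧ IsEmpty (K i).V ∧ IsEmpty (K j).V
  · obtain ⟨i, j, hij, h, h'⟩ := hempty
    exact ⟨i, j, hij, .of_isEmpty h h'⟩
  -- At most one of the knitworks has no vertices; drop the terms up to it.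
  obtain ⟨n, hn⟩ : ∃ n, ∀ i, Nonempty (K (n + i)).V := by
    by_cases h : ∃ m, IsEmpty (K m).V
    · obtain ⟨m, hm⟩ := h
      refine ⟨m + 1, fun i => not_isEmpty_iff.1 fun h => hempty ⟨m, m + 1 + i, by omega, hm, h⟩⟩
    · exact ⟨0, fun i => not_isEmpty_iff.1 fun hi => h ⟨_, hi⟩⟩
  choose s t hs ht hst hrho using fun i =>
    Knitwork.exists_isGood (hlinked (n + i)) (hn i) (hwidth (n + i))
  have hwqo := partiallyWellOrderedOn_isGood.{u, v, w} (Ω := Ω) k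
  obtain ⟨φ, hφ, hmono⟩ := hwqo.exists_strictMono
    (f := fun i => ⟨K (n + i), s i, (K (n + i)).root⟩) hs
  obtain ⟨i, j, hij, f₂, g₂, h₂⟩ := hwqo.exists_lt
    (f := fun i => ⟨K (n + φ i), t (φ i), (K (n + φ i)).root⟩) fun i => ht (φ i)
  obtain ⟨f₁, g₁, h₁⟩ := hmono i j hij
  dsimp only at h₂
  rw [hst, hst] at h₂
  exact ⟨_, _, Nat.add_lt_add_left (hφ hij) n, _, _,
    h₁.isStrongKnitworkImmersion h₂ (hrho _) (hrho _)⟩
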